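/- **Setting.** Let $n\ge 1$ and let $q\in\mathbb C$ be nonzero and not a root of unity. Put $(\epsilon_a,\epsilon_b)=\delta_{ab}$, $\alpha_i=\epsilon_i-\epsilon_{i+1}$ for $i<n$, $\alpha_n=\epsilon_n$ and $a_{ij}=2(\alpha_i,\alpha_j)/(\alpha_i,\alpha_i)$. $U_q=U_q(\mathfrak{osp}(1|2n))$ is the $\mathbb Z_2$-graded complex algebra generated by $k_i^{\pm1},e_i,f_i$ ($1\le i\le n$), where $e_n,f_n$ are odd and all other generators are even, with the relations $$k_ik_i^{-1}=k_i^{-1}k_i=1,\quad k_ik_j=k_jk_i,\quad k_ie_j=q^{(\alpha_i,\alpha_j)}e_jk_i,\quad k_if_j=q^{-(\alpha_i,\alpha_j)}f_jk_i,$$ $$[e_i,f_j\}=\delta_{ij}\frac{k_i-k_i^{-1}}{q-q^{-1}},\qquad (\mathrm{Ad}\,e_i)^{1-a_{ij}}(e_j)=0=(\mathrm{Ad}\,f_i)^{1-a_{ij}}(f_j)\quad(i\ne j),$$ where $[\,,\}$ is the graded commutator, $\mathrm{Ad}\,e_i(x)=e_ix-(-1)^{[e_i][x]}k_ixk_i^{-1}e_i$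 and $\mathrm{Ad}\,f_i(x)=f_ix-(-1)^{[f_i][x]}k_ixk_i^{-1}f_i$. It is a $\mathbb Z_2$-graded Hopf algebra with $\Delta(k_i^{\pm1})=k_i^{\pm1}\otimes k_i^{\pm1}$, $\Delta(e_i)=e_i\otimes k_i+1\otimes e_i$, $\Delta(f_i)=f_i\otimes 1+k_i^{-1}\otimes f_i$, antipode $S(k_i)=k_i^{-1}$, $S(e_i)=-e_ik_i^{-1}$, $S(f_i)=-k_if_i$, and co-unit $\epsilon(k_i^{\pm1})=1$, $\epsilon(e_i)=\epsilon(f_i)=0$. For a subset $\Theta\subseteq\{1,\dots,n\}$ let $U_q(\mathfrak k)\subseteq U_q$ be the subalgebra generated by all $k_i^{\pm1}$ and the $e_j,f_j$ with $j\in\Theta$. **Functions.** Let $t$ be the vector representation: for $\mu,\nu\in\{0,\pm1,\dots,\pm n\}$ (with $\epsilon_0=0$, $\epsilon_{-i}=-\epsilon_i$) and $i<n$, $$t(e_i)_{\mu\nu}=\delta_{\mu i}\delta_{\nu,i+1}+\delta_{\mu,-i-1}\delta_{\nu,-i},\quad t(f_i)_{\mu\nu}=\delta_{\mu,i+1}\delta_{\nu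 i}+\delta_{\mu,-i}\delta_{\nu,-i-1},$$ $$t(e_n)_{\mu\nu}=\delta_{\mu n}\delta_{\nu0}-\delta_{\mu0}\delta_{\nu,-n},\quad t(f_n)_{\mu\nu}=\delta_{\mu0}\delta_{\nu n}+\delta_{\mu,-n}\delta_{\nu0},\quad t(k_j)_{\mu\nu}=\delta_{\mu\nu}q^{(\alpha_j,\epsilon_\mu)}.$$ Let $T_q$ be the unital subalgebra of the dual of $U_q$ generated by the matrix elements $t_{\mu\nu}$, for the product $\langle fg,x\rangle=\sum(-1)^{[g][x_{(1)}]}\langle f,x_{(1)}\rangle\langle g,x_{(2)}\rangle$. It is a $\mathbb Z_2$-graded Hopf algebra; its co-multiplication $\Delta(f)=\sum f_{(1)}\otimes f_{(2)}$, antipode and co-unit are determined by $$\langle f,ab\rangle=\sum(-1)^{[f_{(1)}][f_{(2)}]}\langle f_{(1)},a\rangle\langle f_{(2)},b\rangle,\qquad \langle S(f),x\rangle=\langle f,S(x)\rangle,\qquad \epsilon(f)=\langle f,1\rangle.$$ For $x\in U_q$ and $f\in T_q$ put $$x\circ f=\sum(-1)^{[f_{(1)}][f_{(2)}]}f_{(1)}\langle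 f_{(2)},x\rangle,\qquad x\cdot f=\sum\langle f_{(1)},S^{-1}(x)\rangle f_{(2)}.$$ **Sections.** Let $V$ be a finite-dimensional $\mathbb Z_2$-graded $U_q(\mathfrak k)$-module. On $V\otimes T_q$ put $x\circ(v\otimes f)=(-1)^{[x][v]}v\otimes(x\circ f)$ and $x\cdot(v\otimes f)=(-1)^{[x][v]}v\otimes(x\cdot f)$, and let $$\mathcal H_q(V)=\{\zeta\in V\otimes T_q\mid x\circ\zeta=(S(x)\otimes\mathrm{id})\zeta\ \text{ for all } x\in U_q(\mathfrak k)\},$$ where $S(x)$ acts on $V$ by the module structure. Let $P(a\otimes b)=(-1)^{[a][b]}b\otimes a$ be the graded flip of $T_q\otimes T_q$ and $$\omega=\mathrm{id}_V\otimes(\mathrm{id}\otimes S^{-1})P\Delta\colon V\otimes T_q\to V\otimes T_q\otimes T_q .$$ **Proposition.** (i) $\mathcal H_q(V)$ is a $\mathbb Z_2$-graded subspace of $V\otimes T_q$ that is mapped into itself by $\zeta\mapsto x\cdot\zeta$ for every $x\in U_q$, and the action $\cdot$ makes it a ($\mathbb Z_2$-graded) left $U_q$-module. (ii) $\omega$ maps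 $\mathcal H_q(V)$ into $\mathcal H_q(V)\otimes T_q$, and makes it a ($\mathbb Z_2$-graded) right $T_q$-comodule: $(\omega\otimes\mathrm{id})\omega=(\mathrm{id}\otimes\Delta)\omega$ and $(\mathrm{id}\otimes\epsilon)\omega=\mathrm{id}$, and $\omega$ preserves the parity. -/

import Mathlib

set_option linter.unusedSimpArgs false
set_option linter.unnecessarySeqFocus false
set_option linter.unusedSectionVars false
set_option linter.unreachableTactic false
set_option linter.unusedTactic false

open scoped TensorProduct DirectSum

noncomputable section

namespace QOsp

/-- The deformation parameter is generic: nonzero and not a root of unity. -/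
class Generic (q : ℂ) : Prop where
  ne_zero : q ≠ 0
  not_root : ∀ m : ℕ, 0 < m → q ^ m ≠ 1

/-! ### Root data of `osp(1|2n)`; the index `i : Fin n` stands for the node `i + 1`. -/

/-- `α_i = ε_i - ε_{i+1}` for `i < n` and `α_n = ε_n`, in coordinates with respect to `ε`. -/
def simpleRoot {n : ℕ} (i : Fin n) : Fin n → ℤ := fun a =>
  (if a = i then 1 else 0) - (if (a : ℕ) = (i : ℕ) + 1 then 1 else 0)

/-- The inner product `(α_i, α_j)`. -/
def ip {n : ℕ} (i j : Fin n) : ℤ := simpleRoot i ⬝ᵥ simpleRoot j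

/-- The Cartan matrix `a_{ij} = 2 (α_i, α_j) / (α_i, α_i)` (the division is exact). -/
def cartan {n : ℕ} (i j : Fin n) : ℤ := 2 * ip i j / ip i i

/-- `-1` at the odd node `n`, `1` at the even nodes. -/
def nodeSign {n : ℕ} (i : Fin n) : ℂ := if (i : ℕ) + 1 = n then -1 else 1

/-! ### The algebra `U_q(osp(1|2n))` -/

/-- The symbols `k_i`, `k_i⁻¹`, `e_i`, `f_i`. -/
inductive Gen (n : ℕ) : Type
  | k (i : Fin n)
  | kinv (i : Fin n)
  | e (i : Fin n)
  | f (i : Fin n)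

/-- The free algebra on the generators. -/
abbrev FreeU (n : ℕ) : Type := FreeAlgebra ℂ (Gen n)

namespace FreeU

variable {n : ℕ}

def k (i : Fin n) : FreeU n := FreeAlgebra.ι ℂ (Gen.k i)
def kinv (i : Fin n) : FreeU n := FreeAlgebra.ι ℂ (Gen.kinv i)
def e (i : Fin n) : FreeU n := FreeAlgebra.ι ℂ (Gen.e i)
def f (i : Fin n) : FreeU n := FreeAlgebra.ι ℂ (Gen.f i)

/-- The parity automorphism `x ↦ (-1)^{[x]} x`: it fixes `k_i^{±1}`, and `e_j`, `f_j` with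
`j < n`, and changes the sign of `e_n` and `f_n`. -/
def parity (n : ℕ) : FreeU n →ₐ[ℂ] FreeU n :=
  FreeAlgebra.lift ℂ fun g => match g with
    | Gen.k i => k i
    | Gen.kinv i => kinv i
    | Gen.e i => nodeSign i • e i
    | Gen.f i => nodeSign i • f i

/-- The map `x ↦ (-1)^{[e_i][x]} x`. -/
def twist (i : Fin n) : FreeU n →ₐ[ℂ] FreeU n :=
  if (i : ℕ) + 1 = n then parity n else AlgHom.id ℂ _

/-- `Ad e_i (x) = e_i x - (-1)^{[e_i][x]} k_i x k_i⁻¹ e_i`. -/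
def adE (i : Fin n) (x : FreeU n) : FreeU n := e i * x - k i * twist i x * kinv i * e i

/-- `Ad f_i (x) = f_i x - (-1)^{[f_i][x]} k_i x k_i⁻¹ f_i`. -/
def adF (i : Fin n) (x : FreeU n) : FreeU n := f i * x - k i * twist i x * kinv i * f i

end FreeU

open FreeU in
/-- The defining relations of `U_q(osp(1|2n))`. -/
inductive Rel (n : ℕ) (q : ℂ) : FreeU n → FreeU n → Prop
  | k_kinv (i : Fin n) : Rel n q (k i * kinv i) 1
  | kinv_k (i : Fin n) : Rel n q (kinv i * k i) 1
  | k_comm (i j : Fin n) : Rel n q (k i * k j) (k j * k i)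
  | k_e (i j : Fin n) : Rel n q (k i * e j) (q ^ ip i j • (e j * k i))
  | k_f (i j : Fin n) : Rel n q (k i * f j) (q ^ (-ip i j) • (f j * k i))
  | e_f_same (i : Fin n) :
      Rel n q (e i * f i - nodeSign i • (f i * e i)) ((q - q⁻¹)⁻¹ • (k i - kinv i))
  | e_f_ne (i j : Fin n) (hij : i ≠ j) : Rel n q (e i * f j - f j * e i) 0
  | serre_e (i j : Fin n) (hij : i ≠ j) :
      Rel n q ((adE i)^[(1 - cartan i j).toNat] (e j)) 0
  | serre_f (i j : Fin n) (hij : i ≠ j) :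
      Rel n q ((adF i)^[(1 - cartan i j).toNat] (f j)) 0

/-- The quantum superalgebra `U_q(osp(1|2n))`. -/
abbrev Uq (n : ℕ) (q : ℂ) : Type := RingQuot (Rel n q)

namespace Uq

variable (n : ℕ) (q : ℂ)

def mk : FreeU n →ₐ[ℂ] Uq n q := RingQuot.mkAlgHom ℂ (Rel n q)

variable {n}

def k (i : Fin n) : Uq n q := mk n q (FreeU.k i)
def kinv (i : Fin n) : Uq n q := mk n q (FreeU.kinv i)
def e (i : Fin n) : Uq n q := mk n q (FreeU.e i)
def f (i : Fin n) : Uq n q := mk n q (FreeU.f i)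

end Uq

/-! ### Presentation of algebra maps out of `U_q(osp(1|2n))` -/

/-- `X_0 = x`, `X_{m+1} = E X_m - c d^m X_m E`: the iterated quantum adjoint action, written with
its scalar factors. -/
def serreSeq {B : Type*} [Ring B] [Algebra ℂ B] (E x : B) (c d : ℂ) : ℕ → B
  | 0 => x
  | m + 1 => E * serreSeq E x c d m - (c * d ^ m) • (serreSeq E x c d m * E)

/-- The relations of `U_q(osp(1|2n))` for elements of an arbitrary algebra. -/
structure RelHolds {n : ℕ} (q : ℂ) {B : Type*} [Ring B] [Algebra ℂ B]
    (K K' E F : Fin n → B) : Prop where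
  k_kinv : ∀ i, K i * K' i = 1
  kinv_k : ∀ i, K' i * K i = 1
  k_comm : ∀ i j, K i * K j = K j * K i
  k_e : ∀ i j, K i * E j = q ^ ip i j • (E j * K i)
  k_f : ∀ i j, K i * F j = q ^ (-ip i j) • (F j * K i)
  e_f_same : ∀ i, E i * F i - nodeSign i • (F i * E i) = (q - q⁻¹)⁻¹ • (K i - K' i)
  e_f_ne : ∀ i j, i ≠ j → E i * F j = F j * E i
  serre_e : ∀ i j, i ≠ j →
    serreSeq (E i) (E j) (q ^ ip i j) (nodeSign i * q ^ ip i i) (1 - cartan i j).toNat = 0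
  serre_f : ∀ i j, i ≠ j →
    serreSeq (F i) (F j) (q ^ (-ip i j)) (nodeSign i * q ^ (-ip i i)) (1 - cartan i j).toNat = 0

theorem nodeSign_mul_self {n : ℕ} (i : Fin n) : nodeSign i * nodeSign i = 1 := by
  unfold nodeSign; split_ifs <;> norm_num

theorem FreeU.twist_gen {n : ℕ} (i : Fin n) :
    twist i (k i) = k i ∧ twist i (kinv i) = kinv i ∧ twist i (e i) = nodeSign i • e i ∧
      twist i (f i) = nodeSign i • f i := by
  unfold twist nodeSign
  split_ifs with h
  · simp only [parity, k, kinv, e, f, FreeAlgebra.lift_ι_apply, nodeSign, h, if_true, and_self]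
  · simp

theorem FreeU.twist_ne {n : ℕ} {i j : Fin n} (hij : i ≠ j) :
    twist i (e j) = e j ∧ twist i (f j) = f j := by
  unfold twist
  split_ifs with h
  · have : ¬ (j : ℕ) + 1 = n := by
      intro h'; exact hij (Fin.ext (by omega))
    simp only [parity, e, f, FreeAlgebra.lift_ι_apply, nodeSign, this, if_false, one_smul, and_self]
  · simp

section Lift

variable {n : ℕ} {q : ℂ} {B : Type*} [Ring B] [Algebra ℂ B] {K K' E F : Fin n → B}

/-- The map on generators. -/
def genMap (K K' E F : Fin n → B) : Gen n → B
  | Gen.k i => K i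
  | Gen.kinv i => K' i
  | Gen.e i => E i
  | Gen.f i => F i

theorem conj_aux (φ : FreeU n →ₐ[ℂ] B) (i : Fin n) (X : FreeU n) (g : FreeU n) (c d : ℂ) (m : ℕ)
    (Y : B) (hY : φ X = Y) (ht : FreeU.twist i X = nodeSign i ^ m • X)
    (hk : φ (FreeU.k i) * Y = (c * d ^ m) • (Y * φ (FreeU.k i)))
    (hkk : φ (FreeU.k i) * φ (FreeU.kinv i) = 1) :
    φ (g * X - FreeU.k i * FreeU.twist i X * FreeU.kinv i * g) =
      φ g * Y - (c * (nodeSign i * d) ^ m) • (Y * φ g) := by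
  rw [ht]
  simp only [map_sub, map_mul, map_smul, hY, mul_smul_comm, smul_mul_assoc, hk]
  rw [mul_assoc Y, hkk, mul_one, smul_smul, mul_pow]
  congr 2
  ring

theorem adE_aux (φ : FreeU n →ₐ[ℂ] B) {i j : Fin n} (hij : i ≠ j)
    (h1 : φ (FreeU.k i) * φ (FreeU.kinv i) = 1)
    (h2 : ∀ j, φ (FreeU.k i) * φ (FreeU.e j) = q ^ ip i j • (φ (FreeU.e j) * φ (FreeU.k i)))
    (m : ℕ) :
    φ ((FreeU.adE i)^[m] (FreeU.e j)) =
        serreSeq (φ (FreeU.e i)) (φ (FreeU.e j)) (q ^ ip i j) (nodeSign i * q ^ ip i i) m ∧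
      FreeU.twist i ((FreeU.adE i)^[m] (FreeU.e j)) =
        nodeSign i ^ m • ((FreeU.adE i)^[m] (FreeU.e j)) ∧
      φ (FreeU.k i) * φ ((FreeU.adE i)^[m] (FreeU.e j)) =
        (q ^ ip i j * (q ^ ip i i) ^ m) • (φ ((FreeU.adE i)^[m] (FreeU.e j)) * φ (FreeU.k i)) := by
  induction m with
  | zero => simp [serreSeq, (FreeU.twist_ne hij).1, h2]
  | succ m ih =>
    obtain ⟨ih1, ih2, ih3⟩ := ih
    obtain ⟨t1, t2, t3, -⟩ := FreeU.twist_gen i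
    rw [Function.iterate_succ_apply']
    set X := (FreeU.adE i)^[m] (FreeU.e j) with hX
    have key := conj_aux φ i X (FreeU.e i) _ _ m (φ X) rfl ih2 ih3 h1
    have key' : φ (FreeU.adE i X) = _ := key
    refine ⟨?_, ?_, ?_⟩
    · rw [key', ih1, serreSeq]
    · unfold FreeU.adE
      simp only [map_sub, map_mul, ih2, map_smul, t1, t2, t3, mul_smul_comm, smul_mul_assoc,
        smul_sub, pow_succ, smul_smul]
      (congr 2; ring_nf)
    · rw [key', mul_sub, sub_mul, smul_sub, ← mul_assoc, h2 i, mul_smul_comm, ← mul_assoc, ih3,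
        smul_mul_assoc, mul_assoc _ (φ (FreeU.k i)), ih3, smul_mul_assoc, mul_assoc _ (φ (FreeU.k i)),
        h2 i]
      simp only [mul_smul_comm, smul_mul_assoc, smul_smul, mul_assoc]
      congr 2 <;> ring

theorem adF_aux (φ : FreeU n →ₐ[ℂ] B) {i j : Fin n} (hij : i ≠ j)
    (h1 : φ (FreeU.k i) * φ (FreeU.kinv i) = 1)
    (h2 : ∀ j, φ (FreeU.k i) * φ (FreeU.f j) = q ^ (-ip i j) • (φ (FreeU.f j) * φ (FreeU.k i)))
    (m : ℕ) :
    φ ((FreeU.adF i)^[m] (FreeU.f j)) =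
        serreSeq (φ (FreeU.f i)) (φ (FreeU.f j)) (q ^ (-ip i j)) (nodeSign i * q ^ (-ip i i)) m ∧
      FreeU.twist i ((FreeU.adF i)^[m] (FreeU.f j)) =
        nodeSign i ^ m • ((FreeU.adF i)^[m] (FreeU.f j)) ∧
      φ (FreeU.k i) * φ ((FreeU.adF i)^[m] (FreeU.f j)) =
        (q ^ (-ip i j) * (q ^ (-ip i i)) ^ m) •
          (φ ((FreeU.adF i)^[m] (FreeU.f j)) * φ (FreeU.k i)) := by
  induction m with
  | zero => simp only [Function.iterate_zero, id, serreSeq, (FreeU.twist_ne hij).2, h2]; simp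
  | succ m ih =>
    obtain ⟨ih1, ih2, ih3⟩ := ih
    obtain ⟨t1, t2, -, t3⟩ := FreeU.twist_gen i
    rw [Function.iterate_succ_apply']
    set X := (FreeU.adF i)^[m] (FreeU.f j) with hX
    have key := conj_aux φ i X (FreeU.f i) _ _ m (φ X) rfl ih2 ih3 h1
    have key' : φ (FreeU.adF i X) = _ := key
    refine ⟨?_, ?_, ?_⟩
    · rw [key', ih1, serreSeq]
    · unfold FreeU.adF
      simp only [map_sub, map_mul, ih2, map_smul, t1, t2, t3, mul_smul_comm, smul_mul_assoc,
        smul_sub, pow_succ, smul_smul]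
      (congr 2; ring_nf)
    · rw [key', mul_sub, sub_mul, smul_sub, ← mul_assoc, h2 i, mul_smul_comm, ← mul_assoc, ih3,
        smul_mul_assoc, mul_assoc _ (φ (FreeU.k i)), ih3, smul_mul_assoc, mul_assoc _ (φ (FreeU.k i)),
        h2 i]
      simp only [mul_smul_comm, smul_mul_assoc, smul_smul, mul_assoc]
      congr 2 <;> ring

theorem lift_rel (h : RelHolds q K K' E F) ⦃x y : FreeU n⦄ (hxy : Rel n q x y) :
    FreeAlgebra.lift ℂ (genMap K K' E F) x = FreeAlgebra.lift ℂ (genMap K K' E F) y := by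
  set φ := FreeAlgebra.lift ℂ (genMap K K' E F) with hφ
  have hk : ∀ i, φ (FreeU.k i) = K i := fun i => by simp [hφ, FreeU.k, genMap]
  have hk' : ∀ i, φ (FreeU.kinv i) = K' i := fun i => by simp [hφ, FreeU.kinv, genMap]
  have he : ∀ i, φ (FreeU.e i) = E i := fun i => by simp [hφ, FreeU.e, genMap]
  have hf : ∀ i, φ (FreeU.f i) = F i := fun i => by simp [hφ, FreeU.f, genMap]
  cases hxy with
  | k_kinv i => simp [hk, hk', h.k_kinv]
  | kinv_k i => simp [hk, hk', h.kinv_k]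
  | k_comm i j => simp only [map_mul, hk, h.k_comm i j]
  | k_e i j => simp only [map_mul, map_smul, hk, he, h.k_e]
  | k_f i j => simp only [map_mul, map_smul, hk, hf, h.k_f]
  | e_f_same i => simp only [map_sub, map_mul, map_smul, hk, hk', he, hf, h.e_f_same]
  | e_f_ne i j hij => simp only [map_sub, map_mul, he, hf, h.e_f_ne i j hij, sub_self, map_zero]
  | serre_e i j hij =>
    rw [(adE_aux (q := q) φ hij (by rw [hk, hk', h.k_kinv])
      (fun j => by rw [hk, he, h.k_e]) _).1, he, he, h.serre_e i j hij, map_zero]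
  | serre_f i j hij =>
    rw [(adF_aux (q := q) φ hij (by rw [hk, hk', h.k_kinv])
      (fun j => by rw [hk, hf, h.k_f]) _).1, hf, hf, h.serre_f i j hij, map_zero]

/-- The algebra map out of `U_q(osp(1|2n))` with prescribed values on the generators. -/
def Uq.lift (h : RelHolds q K K' E F) : Uq n q →ₐ[ℂ] B :=
  RingQuot.liftAlgHom ℂ ⟨FreeAlgebra.lift ℂ (genMap K K' E F), lift_rel h⟩

theorem Uq.lift_k (h : RelHolds q K K' E F) (i : Fin n) : Uq.lift h (Uq.k q i) = K i := by
  simp [Uq.lift, Uq.k, Uq.mk, FreeU.k, genMap]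

theorem Uq.lift_kinv (h : RelHolds q K K' E F) (i : Fin n) :
    Uq.lift h (Uq.kinv q i) = K' i := by
  simp [Uq.lift, Uq.kinv, Uq.mk, FreeU.kinv, genMap]

theorem Uq.lift_e (h : RelHolds q K K' E F) (i : Fin n) : Uq.lift h (Uq.e q i) = E i := by
  simp [Uq.lift, Uq.e, Uq.mk, FreeU.e, genMap]

theorem Uq.lift_f (h : RelHolds q K K' E F) (i : Fin n) : Uq.lift h (Uq.f q i) = F i := by
  simp [Uq.lift, Uq.f, Uq.mk, FreeU.f, genMap]

end Lift

theorem Uq.hom_ext {n : ℕ} {q : ℂ} {B : Type*} [Semiring B] [Algebra ℂ B]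
    {φ ψ : Uq n q →ₐ[ℂ] B}
    (hk : ∀ i, φ (Uq.k q i) = ψ (Uq.k q i)) (hk' : ∀ i, φ (Uq.kinv q i) = ψ (Uq.kinv q i))
    (he : ∀ i, φ (Uq.e q i) = ψ (Uq.e q i)) (hf : ∀ i, φ (Uq.f q i) = ψ (Uq.f q i)) : φ = ψ := by
  apply RingQuot.ringQuot_ext'
  apply FreeAlgebra.hom_ext
  funext g
  cases g with
  | k i => exact hk i
  | kinv i => exact hk' i
  | e i => exact he i
  | f i => exact hf i

theorem Uq.relHolds (n : ℕ) (q : ℂ) :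
    RelHolds (n := n) q (Uq.k q) (Uq.kinv q) (Uq.e q) (Uq.f q) := by
  have H : ∀ {x y : FreeU n}, Rel n q x y → Uq.mk n q x = Uq.mk n q y := fun h =>
    RingQuot.mkAlgHom_rel ℂ h
  have hkk : ∀ i : Fin n, Uq.k q i * Uq.kinv q i = 1 := fun i => by
    have := H (Rel.k_kinv i); simpa [Uq.k, Uq.kinv] using this
  have hke : ∀ i j : Fin n, Uq.k q i * Uq.e q j = q ^ ip i j • (Uq.e q j * Uq.k q i) :=
    fun i j => by
      have := H (Rel.k_e i j)
      simp only [map_mul, map_smul] at this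
      exact this
  have hkf : ∀ i j : Fin n, Uq.k q i * Uq.f q j = q ^ (-ip i j) • (Uq.f q j * Uq.k q i) :=
    fun i j => by
      have := H (Rel.k_f i j)
      simp only [map_mul, map_smul] at this
      exact this
  refine ⟨hkk, fun i => ?_, fun i j => ?_, hke, hkf, fun i => ?_, fun i j hij => ?_,
    fun i j hij => ?_, fun i j hij => ?_⟩
  · have := H (Rel.kinv_k i)
    simp only [map_mul, map_one] at this
    exact this
  · have := H (Rel.k_comm i j)
    simp only [map_mul] at this
    exact this
  · have := H (Rel.e_f_same i)
    simp only [map_mul, map_sub, map_smul] at this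
    exact this
  · have := H (Rel.e_f_ne i j hij)
    rw [map_sub, map_zero, sub_eq_zero, map_mul, map_mul] at this
    exact this
  · have := H (Rel.serre_e i j hij)
    rwa [(adE_aux (q := q) (Uq.mk n q) hij (hkk i) (hke i) _).1, map_zero] at this
  · have := H (Rel.serre_f i j hij)
    rwa [(adF_aux (q := q) (Uq.mk n q) hij (hkk i) (hkf i) _).1, map_zero] at this

/-! ### Root computations -/

section Roots

variable {n : ℕ}

theorem root_dot (i : Fin n) (v : Fin n → ℤ) :
    simpleRoot i ⬝ᵥ v = v i - (if h : (i : ℕ) + 1 < n then v ⟨i + 1, h⟩ else 0) := by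
  unfold dotProduct simpleRoot
  simp only [sub_mul, ite_mul, one_mul, zero_mul, Finset.sum_sub_distrib, Finset.sum_ite_eq',
    Finset.mem_univ, if_true]
  congr 1
  split_ifs with h
  · rw [Finset.sum_eq_single (⟨i + 1, h⟩ : Fin n)]
    · simp
    · intro b _ hb
      rw [if_neg]
      intro hb'
      exact hb (Fin.ext hb')
    · simp
  · apply Finset.sum_eq_zero
    intro x _
    rw [if_neg]
    have := x.2
    omega

theorem ip_eq (i j : Fin n) : ip i j =
    if i = j then (if (i : ℕ) + 1 = n then 1 else 2)
    else if (i : ℕ) + 1 = j ∨ (j : ℕ) + 1 = i then -1 else 0 := by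
  unfold ip
  rw [root_dot]
  have := i.2
  have := j.2
  unfold simpleRoot
  simp only [Fin.ext_iff]
  split_ifs <;> omega

theorem ip_comm (i j : Fin n) : ip i j = ip j i := dotProduct_comm _ _

/-- The three shapes of a quantum Serre relation. -/
def SerreCase (m : ℕ) (c d : ℂ) : Prop :=
  c ≠ 0 ∧ d ≠ 0 ∧ ((m = 1 ∧ c = 1) ∨ (m = 2 ∧ c ^ 2 * d = 1) ∨ (m = 3 ∧ c * d = -1))

theorem nodeSign_ne_zero (i : Fin n) : nodeSign i ≠ 0 := by
  unfold nodeSign; split_ifs <;> norm_num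

theorem serreCase_e {q : ℂ} (hq : q ≠ 0) {i j : Fin n} (hij : i ≠ j) :
    SerreCase (1 - cartan i j).toNat (q ^ ip i j) (nodeSign i * q ^ ip i i) := by
  refine ⟨zpow_ne_zero _ hq, mul_ne_zero (nodeSign_ne_zero i) (zpow_ne_zero _ hq), ?_⟩
  unfold cartan nodeSign
  rw [ip_eq, ip_eq, if_neg hij, if_pos rfl]
  by_cases h1 : (i : ℕ) + 1 = j ∨ (j : ℕ) + 1 = i
  · by_cases h2 : (i : ℕ) + 1 = n
    · right; right
      simp only [if_pos h1, if_pos h2]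
      refine ⟨by decide, ?_⟩
      simp [hq]
    · right; left
      simp only [if_pos h1, if_neg h2]
      refine ⟨by decide, ?_⟩
      have : q ^ (2 : ℤ) = q ^ 2 := by norm_cast
      rw [this, zpow_neg_one]
      field_simp
  · left
    simp [if_neg h1]

theorem SerreCase.inv {m : ℕ} {c d : ℂ} (h : SerreCase m c d) : SerreCase m c⁻¹ d⁻¹ := by
  obtain ⟨hc, hd, h⟩ := h
  refine ⟨inv_ne_zero hc, inv_ne_zero hd, ?_⟩
  rcases h with ⟨h, h'⟩ | ⟨h, h'⟩ | ⟨h, h'⟩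
  · left; simp [h, h']
  · right; left
    refine ⟨h, ?_⟩
    rw [inv_pow, ← mul_inv, h', inv_one]
  · right; right
    refine ⟨h, ?_⟩
    rw [← mul_inv, h']; norm_num

theorem nodeSign_inv (i : Fin n) : (nodeSign i)⁻¹ = nodeSign i := by
  unfold nodeSign; split_ifs <;> norm_num

theorem serreCase_f {q : ℂ} (hq : q ≠ 0) {i j : Fin n} (hij : i ≠ j) :
    SerreCase (1 - cartan i j).toNat (q ^ (-ip i j)) (nodeSign i * q ^ (-ip i i)) := by
  have := (serreCase_e hq hij).inv
  rwa [mul_inv, nodeSign_inv, ← zpow_neg, ← zpow_neg] at this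

end Roots

/-! ### Manipulating Serre relations -/

section Serre

variable {B : Type*} [Ring B] [Algebra ℂ B]

theorem serreSeq_map {C : Type*} [Ring C] [Algebra ℂ C] (φ : B →ₐ[ℂ] C) (E x : B) (c d : ℂ)
    (m : ℕ) : φ (serreSeq E x c d m) = serreSeq (φ E) (φ x) c d m := by
  induction m with
  | zero => rfl
  | succ m ih => simp only [serreSeq, map_sub, map_mul, map_smul, ih]

theorem serreSeq_smul (E x : B) (c d z w : ℂ) (m : ℕ) :
    serreSeq (z • E) (w • x) c d m = (z ^ m * w) • serreSeq E x c d m := by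
  induction m with
  | zero => simp [serreSeq]
  | succ m ih =>
    simp only [serreSeq, ih, smul_sub, smul_mul_assoc, mul_smul_comm, smul_smul]
    congr 2 <;> ring

theorem serreSeq_twist {E x κ l : B} {a b : ℂ} (h1 : κ * E = a • (E * κ))
    (h2 : κ * x = b • (x * κ)) (h3 : l * E = b • (E * l)) (h4 : κ * l = l * κ) (c d : ℂ) (m : ℕ) :
    (∃ t : ℂ, serreSeq (E * κ) (x * l) c d m = t • (serreSeq E x c d m * κ ^ m * l)) := by
  have hκ : ∀ m, κ * serreSeq E x c d m = (a ^ m * b) • (serreSeq E x c d m * κ) := by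
    intro m
    induction m with
    | zero => simp [serreSeq, h2]
    | succ m ih =>
      simp only [serreSeq, mul_sub, sub_mul, smul_sub, mul_smul_comm, smul_mul_assoc]
      rw [← mul_assoc, h1, ← mul_assoc, ih, smul_mul_assoc, mul_assoc E κ, ih, smul_mul_assoc,
        mul_assoc _ κ E, h1]
      simp only [mul_smul_comm, smul_mul_assoc, smul_smul, mul_assoc]
      congr 2 <;> ring
  have hE : ∀ m : ℕ, κ ^ m * E = a ^ m • (E * κ ^ m) := by
    intro m
    induction m with
    | zero => simp
    | succ m ih =>
      rw [pow_succ, mul_assoc, h1, mul_smul_comm, ← mul_assoc, ih, smul_mul_assoc, smul_smul,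
        mul_assoc, pow_succ, mul_comm a]
  induction m with
  | zero => exact ⟨1, by simp [serreSeq]⟩
  | succ m ih =>
    obtain ⟨t, ht⟩ := ih
    refine ⟨t * (a ^ m * b), ?_⟩
    have hl : κ ^ m * l = l * κ ^ m := (Commute.pow_left h4 m : Commute (κ ^ m) l)
    have e1 : E * κ * (serreSeq E x c d m * κ ^ m * l) =
        (a ^ m * b) • (E * serreSeq E x c d m * κ ^ (m + 1) * l) := by
      rw [show E * κ * (serreSeq E x c d m * κ ^ m * l) =
        E * (κ * serreSeq E x c d m) * κ ^ m * l by simp only [mul_assoc], hκ]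
      simp only [mul_smul_comm, smul_mul_assoc, mul_assoc, pow_succ']
    have e2 : serreSeq E x c d m * κ ^ m * l * (E * κ) =
        (a ^ m * b) • (serreSeq E x c d m * E * κ ^ (m + 1) * l) := by
      rw [show serreSeq E x c d m * κ ^ m * l * (E * κ) =
        serreSeq E x c d m * κ ^ m * (l * E) * κ by simp only [mul_assoc], h3]
      rw [mul_smul_comm, smul_mul_assoc,
        show serreSeq E x c d m * κ ^ m * (E * l) * κ =
          serreSeq E x c d m * (κ ^ m * E) * (l * κ) by simp only [mul_assoc], hE, ← h4]
      simp only [mul_smul_comm, smul_mul_assoc, smul_smul, mul_assoc, pow_succ]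
      congr 1; ring
    rw [serreSeq, ht, mul_smul_comm, smul_mul_assoc, e1, e2, serreSeq]
    simp only [sub_mul, smul_sub, smul_mul_assoc, smul_smul]
    congr 2
    ring

theorem serreSeq_op (E x : B) {c d : ℂ} (hc : c ≠ 0) (hd : d ≠ 0) (m : ℕ) :
    ∃ t : ℂ, serreSeq (MulOpposite.op E) (MulOpposite.op x) c d m =
      t • MulOpposite.op (serreSeq E x c⁻¹ d⁻¹ m) := by
  induction m with
  | zero => exact ⟨1, by simp [serreSeq]⟩
  | succ m ih =>
    obtain ⟨t, ht⟩ := ih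
    refine ⟨-t * (c * d ^ m), ?_⟩
    have hne : c * d ^ m ≠ 0 := mul_ne_zero hc (pow_ne_zero _ hd)
    have h : (-t * (c * d ^ m)) * (c⁻¹ * d⁻¹ ^ m) = -t := by
      rw [inv_pow, ← mul_inv, mul_assoc, mul_inv_cancel₀ hne, mul_one]
    rw [serreSeq, ht, serreSeq, MulOpposite.op_sub, MulOpposite.op_smul, smul_sub, smul_smul, h,
      MulOpposite.op_mul, MulOpposite.op_mul]
    simp only [mul_smul_comm, smul_mul_assoc, smul_smul, neg_mul, neg_smul, sub_neg_eq_add]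
    rw [add_comm, ← sub_eq_add_neg, mul_comm t]

theorem serreSeq_inv {E x : B} {c d : ℂ} {m : ℕ} (h : SerreCase m c d)
    (h0 : serreSeq E x c d m = 0) : serreSeq E x c⁻¹ d⁻¹ m = 0 := by
  obtain ⟨hc, hd, ⟨rfl, rfl⟩ | ⟨rfl, h'⟩ | ⟨rfl, h'⟩⟩ := h
  · simpa [serreSeq] using h0
  · have : d = (c ^ 2)⁻¹ := by field_simp; linear_combination h'
    subst this
    rw [← h0]
    simp only [serreSeq, mul_sub, sub_mul, smul_sub, mul_smul_comm, smul_mul_assoc, smul_smul,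
      mul_assoc, pow_zero, pow_one, mul_one]
    match_scalars <;> field_simp <;> ring
  · have : d = -c⁻¹ := by field_simp; linear_combination h'
    subst this
    rw [← h0]
    simp only [serreSeq, mul_sub, sub_mul, smul_sub, mul_smul_comm, smul_mul_assoc, smul_smul,
      mul_assoc, pow_zero, pow_one, mul_one]
    match_scalars <;> field_simp <;> ring

theorem serreSeq_op_zero {E x : B} {c d : ℂ} {m : ℕ} (h : SerreCase m c d)
    (h0 : serreSeq E x c d m = 0) :
    serreSeq (MulOpposite.op E) (MulOpposite.op x) c d m = 0 := by
  obtain ⟨t, ht⟩ := serreSeq_op E x h.1 h.2.1 m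
  rw [ht, serreSeq_inv h h0, MulOpposite.op_zero, smul_zero]

theorem serreSeq_add {A A' C D : B} {c d : ℂ} {m : ℕ} (h : SerreCase m c d)
    (h1 : A * A' = d • (A' * A)) (h2 : A * D = c • (D * A)) (h3 : C * A' = c • (A' * C))
    (hA : serreSeq A C c d m = 0) (hA' : serreSeq A' D c d m = 0) :
    serreSeq (A + A') (C + D) c d m = 0 := by
  have r1 : ∀ Z, A * (A' * Z) = d • (A' * (A * Z)) := fun Z => by
    rw [← mul_assoc, h1, smul_mul_assoc, mul_assoc]
  have r2 : ∀ Z, A * (D * Z) = c • (D * (A * Z)) := fun Z => by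
    rw [← mul_assoc, h2, smul_mul_assoc, mul_assoc]
  have r3 : ∀ Z, C * (A' * Z) = c • (A' * (C * Z)) := fun Z => by
    rw [← mul_assoc, h3, smul_mul_assoc, mul_assoc]
  have hsum : serreSeq (A + A') (C + D) c d m = serreSeq A C c d m + serreSeq A' D c d m := by
    obtain ⟨hc, hd, ⟨rfl, rfl⟩ | ⟨rfl, h'⟩ | ⟨rfl, h'⟩⟩ := h
    · simp only [serreSeq, mul_sub, sub_mul, smul_sub, mul_smul_comm, smul_mul_assoc, smul_smul,
        mul_assoc, pow_zero, pow_one, mul_one, mul_add, add_mul, smul_add, r1, r2, r3, h1, h2, h3]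
      module
    · have : d = (c ^ 2)⁻¹ := by field_simp; linear_combination h'
      subst this
      simp only [serreSeq, mul_sub, sub_mul, smul_sub, mul_smul_comm, smul_mul_assoc, smul_smul,
        mul_assoc, pow_zero, pow_one, mul_one, mul_add, add_mul, smul_add, r1, r2, r3, h1, h2, h3]
      match_scalars <;> field_simp <;> ring
    · have : d = -c⁻¹ := by field_simp; linear_combination h'
      subst this
      simp only [serreSeq, mul_sub, sub_mul, smul_sub, mul_smul_comm, smul_mul_assoc, smul_smul,
        mul_assoc, pow_zero, pow_one, mul_one, mul_add, add_mul, smul_add, r1, r2, r3, h1, h2, h3]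
      match_scalars <;> field_simp <;> ring
  rw [hsum, hA, hA', add_zero]

end Serre

/-! ### The vector representation -/

section VectorRep

variable {n : ℕ}

/-- The index set `{0, ±1, …, ±n}`. -/
abbrev Idx (n : ℕ) : Type := Finset.Icc (-(n : ℤ)) n

/-- The weight `ε_μ`, where `ε_0 = 0` and `ε_{-i} = -ε_i`. -/
def wt (μ : Idx n) : Fin n → ℤ := fun a =>
  if (μ : ℤ) = a + 1 then 1 else if (μ : ℤ) = -(a + 1) then -1 else 0

/-- The Kronecker symbol `δ_{a b}`. -/
def kd (a b : ℤ) : ℂ := if a = b then 1 else 0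

/-- The matrix of `e_i`. -/
def tE (i : Fin n) : Matrix (Idx n) (Idx n) ℂ := Matrix.of fun μ ν =>
  if (i : ℕ) + 1 = n then kd μ n * kd ν 0 - kd μ 0 * kd ν (-n)
  else kd μ (i + 1) * kd ν (i + 1 + 1) + kd μ (-(i + 1) - 1) * kd ν (-(i + 1))

/-- The matrix of `f_i`. -/
def tF (i : Fin n) : Matrix (Idx n) (Idx n) ℂ := Matrix.of fun μ ν =>
  if (i : ℕ) + 1 = n then kd μ 0 * kd ν n + kd μ (-n) * kd ν 0
  else kd μ (i + 1 + 1) * kd ν (i + 1) + kd μ (-(i + 1)) * kd ν (-(i + 1) - 1)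

/-- The matrix of `k_i`. -/
def tK (q : ℂ) (i : Fin n) : Matrix (Idx n) (Idx n) ℂ :=
  Matrix.diagonal fun μ => q ^ (simpleRoot i ⬝ᵥ wt μ)

/-- The matrix of `k_i⁻¹`. -/
def tKinv (q : ℂ) (i : Fin n) : Matrix (Idx n) (Idx n) ℂ :=
  Matrix.diagonal fun μ => q ^ (-(simpleRoot i ⬝ᵥ wt μ))

/-- The matrix `M` shifts weights by `β`. -/
def HasWeight (β : Fin n → ℤ) (M : Matrix (Idx n) (Idx n) ℂ) : Prop :=
  ∀ μ ν, M μ ν ≠ 0 → wt μ = wt ν + β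

theorem HasWeight.mul {β γ : Fin n → ℤ} {M N : Matrix (Idx n) (Idx n) ℂ} (hM : HasWeight β M)
    (hN : HasWeight γ N) : HasWeight (β + γ) (M * N) := by
  intro μ ν h
  rw [Matrix.mul_apply] at h
  obtain ⟨s, -, hs⟩ := Finset.exists_ne_zero_of_sum_ne_zero h
  rw [hM μ s (left_ne_zero_of_mul hs), hN s ν (right_ne_zero_of_mul hs)]
  abel

theorem HasWeight.smul {β : Fin n → ℤ} {M : Matrix (Idx n) (Idx n) ℂ} (hM : HasWeight β M)
    (c : ℂ) : HasWeight β (c • M) := by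
  intro μ ν h
  rw [Matrix.smul_apply, smul_eq_mul] at h
  exact hM μ ν (right_ne_zero_of_mul h)

theorem HasWeight.sub {β : Fin n → ℤ} {M N : Matrix (Idx n) (Idx n) ℂ} (hM : HasWeight β M)
    (hN : HasWeight β N) : HasWeight β (M - N) := by
  intro μ ν h
  by_cases h1 : M μ ν = 0
  · refine hN μ ν fun h2 => h ?_
    rw [Matrix.sub_apply, h1, h2, sub_zero]
  · exact hM μ ν h1

theorem HasWeight.serreSeq {β γ : Fin n → ℤ} {M N : Matrix (Idx n) (Idx n) ℂ}
    (hM : HasWeight β M) (hN : HasWeight γ N) (c d : ℂ) (m : ℕ) :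
    HasWeight (m • β + γ) (serreSeq M N c d m) := by
  induction m with
  | zero => simpa [QOsp.serreSeq] using hN
  | succ m ih =>
    have h1 := hM.mul ih
    have h2 := (ih.mul hM).smul (c * d ^ m)
    have e1 : β + (m • β + γ) = (m + 1) • β + γ := by rw [succ_nsmul]; abel
    have e2 : m • β + γ + β = (m + 1) • β + γ := by rw [succ_nsmul]; abel
    rw [e1] at h1
    rw [e2] at h2
    exact h1.sub h2

theorem HasWeight.comm {β : Fin n → ℤ} {M : Matrix (Idx n) (Idx n) ℂ} (hM : HasWeight β M) {q : ℂ}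
    (hq : q ≠ 0) (i : Fin n) : tK q i * M = q ^ (simpleRoot i ⬝ᵥ β) • (M * tK q i) := by
  ext μ ν
  rw [tK, Matrix.diagonal_mul, Matrix.smul_apply, Matrix.mul_diagonal]
  by_cases h : M μ ν = 0
  · simp [h]
  · rw [hM μ ν h, dotProduct_add, zpow_add₀ hq, smul_eq_mul]
    ring

theorem tE_weight (i : Fin n) : HasWeight (simpleRoot i) (tE i) := by
  intro μ ν h
  have hi := i.2
  unfold tE kd at h
  rw [Matrix.of_apply] at h
  funext a
  have ha := a.2
  simp only [Pi.add_apply, Pi.neg_apply, wt, simpleRoot, Fin.ext_iff]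
  by_cases hn : (i : ℕ) + 1 = n
  · have hz : ((μ : ℤ) = n ∧ (ν : ℤ) = 0) ∨ ((μ : ℤ) = 0 ∧ (ν : ℤ) = -n) := by
      by_contra hc
      apply h
      rw [if_pos hn]
      split_ifs <;> first | omega | norm_num
    clear h
    rcases hz with ⟨h1, h2⟩ | ⟨h1, h2⟩ <;> omega
  · have hz : ((μ : ℤ) = i + 1 ∧ (ν : ℤ) = i + 1 + 1) ∨
        ((μ : ℤ) = -(i + 1) - 1 ∧ (ν : ℤ) = -(i + 1)) := by
      by_contra hc
      apply h
      rw [if_neg hn]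
      split_ifs <;> first | omega | norm_num
    clear h
    rcases hz with ⟨h1, h2⟩ | ⟨h1, h2⟩ <;> omega

theorem tF_weight (i : Fin n) : HasWeight (-simpleRoot i) (tF i) := by
  intro μ ν h
  have hi := i.2
  unfold tF kd at h
  rw [Matrix.of_apply] at h
  funext a
  have ha := a.2
  simp only [Pi.add_apply, Pi.neg_apply, wt, simpleRoot, Fin.ext_iff]
  by_cases hn : (i : ℕ) + 1 = n
  · have hz : ((μ : ℤ) = 0 ∧ (ν : ℤ) = n) ∨ ((μ : ℤ) = -n ∧ (ν : ℤ) = 0) := by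
      by_contra hc
      apply h
      rw [if_pos hn]
      split_ifs <;> first | omega | norm_num
    clear h
    rcases hz with ⟨h1, h2⟩ | ⟨h1, h2⟩ <;> omega
  · have hz : ((μ : ℤ) = i + 1 + 1 ∧ (ν : ℤ) = i + 1) ∨
        ((μ : ℤ) = -(i + 1) ∧ (ν : ℤ) = -(i + 1) - 1) := by
      by_contra hc
      apply h
      rw [if_neg hn]
      split_ifs <;> first | omega | norm_num
    clear h
    rcases hz with ⟨h1, h2⟩ | ⟨h1, h2⟩ <;> omega

/-- No two weights differ by `±β` when `β` is too large. -/
theorem eq_zero_of_weight {β : Fin n → ℤ} {M : Matrix (Idx n) (Idx n) ℂ} (hM : HasWeight β M)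
    (hβ : ∀ μ ν : Idx n, wt μ ≠ wt ν + β) : M = 0 := by
  ext μ ν
  by_contra h
  exact hβ μ ν (hM μ ν h)

theorem wt_two (μ : Idx n) {a b : Fin n} (hab : (a : ℕ) ≠ b) :
    (wt μ a).natAbs + (wt μ b).natAbs ≤ 1 := by
  unfold wt
  split_ifs <;> omega

theorem wt_three (μ : Idx n) {a b c : Fin n} (hab : (a : ℕ) ≠ b) (hac : (a : ℕ) ≠ c)
    (hbc : (b : ℕ) ≠ c) : (wt μ a).natAbs + (wt μ b).natAbs + (wt μ c).natAbs ≤ 1 := by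
  have h1 := wt_two μ hab
  have h2 := wt_two μ hac
  have h3 := wt_two μ hbc
  omega

theorem no_weight_aux {β : Fin n → ℤ} (h : (∃ a b : Fin n, (a : ℕ) ≠ b ∧
    2 < (β a).natAbs + (β b).natAbs) ∨ ∃ a b c : Fin n, (a : ℕ) ≠ b ∧ (a : ℕ) ≠ c ∧ (b : ℕ) ≠ c ∧
    2 < (β a).natAbs + (β b).natAbs + (β c).natAbs) (μ ν : Idx n) : wt μ ≠ wt ν + β := by
  intro h0
  have key : ∀ a : Fin n, wt μ a = wt ν a + β a := fun a => congrFun h0 a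
  rcases h with ⟨a, b, hab, h⟩ | ⟨a, b, c, hab, hac, hbc, h⟩
  · have h1 := wt_two μ hab
    have h2 := wt_two ν hab
    have := key a
    have := key b
    omega
  · have h1 := wt_three μ hab hac hbc
    have h2 := wt_three ν hab hac hbc
    have := key a
    have := key b
    have := key c
    omega

theorem root_self (i : Fin n) : simpleRoot i i = 1 := by
  unfold simpleRoot; simp

theorem root_succ {i j : Fin n} (h : (i : ℕ) + 1 = j) : simpleRoot i j = -1 := by
  unfold simpleRoot
  simp only [Fin.ext_iff]
  split_ifs <;> omega

theorem root_other {i j : Fin n} (h : (j : ℕ) ≠ i) (h' : (j : ℕ) ≠ i + 1) :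
    simpleRoot i j = 0 := by
  unfold simpleRoot
  simp only [Fin.ext_iff]
  split_ifs <;> omega

theorem no_weight_lin {i j : Fin n} (hij : i ≠ j) (s t : ℤ) (hs : s ≠ 0) (ht : t ≠ 0)
    (h1 : (i : ℕ) + 1 = j → 2 < s.natAbs + (t - s).natAbs)
    (h2 : (j : ℕ) + 1 = i → (i : ℕ) + 1 = n → 2 < t.natAbs + (s - t).natAbs)
    (h3 : (j : ℕ) + 1 = i → (i : ℕ) + 1 ≠ n → 2 < t.natAbs + (s - t).natAbs + s.natAbs)
    (μ ν : Idx n) : wt μ ≠ wt ν + (s • simpleRoot i + t • simpleRoot j) := by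
  have hi := i.2
  have hj := j.2
  have hij' : (i : ℕ) ≠ j := fun h => hij (Fin.ext h)
  have hβ : ∀ a, (s • simpleRoot i + t • simpleRoot j) a = s * simpleRoot i a + t * simpleRoot j a :=
    fun a => by simp
  apply no_weight_aux
  simp only [hβ]
  by_cases c1 : (i : ℕ) + 1 = j
  · left
    refine ⟨i, j, hij', ?_⟩
    rw [root_self, root_self, root_succ c1, root_other (i := j) (j := i) (by omega) (by omega)]
    have := h1 c1
    omega
  by_cases c2 : (j : ℕ) + 1 = i
  · by_cases c3 : (i : ℕ) + 1 = n
    · left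
      refine ⟨j, i, hij'.symm, ?_⟩
      rw [root_self, root_self, root_succ c2, root_other (i := i) (j := j) (by omega) (by omega)]
      have := h2 c2 c3
      omega
    · right
      refine ⟨j, i, ⟨i + 1, by omega⟩, hij'.symm, by simp only []; omega, by simp, ?_⟩
      rw [root_self, root_self, root_succ c2, root_other (i := i) (j := j) (by omega) (by omega),
        root_succ (i := i) (j := ⟨i + 1, by omega⟩) rfl,
        root_other (i := j) (j := ⟨i + 1, by omega⟩) (by simp only []; omega) (by simp only []; omega)]
      have := h3 c2 c3
      omega
  right
  by_cases c3 : (i : ℕ) + 1 = n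
  · refine ⟨i, j, ⟨j + 1, by omega⟩, hij', by simp only []; omega, by simp, ?_⟩
    rw [root_self, root_self, root_other (i := i) (j := j) (by omega) (by omega),
      root_other (i := j) (j := i) (by omega) (by omega),
      root_succ (i := j) (j := ⟨j + 1, by omega⟩) rfl,
      root_other (i := i) (j := ⟨j + 1, by omega⟩) (by simp only []; omega) (by simp only []; omega)]
    omega
  · refine ⟨i, j, ⟨i + 1, by omega⟩, hij', by simp, by simp only []; omega, ?_⟩
    rw [root_self, root_self, root_other (i := i) (j := j) (by omega) (by omega),
      root_other (i := j) (j := i) (by omega) (by omega),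
      root_succ (i := i) (j := ⟨i + 1, by omega⟩) rfl,
      root_other (i := j) (j := ⟨i + 1, by omega⟩) (by simp only []; omega) (by simp only []; omega)]
    omega

theorem no_weight_sub {i j : Fin n} (hij : i ≠ j) (μ ν : Idx n) :
    wt μ ≠ wt ν + (simpleRoot i - simpleRoot j) := by
  have := no_weight_lin hij 1 (-1) (by decide) (by decide) (fun _ => by decide)
    (fun _ _ => by decide) (fun _ _ => by decide) μ ν
  rwa [one_smul, neg_smul, one_smul, ← sub_eq_add_neg] at this

theorem no_weight_serre {i j : Fin n} (hij : i ≠ j) (μ ν : Idx n) :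
    wt μ ≠ wt ν + ((1 - cartan i j).toNat • simpleRoot i + simpleRoot j) := by
  have hm : (1 - cartan i j).toNat = if (i : ℕ) + 1 = j ∨ (j : ℕ) + 1 = i then
      (if (i : ℕ) + 1 = n then 3 else 2) else 1 := by
    unfold cartan
    rw [ip_eq, ip_eq, if_neg hij, if_pos rfl]
    split_ifs <;> rfl
  have hj := j.2
  have := no_weight_lin hij ((1 - cartan i j).toNat : ℤ) 1
    (by rw [hm]; split_ifs <;> decide) (by decide)
    (fun h => by rw [hm, if_pos (Or.inl h), if_neg (by omega)]; decide)
    (fun h h' => by rw [hm, if_pos (Or.inr h), if_pos h']; decide)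
    (fun h h' => by rw [hm, if_pos (Or.inr h), if_neg h']; decide) μ ν
  rwa [one_smul, natCast_zsmul] at this

theorem no_weight_neg {β : Fin n → ℤ} (h : ∀ μ ν : Idx n, wt μ ≠ wt ν + β) (μ ν : Idx n) :
    wt μ ≠ wt ν + -β := fun h' => h ν μ (by rw [h']; abel)

theorem sum_kd (a : ℤ) (g : Idx n → ℂ) :
    ∑ s : Idx n, kd s a * g s = if h : a ∈ Finset.Icc (-(n : ℤ)) n then g ⟨a, h⟩ else 0 := by
  split_ifs with h
  · rw [Finset.sum_eq_single (⟨a, h⟩ : Idx n)]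
    · simp [kd]
    · intro b _ hb
      rw [kd, if_neg (fun h' => hb (Subtype.ext h')), zero_mul]
    · simp
  · apply Finset.sum_eq_zero
    intro s _
    have hs : (s : ℤ) ≠ a := fun h' => h (h' ▸ s.2)
    rw [kd, if_neg hs, zero_mul]

theorem kd_mul_kd (μ ν : Idx n) (a : ℤ) :
    kd μ a * kd ν a = if μ = ν then kd μ a else 0 := by
  simp only [Subtype.ext_iff]
  unfold kd
  split_ifs <;> first | omega | norm_num

theorem kd_self (a : ℤ) : kd a a = 1 := if_pos rfl

theorem kd_ne {a b : ℤ} (h : a ≠ b) : kd a b = 0 := if_neg h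

theorem tE_tF_entry (i : Fin n) (μ ν : Idx n) :
    (tE i * tF i) μ ν = if μ = ν then (if (i : ℕ) + 1 = n then kd μ n - kd μ 0 else
      kd μ (i + 1) + kd μ (-(i + 1) - 1)) else 0 := by
  have hi := i.2
  rw [Matrix.mul_apply]
  unfold tE tF
  simp only [Matrix.of_apply]
  have hμ := Finset.mem_Icc.1 μ.2
  by_cases h : (i : ℕ) + 1 = n
  · simp only [if_pos h]
    have e : ∀ s : Idx n, (kd μ n * kd s 0 - kd μ 0 * kd s (-n)) *
        (kd s 0 * kd ν n + kd s (-n) * kd ν 0) =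
        kd s 0 * (kd μ n * (kd s 0 * kd ν n + kd s (-n) * kd ν 0)) -
        kd s (-n) * (kd μ 0 * (kd s 0 * kd ν n + kd s (-n) * kd ν 0)) := fun s => by ring
    simp only [e, Finset.sum_sub_distrib, sum_kd]
    rw [dif_pos (by simp), dif_pos (by simp)]
    rw [kd_ne (a := 0) (b := -(n : ℤ)) (by omega), kd_ne (a := -(n : ℤ)) (b := 0) (by omega)]
    simp only [kd_self, one_mul, zero_mul, add_zero, zero_add, sub_zero, zero_sub, kd_mul_kd, mul_neg]
    split_ifs <;> ring
  · simp only [if_neg h]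
    have e : ∀ s : Idx n, (kd μ (i + 1) * kd s (i + 1 + 1) + kd μ (-(i + 1) - 1) * kd s (-(i + 1))) *
        (kd s (i + 1 + 1) * kd ν (i + 1) + kd s (-(i + 1)) * kd ν (-(i + 1) - 1)) =
        kd s (i + 1 + 1) * (kd μ (i + 1) *
          (kd s (i + 1 + 1) * kd ν (i + 1) + kd s (-(i + 1)) * kd ν (-(i + 1) - 1))) +
        kd s (-(i + 1)) * (kd μ (-(i + 1) - 1) *
          (kd s (i + 1 + 1) * kd ν (i + 1) + kd s (-(i + 1)) * kd ν (-(i + 1) - 1))) :=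
      fun s => by ring
    simp only [e, Finset.sum_add_distrib, sum_kd]
    rw [dif_pos (by rw [Finset.mem_Icc]; omega), dif_pos (by rw [Finset.mem_Icc]; omega)]
    rw [kd_ne (a := (i : ℤ) + 1 + 1) (b := -((i : ℤ) + 1)) (by omega), kd_ne (a := -((i : ℤ) + 1)) (b := (i : ℤ) + 1 + 1) (by omega)]
    simp only [kd_self, one_mul, zero_mul, add_zero, zero_add, sub_zero, zero_sub, kd_mul_kd, mul_neg]
    split_ifs <;> ring

theorem tF_tE_entry (i : Fin n) (μ ν : Idx n) :
    (tF i * tE i) μ ν = if μ = ν then (if (i : ℕ) + 1 = n then kd μ 0 - kd μ (-n) else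
      kd μ (i + 1 + 1) + kd μ (-(i + 1))) else 0 := by
  have hi := i.2
  rw [Matrix.mul_apply]
  unfold tE tF
  simp only [Matrix.of_apply]
  have hμ := Finset.mem_Icc.1 μ.2
  by_cases h : (i : ℕ) + 1 = n
  · simp only [if_pos h]
    have e : ∀ s : Idx n, (kd μ 0 * kd s n + kd μ (-n) * kd s 0) *
        (kd s n * kd ν 0 - kd s 0 * kd ν (-n)) =
        kd s n * (kd μ 0 * (kd s n * kd ν 0 - kd s 0 * kd ν (-n))) +
        kd s 0 * (kd μ (-n) * (kd s n * kd ν 0 - kd s 0 * kd ν (-n))) := fun s => by ring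
    simp only [e, Finset.sum_add_distrib, sum_kd]
    rw [dif_pos (by simp), dif_pos (by simp)]
    rw [kd_ne (a := (n : ℤ)) (b := 0) (by omega), kd_ne (a := 0) (b := (n : ℤ)) (by omega)]
    simp only [kd_self, one_mul, zero_mul, add_zero, zero_add, sub_zero, zero_sub, kd_mul_kd, mul_neg]
    split_ifs <;> ring
  · simp only [if_neg h]
    have e : ∀ s : Idx n, (kd μ (i + 1 + 1) * kd s (i + 1) + kd μ (-(i + 1)) * kd s (-(i + 1) - 1)) *
        (kd s (i + 1) * kd ν (i + 1 + 1) + kd s (-(i + 1) - 1) * kd ν (-(i + 1))) =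
        kd s (i + 1) * (kd μ (i + 1 + 1) *
          (kd s (i + 1) * kd ν (i + 1 + 1) + kd s (-(i + 1) - 1) * kd ν (-(i + 1)))) +
        kd s (-(i + 1) - 1) * (kd μ (-(i + 1)) *
          (kd s (i + 1) * kd ν (i + 1 + 1) + kd s (-(i + 1) - 1) * kd ν (-(i + 1)))) :=
      fun s => by ring
    simp only [e, Finset.sum_add_distrib, sum_kd]
    rw [dif_pos (by rw [Finset.mem_Icc]; omega), dif_pos (by rw [Finset.mem_Icc]; omega)]
    rw [kd_ne (a := (i : ℤ) + 1) (b := -((i : ℤ) + 1) - 1) (by omega), kd_ne (a := -((i : ℤ) + 1) - 1) (b := (i : ℤ) + 1) (by omega)]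
    simp only [kd_self, one_mul, zero_mul, add_zero, zero_add, sub_zero, zero_sub, kd_mul_kd, mul_neg]
    split_ifs <;> ring

theorem q_sub_inv_ne_zero (q : ℂ) [hq : Generic q] : q - q⁻¹ ≠ 0 := by
  intro h
  have h0 := hq.ne_zero
  refine hq.not_root 2 (by norm_num) ?_
  field_simp at h
  linear_combination h

theorem t_relHolds (n : ℕ) (q : ℂ) [hq : Generic q] :
    RelHolds (n := n) q (tK q) (tKinv q) tE tF := by
  have h0 := hq.ne_zero
  refine ⟨fun i => ?_, fun i => ?_, fun i j => ?_, fun i j => (tE_weight j).comm h0 i,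
    fun i j => ?_, fun i => ?_, fun i j hij => ?_, fun i j hij => ?_, fun i j hij => ?_⟩
  · rw [tK, tKinv, Matrix.diagonal_mul_diagonal, ← Matrix.diagonal_one]
    congr 1; funext μ
    rw [← zpow_add₀ h0, add_neg_cancel, zpow_zero]
  · rw [tK, tKinv, Matrix.diagonal_mul_diagonal, ← Matrix.diagonal_one]
    congr 1; funext μ
    rw [← zpow_add₀ h0, neg_add_cancel, zpow_zero]
  · rw [tK, tK, Matrix.diagonal_mul_diagonal, Matrix.diagonal_mul_diagonal]
    congr 1; funext μ; ring
  · rw [(tF_weight j).comm h0 i, dotProduct_neg, ip]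
  · have hi := i.2
    ext μ ν
    rw [Matrix.sub_apply, Matrix.smul_apply, tE_tF_entry, tF_tE_entry, Matrix.smul_apply,
      Matrix.sub_apply, tK, tKinv, Matrix.diagonal_apply, Matrix.diagonal_apply]
    have hμ := Finset.mem_Icc.1 μ.2
    by_cases hμν : μ = ν
    swap
    · simp [hμν]
    simp only [if_pos hμν, smul_eq_mul]
    rw [root_dot]
    have hne := q_sub_inv_ne_zero q
    have hA : (q - q⁻¹)⁻¹ * (q - q⁻¹) = 1 := inv_mul_cancel₀ hne
    have hB : (q - q⁻¹)⁻¹ * (q⁻¹ - q) = -1 := by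
      rw [← neg_sub q q⁻¹, mul_neg, hA]
    unfold wt kd nodeSign
    by_cases h : (i : ℕ) + 1 = n
    · simp only [h, if_true, lt_irrefl, dif_neg, not_false_eq_true]
      have : ((i : ℕ) : ℤ) + 1 = n := by omega
      rw [this]
      split_ifs <;> first | omega | simp [hA, hB]
    · simp only [h, if_false, dif_pos (show (i : ℕ) + 1 < n by omega)]
      push_cast
      split_ifs <;> first | omega | simp [hA, hB]
  · have z1 : tE i * tF j = 0 := eq_zero_of_weight (β := simpleRoot i - simpleRoot j)
      (by rw [sub_eq_add_neg]; exact (tE_weight i).mul (tF_weight j)) (no_weight_sub hij)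
    have z2 : tF j * tE i = 0 := eq_zero_of_weight (β := simpleRoot i - simpleRoot j)
      (by rw [sub_eq_add_neg, add_comm]; exact (tF_weight j).mul (tE_weight i))
      (no_weight_sub hij)
    rw [z1, z2]
  · exact eq_zero_of_weight ((tE_weight i).serreSeq (tE_weight j) _ _ _) (no_weight_serre hij)
  · refine eq_zero_of_weight ((tF_weight i).serreSeq (tF_weight j) _ _ _) ?_
    have := no_weight_neg (no_weight_serre hij)
    rwa [neg_add, ← smul_neg] at this

/-- The vector representation `t` of `U_q(osp(1|2n))`. -/
def vecRep (n : ℕ) (q : ℂ) [Generic q] : Uq n q →ₐ[ℂ] Matrix (Idx n) (Idx n) ℂ :=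
  Uq.lift (t_relHolds n q)

end VectorRep

/-! ### Super vector spaces -/

section Super

/-- The `ℤ/2`-grading by the eigenspaces of a linear involution: the even part is where it is the
identity, the odd part is where it is minus the identity. -/
def parityGrading {M : Type*} [AddCommGroup M] [Module ℂ M] (s : M →ₗ[ℂ] M) (i : ZMod 2) :
    Submodule ℂ M :=
  LinearMap.ker (s - (if i = 0 then (1 : ℂ) else -1) • LinearMap.id)

theorem zmod_two (i : ZMod 2) : i = 0 ∨ i = 1 := by revert i; decide

variable {M : Type*} [AddCommGroup M] [Module ℂ M]

theorem mem_parityGrading {s : M →ₗ[ℂ] M} {i : ZMod 2} {x : M} :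
    x ∈ parityGrading s i ↔ s x = (if i = 0 then (1 : ℂ) else -1) • x := by
  rw [parityGrading, LinearMap.mem_ker, LinearMap.sub_apply, sub_eq_zero]
  rfl

theorem mem_parityGrading_zero {s : M →ₗ[ℂ] M} {x : M} : x ∈ parityGrading s 0 ↔ s x = x := by
  simp [mem_parityGrading]

theorem mem_parityGrading_one {s : M →ₗ[ℂ] M} {x : M} : x ∈ parityGrading s 1 ↔ s x = -x := by
  simp [mem_parityGrading]

theorem parity_half_even {s : M →ₗ[ℂ] M} (hs : ∀ x, s (s x) = x) (x : M) :
    (1 / 2 : ℂ) • (x + s x) ∈ parityGrading s 0 := by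
  rw [mem_parityGrading_zero, map_smul, map_add, hs, add_comm]

theorem parity_half_odd {s : M →ₗ[ℂ] M} (hs : ∀ x, s (s x) = x) (x : M) :
    (1 / 2 : ℂ) • (x - s x) ∈ parityGrading s 1 := by
  rw [mem_parityGrading_one, map_smul, map_sub, hs, ← smul_neg, neg_sub]

/-- The decomposition into the even and the odd part. -/
@[reducible]
def parityDecomposition (s : M →ₗ[ℂ] M) (hs : ∀ x, s (s x) = x) :
    DirectSum.Decomposition (parityGrading s) :=
  DirectSum.Decomposition.ofLinearMap _
    (DirectSum.lof ℂ (ZMod 2) (fun i => parityGrading s i) 0 ∘ₗ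
        LinearMap.codRestrict _ ((1 / 2 : ℂ) • (LinearMap.id + s)) (parity_half_even hs) +
      DirectSum.lof ℂ (ZMod 2) (fun i => parityGrading s i) 1 ∘ₗ
        LinearMap.codRestrict _ ((1 / 2 : ℂ) • (LinearMap.id - s)) (parity_half_odd hs))
    (by
      refine LinearMap.ext fun x => ?_
      rw [LinearMap.comp_apply, LinearMap.add_apply, map_add, LinearMap.comp_apply,
        LinearMap.comp_apply, DirectSum.coeLinearMap_lof, DirectSum.coeLinearMap_lof,
        LinearMap.codRestrict_apply, LinearMap.codRestrict_apply, LinearMap.smul_apply,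
        LinearMap.smul_apply, LinearMap.add_apply, LinearMap.sub_apply, LinearMap.id_apply]
      module)
    (by
      apply DirectSum.linearMap_ext
      intro i
      ext x : 1
      obtain ⟨x, hx⟩ := x
      rcases zmod_two i with rfl | rfl
      · have h := mem_parityGrading_zero.1 hx
        have e1 : LinearMap.codRestrict _ ((1 / 2 : ℂ) • (LinearMap.id + s))
            (parity_half_even hs) x = ⟨x, hx⟩ := by
          apply Subtype.ext
          rw [LinearMap.codRestrict_apply, LinearMap.smul_apply, LinearMap.add_apply,
            LinearMap.id_apply, h]
          module
        have e2 : LinearMap.codRestrict _ ((1 / 2 : ℂ) • (LinearMap.id - s))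
            (parity_half_odd hs) x = 0 := by
          apply Subtype.ext
          rw [LinearMap.codRestrict_apply, LinearMap.smul_apply, LinearMap.sub_apply,
            LinearMap.id_apply, h, sub_self, smul_zero]
          rfl
        simp only [LinearMap.comp_apply, LinearMap.add_apply, DirectSum.coeLinearMap_lof, e1, e2,
          map_zero, add_zero, LinearMap.id_apply]
      · have h := mem_parityGrading_one.1 hx
        have e1 : LinearMap.codRestrict _ ((1 / 2 : ℂ) • (LinearMap.id + s))
            (parity_half_even hs) x = 0 := by
          apply Subtype.ext
          rw [LinearMap.codRestrict_apply, LinearMap.smul_apply, LinearMap.add_apply,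
            LinearMap.id_apply, h, add_neg_cancel, smul_zero]
          rfl
        have e2 : LinearMap.codRestrict _ ((1 / 2 : ℂ) • (LinearMap.id - s))
            (parity_half_odd hs) x = ⟨x, hx⟩ := by
          apply Subtype.ext
          rw [LinearMap.codRestrict_apply, LinearMap.smul_apply, LinearMap.sub_apply,
            LinearMap.id_apply, h]
          module
        simp only [LinearMap.comp_apply, LinearMap.add_apply, DirectSum.coeLinearMap_lof, e1, e2,
          map_zero, zero_add, LinearMap.id_apply])

variable (𝒜 : ZMod 2 → Submodule ℂ M) [DirectSum.Decomposition 𝒜]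

/-- The projection onto the odd part. -/
def oddProj : M →ₗ[ℂ] M :=
  (𝒜 1).subtype ∘ₗ DirectSum.component ℂ (ZMod 2) (fun i => 𝒜 i) 1 ∘ₗ
    (DirectSum.decomposeLinearEquiv 𝒜).toLinearMap

theorem oddProj_apply (x : M) : oddProj 𝒜 x = (DirectSum.decompose 𝒜 x 1 : M) := rfl

theorem oddProj_even {x : M} (hx : x ∈ 𝒜 0) : oddProj 𝒜 x = 0 :=
  DirectSum.decompose_of_mem_ne 𝒜 hx (by decide)

theorem oddProj_odd {x : M} (hx : x ∈ 𝒜 1) : oddProj 𝒜 x = x :=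
  DirectSum.decompose_of_mem_same 𝒜 hx

theorem parity_split {s : M →ₗ[ℂ] M} (x : M) :
    x = (1 / 2 : ℂ) • (x + s x) + (1 / 2 : ℂ) • (x - s x) := by
  module

theorem oddProj_parity {s : M →ₗ[ℂ] M} (hs : ∀ x, s (s x) = x)
    [DirectSum.Decomposition (parityGrading s)] (x : M) :
    oddProj (parityGrading s) x = (1 / 2 : ℂ) • (x - s x) := by
  conv_lhs => rw [parity_split (s := s) x, map_add, oddProj_even _ (parity_half_even hs x),
    oddProj_odd _ (parity_half_odd hs x), zero_add]

variable {N : Type*} [AddCommGroup N] [Module ℂ N] (ℬ : ZMod 2 → Submodule ℂ N)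
  [DirectSum.Decomposition ℬ]

/-- The sign operator `a ⊗ b ↦ (-1)^{[a][b]} a ⊗ b`. -/
def koszul : M ⊗[ℂ] N →ₗ[ℂ] M ⊗[ℂ] N :=
  LinearMap.id - (2 : ℂ) • TensorProduct.map (oddProj 𝒜) (oddProj ℬ)

theorem koszul_tmul (a : M) (b : N) :
    koszul 𝒜 ℬ (a ⊗ₜ b) = a ⊗ₜ b - (2 : ℂ) • (oddProj 𝒜 a ⊗ₜ oddProj ℬ b) := rfl

end Super

/-! ### The grading of `U_q(osp(1|2n))` -/

section Grading

theorem parity_relHolds (n : ℕ) (q : ℂ) :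
    RelHolds (n := n) q (Uq.k q) (Uq.kinv q) (fun i => nodeSign i • Uq.e q i)
      (fun i => nodeSign i • Uq.f q i) := by
  have h := Uq.relHolds n q
  refine ⟨h.k_kinv, h.kinv_k, h.k_comm, fun i j => ?_, fun i j => ?_, fun i => ?_,
    fun i j hij => ?_, fun i j hij => ?_, fun i j hij => ?_⟩
  · rw [mul_smul_comm, h.k_e, smul_mul_assoc, smul_comm]
  · rw [mul_smul_comm, h.k_f, smul_mul_assoc, smul_comm]
  · rw [← h.e_f_same, smul_mul_smul_comm, smul_mul_smul_comm, nodeSign_mul_self, one_smul, one_smul]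
  · simp only [smul_mul_smul_comm]
    rw [h.e_f_ne i j hij, mul_comm]
  · rw [serreSeq_smul, h.serre_e i j hij, smul_zero]
  · rw [serreSeq_smul, h.serre_f i j hij, smul_zero]

/-- The parity automorphism of `U_q(osp(1|2n))`. -/
def Uq.parity (n : ℕ) (q : ℂ) : Uq n q →ₐ[ℂ] Uq n q := Uq.lift (parity_relHolds n q)

theorem Uq.parity_parity (n : ℕ) (q : ℂ) (x : Uq n q) :
    Uq.parity n q (Uq.parity n q x) = x := by
  have : (Uq.parity n q).comp (Uq.parity n q) = AlgHom.id ℂ _ := by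
    apply Uq.hom_ext <;> intro i <;>
    simp [Uq.parity, Uq.lift_k, Uq.lift_kinv, Uq.lift_e, Uq.lift_f, smul_smul, nodeSign_mul_self]
  exact DFunLike.congr_fun this x

/-- The `ℤ/2`-grading of `U_q(osp(1|2n))`: all `k_i^{±1}` and the `e_j`, `f_j` with `j < n` are
even, `e_n` and `f_n` are odd. -/
def Uq.grading (n : ℕ) (q : ℂ) : ZMod 2 → Submodule ℂ (Uq n q) :=
  parityGrading (Uq.parity n q).toLinearMap

instance Uq.gradedAlgebra (n : ℕ) (q : ℂ) : GradedAlgebra (Uq.grading n q) where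
  toDecomposition := parityDecomposition _ (Uq.parity_parity n q)
  one_mem := by
    rw [Uq.grading, mem_parityGrading_zero]
    exact map_one (Uq.parity n q)
  mul_mem := by
    intro i j x y hx hy
    rw [Uq.grading, mem_parityGrading] at hx hy ⊢
    have hx' : Uq.parity n q x = _ := hx
    have hy' : Uq.parity n q y = _ := hy
    change Uq.parity n q (x * y) = _
    rw [map_mul, hx', hy', smul_mul_smul_comm]
    congr 1
    rcases zmod_two i with rfl | rfl <;> rcases zmod_two j with rfl | rfl <;> norm_num
    rfl

variable {n : ℕ} {q : ℂ}

theorem Uq.mem_even {x : Uq n q} : x ∈ Uq.grading n q 0 ↔ Uq.parity n q x = x :=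
  mem_parityGrading_zero

theorem Uq.mem_odd {x : Uq n q} : x ∈ Uq.grading n q 1 ↔ Uq.parity n q x = -x :=
  mem_parityGrading_one

theorem Uq.k_mem (i : Fin n) : Uq.k q i ∈ Uq.grading n q 0 :=
  Uq.mem_even.2 (Uq.lift_k _ i)

theorem Uq.kinv_mem (i : Fin n) : Uq.kinv q i ∈ Uq.grading n q 0 :=
  Uq.mem_even.2 (Uq.lift_kinv _ i)

theorem Uq.parity_e (i : Fin n) : Uq.parity n q (Uq.e q i) = nodeSign i • Uq.e q i :=
  Uq.lift_e _ i

theorem Uq.parity_f (i : Fin n) : Uq.parity n q (Uq.f q i) = nodeSign i • Uq.f q i :=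
  Uq.lift_f _ i

/-- The degree of the node `i`: odd only for the last one. -/
def nodeDeg (i : Fin n) : ZMod 2 := if (i : ℕ) + 1 = n then 1 else 0

theorem Uq.e_mem (i : Fin n) : Uq.e q i ∈ Uq.grading n q (nodeDeg i) := by
  rw [Uq.grading, mem_parityGrading]
  refine (Uq.parity_e i).trans ?_
  unfold nodeSign nodeDeg
  split_ifs <;> first | rfl | exact absurd rfl ‹_› | exact absurd ‹_› (by decide)

theorem Uq.f_mem (i : Fin n) : Uq.f q i ∈ Uq.grading n q (nodeDeg i) := by
  rw [Uq.grading, mem_parityGrading]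
  refine (Uq.parity_f i).trans ?_
  unfold nodeSign nodeDeg
  split_ifs <;> first | rfl | exact absurd rfl ‹_› | exact absurd ‹_› (by decide)

theorem Uq.oddProj_eq (x : Uq n q) :
    oddProj (Uq.grading n q) x = (1 / 2 : ℂ) • (x - Uq.parity n q x) :=
  @oddProj_parity _ _ _ (Uq.parity n q).toLinearMap (Uq.parity_parity n q)
    (Uq.gradedAlgebra n q).toDecomposition x

end Grading

/-! ### Co-multiplication, co-unit and antipode of `U_q(osp(1|2n))` -/

section Hopf

variable {n : ℕ} {q : ℂ}

/-- The super algebra `U_q ⊗ U_q` with `(a ⊗ b) (a' ⊗ b') = (-1)^{[b][a']} a a' ⊗ b b'`. -/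
abbrev Uq.Sq (n : ℕ) (q : ℂ) : Type := GradedTensorProduct ℂ (Uq.grading n q) (Uq.grading n q)

/-- The pure tensor `a ⊗ b`. -/
abbrev Uq.ten (a b : Uq n q) : Uq.Sq n q :=
  GradedTensorProduct.of ℂ (Uq.grading n q) (Uq.grading n q) (a ⊗ₜ b)

theorem Uq.ten_add_left (a a' b : Uq n q) : Uq.ten (a + a') b = Uq.ten a b + Uq.ten a' b := by
  rw [Uq.ten, TensorProduct.add_tmul, map_add]

theorem Uq.ten_add_right (a b b' : Uq n q) : Uq.ten a (b + b') = Uq.ten a b + Uq.ten a b' := by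
  rw [Uq.ten, TensorProduct.tmul_add, map_add]

theorem Uq.ten_zero_left (b : Uq n q) : Uq.ten 0 b = 0 := by
  rw [Uq.ten, TensorProduct.zero_tmul, map_zero]

theorem Uq.ten_zero_right (a : Uq n q) : Uq.ten a 0 = 0 := by
  rw [Uq.ten, TensorProduct.tmul_zero, map_zero]

theorem Uq.ten_mul_hom {i j : ZMod 2} (a b a' b' : Uq n q) (hb : b ∈ Uq.grading n q j)
    (ha' : a' ∈ Uq.grading n q i) :
    Uq.ten a b * Uq.ten a' b' =
      (if j = 1 ∧ i = 1 then (-1 : ℂ) else 1) • Uq.ten (a * a') (b * b') := by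
  have := GradedTensorProduct.tmul_coe_mul_coe_tmul (R := ℂ) (Uq.grading n q) (Uq.grading n q)
    a ⟨b, hb⟩ ⟨a', ha'⟩ b'
  refine this.trans ?_
  rcases zmod_two i with rfl | rfl <;> rcases zmod_two j with rfl | rfl
  · simp
  · simp
  · simp
  · simp

theorem Uq.ten_mul_even_left (a b a' b' : Uq n q) (hb : b ∈ Uq.grading n q 0) :
    Uq.ten a b * Uq.ten a' b' = Uq.ten (a * a') (b * b') := by
  have h : ∀ i, ∀ a' ∈ Uq.grading n q i,
      Uq.ten a b * Uq.ten a' b' = Uq.ten (a * a') (b * b') := fun i a' h => by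
    rw [Uq.ten_mul_hom a b a' b' hb h]; simp
  induction a' using DirectSum.Decomposition.inductionOn (Uq.grading n q) with
  | zero => simp [Uq.ten_zero_left, Uq.ten_zero_right]
  | homogeneous m => exact h _ _ m.2
  | add x y hx hy =>
    rw [mul_add, Uq.ten_add_left, mul_add, Uq.ten_add_left, hx, hy]

theorem Uq.ten_mul_even_right (a b a' b' : Uq n q) (ha' : a' ∈ Uq.grading n q 0) :
    Uq.ten a b * Uq.ten a' b' = Uq.ten (a * a') (b * b') := by
  have h : ∀ i, ∀ b ∈ Uq.grading n q i,
      Uq.ten a b * Uq.ten a' b' = Uq.ten (a * a') (b * b') := fun i b h => by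
    rw [Uq.ten_mul_hom a b a' b' h ha']; simp
  induction b using DirectSum.Decomposition.inductionOn (Uq.grading n q) with
  | zero => simp [Uq.ten_zero_left, Uq.ten_zero_right]
  | homogeneous m => exact h _ _ m.2
  | add x y hx hy =>
    rw [add_mul, Uq.ten_add_right, add_mul, Uq.ten_add_right, hx, hy]

/-- The general product formula in `U_q ⊗ U_q`. -/
theorem Uq.ten_mul (a b a' b' : Uq n q) :
    Uq.ten a b * Uq.ten a' b' = Uq.ten (a * a') (b * b') -
      (2 : ℂ) • Uq.ten (a * oddProj (Uq.grading n q) a') (oddProj (Uq.grading n q) b * b') := by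
  induction b using DirectSum.Decomposition.inductionOn (Uq.grading n q) with
  | zero => simp [Uq.ten_zero_left, Uq.ten_zero_right]
  | @homogeneous j m =>
    induction a' using DirectSum.Decomposition.inductionOn (Uq.grading n q) with
    | zero => simp [Uq.ten_zero_left, Uq.ten_zero_right]
    | @homogeneous i m' =>
      rw [Uq.ten_mul_hom _ _ _ _ m.2 m'.2]
      rcases zmod_two i with rfl | rfl
      · rw [oddProj_even _ m'.2]; simp [Uq.ten_zero_left, Uq.ten_zero_right]
      · rcases zmod_two j with rfl | rfl
        · rw [oddProj_even _ m.2]; simp [Uq.ten_zero_left, Uq.ten_zero_right]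
        · rw [oddProj_odd _ m'.2, oddProj_odd _ m.2]
          simp
          module
    | add x y hx hy =>
      rw [mul_add, map_add, mul_add, Uq.ten_add_left, mul_add, hx, hy, Uq.ten_add_left,
        Uq.ten_add_left, smul_add]
      abel
  | add x y hx hy =>
    rw [add_mul, map_add, add_mul, Uq.ten_add_right, add_mul, hx, hy, Uq.ten_add_right,
      Uq.ten_add_right, smul_add]
    abel

theorem Uq.ten_smul_left (c : ℂ) (a b : Uq n q) : Uq.ten (c • a) b = c • Uq.ten a b := by
  rw [Uq.ten, ← TensorProduct.smul_tmul', map_smul]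

theorem Uq.ten_smul_right (c : ℂ) (a b : Uq n q) : Uq.ten a (c • b) = c • Uq.ten a b := by
  rw [Uq.ten, TensorProduct.tmul_smul, map_smul]

theorem nodeDeg_sign (i j : Fin n) :
    (if nodeDeg i = 1 ∧ nodeDeg j = 1 then (-1 : ℂ) else 1) =
      if i = j then nodeSign i else 1 := by
  unfold nodeDeg nodeSign
  by_cases hi : (i : ℕ) + 1 = n
  · by_cases hj : (j : ℕ) + 1 = n
    · have : i = j := Fin.ext (by omega)
      simp [hi, hj, this]
    · have : i ≠ j := fun h => hj (h ▸ hi)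
      simp [hj, this]
  · simp [hi]

theorem Uq.ten_mul_e_f (i j : Fin n) {x y : Uq n q} (hx : x ∈ Uq.grading n q (nodeDeg i))
    (hy : y ∈ Uq.grading n q (nodeDeg j)) (a b : Uq n q) :
    Uq.ten a x * Uq.ten y b = (if i = j then nodeSign i else 1) • Uq.ten (a * y) (x * b) := by
  rw [Uq.ten_mul_hom _ _ _ _ hx hy, nodeDeg_sign]

section Relations

variable (q) [hq : Generic q]

theorem Uq.kinv_e (i j : Fin n) :
    Uq.kinv q i * Uq.e q j = q ^ (-ip i j) • (Uq.e q j * Uq.kinv q i) := by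
  have h := Uq.relHolds n q
  have h1 : Uq.kinv q i * (Uq.k q i * Uq.e q j) * Uq.kinv q i = Uq.e q j * Uq.kinv q i := by
    rw [← mul_assoc, h.kinv_k, one_mul]
  rw [h.k_e, mul_smul_comm, smul_mul_assoc, mul_assoc, mul_assoc, h.k_kinv, mul_one] at h1
  rw [← h1, smul_smul, ← zpow_add₀ hq.ne_zero, neg_add_cancel, zpow_zero, one_smul]

theorem Uq.kinv_f (i j : Fin n) :
    Uq.kinv q i * Uq.f q j = q ^ ip i j • (Uq.f q j * Uq.kinv q i) := by
  have h := Uq.relHolds n q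
  have h1 : Uq.kinv q i * (Uq.k q i * Uq.f q j) * Uq.kinv q i = Uq.f q j * Uq.kinv q i := by
    rw [← mul_assoc, h.kinv_k, one_mul]
  rw [h.k_f, mul_smul_comm, smul_mul_assoc, mul_assoc, mul_assoc, h.k_kinv, mul_one] at h1
  rw [← h1, smul_smul, ← zpow_add₀ hq.ne_zero, add_neg_cancel, zpow_zero, one_smul]

theorem Uq.kinv_k_comm (i j : Fin n) :
    Uq.kinv q i * Uq.k q j = Uq.k q j * Uq.kinv q i := by
  have h := Uq.relHolds n q
  have h1 : Uq.kinv q i * (Uq.k q i * Uq.k q j) * Uq.kinv q i = Uq.k q j * Uq.kinv q i := by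
    rw [← mul_assoc, h.kinv_k, one_mul]
  rw [h.k_comm, ← mul_assoc, mul_assoc, h.k_kinv, mul_one] at h1
  exact h1

theorem Uq.kinv_comm (i j : Fin n) :
    Uq.kinv q i * Uq.kinv q j = Uq.kinv q j * Uq.kinv q i := by
  have h := Uq.relHolds n q
  have h1 : Uq.kinv q i * (Uq.k q i * Uq.kinv q j) * Uq.kinv q i = Uq.kinv q j * Uq.kinv q i := by
    rw [← mul_assoc, h.kinv_k, one_mul]
  rw [← Uq.kinv_k_comm, ← mul_assoc, mul_assoc, h.k_kinv, mul_one] at h1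
  exact h1

end Relations

theorem comul_relHolds (n : ℕ) (q : ℂ) [hq : Generic q] :
    RelHolds (n := n) q (fun i => Uq.ten (Uq.k q i) (Uq.k q i))
      (fun i => Uq.ten (Uq.kinv q i) (Uq.kinv q i))
      (fun i => Uq.ten (Uq.e q i) (Uq.k q i) + Uq.ten 1 (Uq.e q i))
      (fun i => Uq.ten (Uq.f q i) 1 + Uq.ten (Uq.kinv q i) (Uq.f q i)) := by
  have h := Uq.relHolds n q
  have h0 := hq.ne_zero
  have h1 : (1 : Uq n q) ∈ Uq.grading n q 0 := SetLike.GradedOne.one_mem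
  have hk : ∀ i, Uq.k q i ∈ Uq.grading n q 0 := Uq.k_mem
  have hk' : ∀ i, Uq.kinv q i ∈ Uq.grading n q 0 := Uq.kinv_mem
  have one_ten : (1 : Uq.Sq n q) = Uq.ten 1 1 := rfl
  refine ⟨fun i => ?_, fun i => ?_, fun i j => ?_, fun i j => ?_, fun i j => ?_, fun i => ?_,
    fun i j hij => ?_, fun i j hij => ?_, fun i j hij => ?_⟩
  · simp only [Uq.ten_mul_even_left _ _ _ _ (hk i), h.k_kinv, one_ten]
  · simp only [Uq.ten_mul_even_left _ _ _ _ (hk' i), h.kinv_k, one_ten]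
  · simp only [Uq.ten_mul_even_left _ _ _ _ (hk _), h.k_comm i j]
  · simp only [mul_add, add_mul, smul_add, Uq.ten_mul_even_left _ _ _ _ (hk i),
      Uq.ten_mul_even_right _ _ _ _ (hk i), h.k_e i j, h.k_comm i j, Uq.ten_smul_left,
      Uq.ten_smul_right, one_mul, mul_one]
  · simp only [mul_add, add_mul, smul_add, Uq.ten_mul_even_left _ _ _ _ (hk i),
      Uq.ten_mul_even_right _ _ _ _ (hk i), h.k_f i j, ← Uq.kinv_k_comm q j i, Uq.ten_smul_left,
      Uq.ten_smul_right, one_mul, mul_one]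
  · simp only [mul_add, add_mul]
    rw [Uq.ten_mul_even_left _ _ _ _ (hk i), Uq.ten_mul_e_f i i (Uq.e_mem i) (Uq.f_mem i),
      Uq.ten_mul_even_left _ _ _ _ (hk i), Uq.ten_mul_even_right _ _ _ _ (hk' i),
      Uq.ten_mul_even_left _ _ _ _ h1, Uq.ten_mul_e_f i i (Uq.f_mem i) (Uq.e_mem i),
      Uq.ten_mul_even_left _ _ _ _ h1, Uq.ten_mul_even_right _ _ _ _ h1]
    simp only [if_true, one_mul, mul_one, smul_add, smul_smul, nodeSign_mul_self, one_smul,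
      Uq.kinv_e, h.k_f, Uq.ten_smul_left, Uq.ten_smul_right, ← zpow_add₀ h0]
    have e1 : Uq.ten (Uq.e q i * Uq.f q i) (Uq.k q i) =
        nodeSign i • Uq.ten (Uq.f q i * Uq.e q i) (Uq.k q i) +
        (q - q⁻¹)⁻¹ • (Uq.ten (Uq.k q i) (Uq.k q i) - Uq.ten (Uq.kinv q i) (Uq.k q i)) := by
      rw [eq_add_of_sub_eq' (h.e_f_same i)]
      simp only [Uq.ten, TensorProduct.add_tmul, TensorProduct.sub_tmul, map_add, map_sub,
        ← TensorProduct.smul_tmul', map_smul]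
    have e2 : Uq.ten (Uq.kinv q i) (Uq.e q i * Uq.f q i) =
        nodeSign i • Uq.ten (Uq.kinv q i) (Uq.f q i * Uq.e q i) +
        (q - q⁻¹)⁻¹ • (Uq.ten (Uq.kinv q i) (Uq.k q i) - Uq.ten (Uq.kinv q i) (Uq.kinv q i)) := by
      rw [eq_add_of_sub_eq' (h.e_f_same i)]
      simp only [Uq.ten, TensorProduct.tmul_add, TensorProduct.tmul_sub, map_add, map_sub,
        TensorProduct.tmul_smul, map_smul]
    rw [e1, e2, ← mul_assoc, nodeSign_mul_self, one_mul]
    module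
  · simp only [mul_add, add_mul]
    rw [Uq.ten_mul_even_left _ _ _ _ (hk i), Uq.ten_mul_e_f i j (Uq.e_mem i) (Uq.f_mem j),
      Uq.ten_mul_even_left _ _ _ _ (hk i), Uq.ten_mul_even_right _ _ _ _ (hk' j),
      Uq.ten_mul_even_left _ _ _ _ h1, Uq.ten_mul_e_f j i (Uq.f_mem j) (Uq.e_mem i),
      Uq.ten_mul_even_left _ _ _ _ h1, Uq.ten_mul_even_right _ _ _ _ h1]
    simp only [if_neg hij, if_neg hij.symm, one_mul, mul_one, one_smul, h.e_f_ne i j hij,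
      Uq.kinv_e, h.k_f, Uq.ten_smul_left, Uq.ten_smul_right, ip_comm j i]
    abel
  · have hc := serreCase_e h0 hij
    refine serreSeq_add hc ?_ ?_ ?_ ?_ ?_
    · rw [Uq.ten_mul_even_left _ _ _ _ (hk i), Uq.ten_mul_e_f i i (Uq.e_mem i) (Uq.e_mem i)]
      simp only [if_true, one_mul, mul_one, h.k_e, Uq.ten_smul_right, smul_smul]
      congr 1
      rw [mul_right_comm, nodeSign_mul_self, one_mul]
    · rw [Uq.ten_mul_even_left _ _ _ _ (hk i), Uq.ten_mul_e_f j i (Uq.e_mem j) (Uq.e_mem i)]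
      simp only [if_neg hij.symm, one_mul, mul_one, h.k_e, Uq.ten_smul_right, one_smul]
    · rw [Uq.ten_mul_even_left _ _ _ _ (hk j), Uq.ten_mul_e_f i j (Uq.e_mem i) (Uq.e_mem j)]
      simp only [if_neg hij, one_mul, mul_one, h.k_e, Uq.ten_smul_right, one_smul, ip_comm j i]
    · have e1 : ∀ i, Uq.ten (Uq.e q i) (Uq.k q i) = Uq.ten (Uq.e q i) 1 * Uq.ten 1 (Uq.k q i) :=
        fun i => by rw [Uq.ten_mul_even_left _ _ _ _ h1, one_mul, mul_one]
      have hcm : ∀ (i : Fin n) (a : Uq n q), Uq.ten 1 (Uq.k q i) * Uq.ten a 1 =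
          (1 : ℂ) • (Uq.ten a 1 * Uq.ten 1 (Uq.k q i)) := fun i a => by
        rw [Uq.ten_mul_even_left _ _ _ _ h1, Uq.ten_mul_even_left _ _ _ _ (hk i), one_mul, mul_one,
          one_mul, mul_one, one_smul]
      obtain ⟨t, ht⟩ := serreSeq_twist (hcm i (Uq.e q i)) (hcm i (Uq.e q j)) (hcm j (Uq.e q i))
        (show Uq.ten 1 (Uq.k q i) * Uq.ten 1 (Uq.k q j) = _ by
          rw [Uq.ten_mul_even_left _ _ _ _ (hk i), Uq.ten_mul_even_left _ _ _ _ (hk j),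
            h.k_comm i j]) (q ^ ip i j) (nodeSign i * q ^ ip i i) (1 - cartan i j).toNat
      rw [e1, e1, ht]
      have := serreSeq_map (GradedTensorProduct.includeLeft (R := ℂ) (Uq.grading n q)
        (Uq.grading n q)) (Uq.e q i) (Uq.e q j) (q ^ ip i j) (nodeSign i * q ^ ip i i)
        (1 - cartan i j).toNat
      rw [h.serre_e i j hij, map_zero] at this
      have this' : serreSeq (Uq.ten (Uq.e q i) 1) (Uq.ten (Uq.e q j) 1) (q ^ ip i j)
        (nodeSign i * q ^ ip i i) (1 - cartan i j).toNat = 0 := this.symm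
      rw [this', zero_mul, zero_mul, smul_zero]
    · have := serreSeq_map (GradedTensorProduct.includeRight (R := ℂ) (Uq.grading n q)
        (Uq.grading n q)) (Uq.e q i) (Uq.e q j) (q ^ ip i j) (nodeSign i * q ^ ip i i)
        (1 - cartan i j).toNat
      rw [h.serre_e i j hij, map_zero] at this
      exact this.symm
  · have hc := serreCase_f h0 hij
    refine serreSeq_add hc ?_ ?_ ?_ ?_ ?_
    · rw [Uq.ten_mul_even_left _ _ _ _ h1, Uq.ten_mul_e_f i i (Uq.f_mem i) (Uq.f_mem i)]
      simp only [if_true, one_mul, mul_one, Uq.kinv_f, Uq.ten_smul_left, smul_smul]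
      have e : nodeSign i * q ^ (-ip i i) * (nodeSign i * q ^ ip i i) = 1 := by
        rw [mul_mul_mul_comm, nodeSign_mul_self, one_mul, ← zpow_add₀ h0, neg_add_cancel, zpow_zero]
      rw [e, one_smul]
    · rw [Uq.ten_mul_even_left _ _ _ _ h1, Uq.ten_mul_e_f j i (Uq.f_mem j) (Uq.f_mem i)]
      simp only [if_neg hij.symm, one_mul, mul_one, Uq.kinv_f, Uq.ten_smul_left, one_smul, smul_smul]
      rw [ip_comm j i, ← zpow_add₀ h0, neg_add_cancel, zpow_zero, one_smul]
    · rw [Uq.ten_mul_even_left _ _ _ _ h1, Uq.ten_mul_e_f i j (Uq.f_mem i) (Uq.f_mem j)]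
      simp only [if_neg hij, one_mul, mul_one, Uq.kinv_f, Uq.ten_smul_left, one_smul, smul_smul]
      rw [← zpow_add₀ h0, neg_add_cancel, zpow_zero, one_smul]
    · have := serreSeq_map (GradedTensorProduct.includeLeft (R := ℂ) (Uq.grading n q)
        (Uq.grading n q)) (Uq.f q i) (Uq.f q j) (q ^ (-ip i j)) (nodeSign i * q ^ (-ip i i))
        (1 - cartan i j).toNat
      rw [h.serre_f i j hij, map_zero] at this
      exact this.symm
    · have e1 : ∀ i, Uq.ten (Uq.kinv q i) (Uq.f q i) =
          Uq.ten 1 (Uq.f q i) * Uq.ten (Uq.kinv q i) 1 :=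
        fun i => by rw [Uq.ten_mul_even_right _ _ _ _ (hk' i), one_mul, mul_one]
      have hcm : ∀ (i : Fin n) (a : Uq n q), Uq.ten (Uq.kinv q i) 1 * Uq.ten 1 a =
          (1 : ℂ) • (Uq.ten 1 a * Uq.ten (Uq.kinv q i) 1) := fun i a => by
        rw [Uq.ten_mul_even_left _ _ _ _ h1, Uq.ten_mul_even_right _ _ _ _ (hk' i), one_mul,
          mul_one, one_mul, mul_one, one_smul]
      obtain ⟨t, ht⟩ := serreSeq_twist (hcm i (Uq.f q i)) (hcm i (Uq.f q j)) (hcm j (Uq.f q i))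
        (show Uq.ten (Uq.kinv q i) 1 * Uq.ten (Uq.kinv q j) 1 = _ by
          rw [Uq.ten_mul_even_left _ _ _ _ h1, Uq.ten_mul_even_left _ _ _ _ h1,
            Uq.kinv_comm q i j]) (q ^ (-ip i j)) (nodeSign i * q ^ (-ip i i)) (1 - cartan i j).toNat
      rw [e1, e1, ht]
      have := serreSeq_map (GradedTensorProduct.includeRight (R := ℂ) (Uq.grading n q)
        (Uq.grading n q)) (Uq.f q i) (Uq.f q j) (q ^ (-ip i j)) (nodeSign i * q ^ (-ip i i))
        (1 - cartan i j).toNat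
      rw [h.serre_f i j hij, map_zero] at this
      have this' : serreSeq (Uq.ten 1 (Uq.f q i)) (Uq.ten 1 (Uq.f q j)) (q ^ (-ip i j))
        (nodeSign i * q ^ (-ip i i)) (1 - cartan i j).toNat = 0 := this.symm
      rw [this', zero_mul, zero_mul, smul_zero]

/-- The co-multiplication of `U_q(osp(1|2n))`:
`Δ(k_i^{±1}) = k_i^{±1} ⊗ k_i^{±1}`, `Δ(e_i) = e_i ⊗ k_i + 1 ⊗ e_i`,
`Δ(f_i) = f_i ⊗ 1 + k_i⁻¹ ⊗ f_i`. -/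
def Uq.comul (n : ℕ) (q : ℂ) [Generic q] : Uq n q →ₐ[ℂ] Uq.Sq n q :=
  Uq.lift (comul_relHolds n q)

theorem counit_relHolds (n : ℕ) (q : ℂ) :
    RelHolds (n := n) q (B := ℂ) (fun _ => 1) (fun _ => 1) (fun _ => 0) (fun _ => 0) := by
  have hs : ∀ (c d : ℂ) (m : ℕ), serreSeq (0 : ℂ) 0 c d m = 0 := by
    intro c d m
    induction m with
    | zero => rfl
    | succ m ih => simp [serreSeq]
  refine ⟨?_, ?_, ?_, ?_, ?_, ?_, ?_, fun _ _ _ => hs _ _ _, fun _ _ _ => hs _ _ _⟩ <;> simp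

/-- The co-unit of `U_q(osp(1|2n))`. -/
def Uq.counit (n : ℕ) (q : ℂ) : Uq n q →ₐ[ℂ] ℂ := Uq.lift (counit_relHolds n q)

end Hopf

section Antipode

variable {n : ℕ} {q : ℂ}

/-- A square root of the sign of the node. -/
def nodeRoot (i : Fin n) : ℂ := if (i : ℕ) + 1 = n then Complex.I else 1

theorem nodeRoot_mul_self (i : Fin n) : nodeRoot i * nodeRoot i = nodeSign i := by
  unfold nodeRoot nodeSign; split_ifs <;> simp

open MulOpposite in
theorem anti_relHolds (q : ℂ) [hq : Generic q] (c : Fin n → ℂ) (hc : ∀ i, c i ≠ 0) :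
    RelHolds (n := n) q (fun i => op (Uq.kinv q i)) (fun i => op (Uq.k q i))
      (fun i => op (-(c i * nodeRoot i) • (Uq.e q i * Uq.kinv q i)))
      (fun i => op (-((c i)⁻¹ * nodeRoot i) • (Uq.k q i * Uq.f q i))) := by
  have h := Uq.relHolds n q
  have h0 := hq.ne_zero
  refine ⟨fun i => ?_, fun i => ?_, fun i j => ?_, fun i j => ?_, fun i j => ?_, fun i => ?_,
    fun i j hij => ?_, fun i j hij => ?_, fun i j hij => ?_⟩
  · rw [← op_mul, h.k_kinv, op_one]
  · rw [← op_mul, h.kinv_k, op_one]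
  · rw [← op_mul, ← op_mul, Uq.kinv_comm]
  · rw [← op_mul, ← op_mul, ← op_smul]
    congr 1
    rw [smul_mul_assoc, mul_smul_comm, smul_comm, ← mul_assoc, Uq.kinv_e, smul_mul_assoc,
      smul_smul (q ^ ip i j), ← zpow_add₀ h0, add_neg_cancel, zpow_zero, one_smul, mul_assoc,
      mul_assoc, Uq.kinv_comm]
  · rw [← op_mul, ← op_mul, ← op_smul]
    congr 1
    rw [smul_mul_assoc, mul_smul_comm, smul_comm, ← mul_assoc, Uq.kinv_k_comm,
      mul_assoc (Uq.k q j) (Uq.kinv q i), Uq.kinv_f, mul_smul_comm, smul_smul (q ^ (-ip i j)), ← zpow_add₀ h0, neg_add_cancel,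
      zpow_zero, one_smul, mul_assoc]
  · rw [← op_mul, ← op_mul, ← op_smul, ← op_sub, ← op_sub, ← op_smul]
    congr 1
    have e1 : Uq.k q i * Uq.f q i * (Uq.e q i * Uq.kinv q i) = Uq.f q i * Uq.e q i := by
      have : Uq.k q i * (Uq.f q i * Uq.e q i) = Uq.f q i * Uq.e q i * Uq.k q i := by
        rw [← mul_assoc, h.k_f, smul_mul_assoc, mul_assoc, h.k_e, mul_smul_comm, smul_smul,
          ← zpow_add₀ h0, neg_add_cancel, zpow_zero, one_smul, mul_assoc]
      rw [mul_assoc, ← mul_assoc (Uq.f q i), ← mul_assoc, this, mul_assoc, h.k_kinv, mul_one]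
    have e2 : Uq.e q i * Uq.kinv q i * (Uq.k q i * Uq.f q i) = Uq.e q i * Uq.f q i := by
      rw [mul_assoc, ← mul_assoc (Uq.kinv q i), h.kinv_k, one_mul]
    have s1 : -((c i)⁻¹ * nodeRoot i) * -(c i * nodeRoot i) = nodeSign i := by
      rw [← nodeRoot_mul_self]
      have := hc i
      field_simp
    rw [smul_mul_smul_comm, smul_mul_smul_comm, e1, e2, s1, mul_comm (-(c i * nodeRoot i)), s1,
      smul_smul, nodeSign_mul_self, one_smul, ← neg_sub (Uq.k q i), smul_neg, ← h.e_f_same, neg_sub]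
  · rw [← op_mul, ← op_mul, smul_mul_smul_comm, smul_mul_smul_comm, mul_comm (-(c i * nodeRoot i))]
    congr 2
    have e1 : Uq.k q j * Uq.f q j * (Uq.e q i * Uq.kinv q i) =
        (q ^ ip i j * q ^ (-ip j j)) • (Uq.f q j * Uq.e q i * (Uq.k q j * Uq.kinv q i)) := by
      rw [h.k_f, smul_mul_assoc, mul_assoc, ← mul_assoc (Uq.k q j), h.k_e, smul_mul_assoc,
        mul_smul_comm, smul_smul, ip_comm j i, mul_comm]
      simp only [mul_assoc]
    have e2 : Uq.e q i * Uq.kinv q i * (Uq.k q j * Uq.f q j) =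
        (q ^ ip i j * q ^ (-ip j j)) • (Uq.e q i * Uq.f q j * (Uq.k q j * Uq.kinv q i)) := by
      rw [h.k_f, mul_smul_comm, mul_assoc, ← mul_assoc (Uq.kinv q i), Uq.kinv_f, smul_mul_assoc,
        mul_smul_comm, smul_smul, mul_comm, mul_assoc (Uq.f q j), Uq.kinv_k_comm]
      simp only [mul_assoc]
    rw [e1, e2, h.e_f_ne i j hij]
  · rw [op_smul, op_smul, serreSeq_smul]
    rw [serreSeq_op_zero (serreCase_e h0 hij), smul_zero]
    obtain ⟨t, ht⟩ := serreSeq_twist (Uq.kinv_e q i i) (Uq.kinv_e q i j)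
      (by rw [Uq.kinv_e q j i, ip_comm]) (Uq.kinv_comm q i j) (q ^ ip i j)
      (nodeSign i * q ^ ip i i) (1 - cartan i j).toNat
    rw [ht, h.serre_e i j hij, zero_mul, zero_mul, smul_zero]
  · rw [h.k_f, h.k_f, smul_smul, smul_smul, op_smul, op_smul, serreSeq_smul]
    rw [serreSeq_op_zero (serreCase_f h0 hij), smul_zero]
    obtain ⟨t, ht⟩ := serreSeq_twist (h.k_f i i) (h.k_f i j)
      (by rw [h.k_f j i, ip_comm]) (h.k_comm i j) (q ^ (-ip i j))
      (nodeSign i * q ^ (-ip i i)) (1 - cartan i j).toNat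
    rw [ht, h.serre_f i j hij, zero_mul, zero_mul, smul_zero]

/-- The anti-homomorphism with `k_i ↦ k_i⁻¹`, `e_i ↦ - c_i r_i e_i k_i⁻¹` and
`f_i ↦ - c_i⁻¹ r_i k_i f_i`, where `r_n² = -1` and `r_j = 1` for `j < n`. -/
def Uq.antiHom (q : ℂ) [Generic q] (c : Fin n → ℂ) (hc : ∀ i, c i ≠ 0) :
    Uq n q →ₐ[ℂ] (Uq n q)ᵐᵒᵖ := Uq.lift (anti_relHolds q c hc)

/-- The map `x ↦ (-√-1)^{[x]} x`. -/
def Uq.rot (n : ℕ) (q : ℂ) : Uq n q →ₗ[ℂ] Uq n q :=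
  LinearMap.id - (1 + Complex.I) • oddProj (Uq.grading n q)

/-- The graded anti-homomorphism, `(x y) ↦ (-1)^{[x][y]} A(y) A(x)`, with `k_i ↦ k_i⁻¹`,
`e_i ↦ - c_i e_i k_i⁻¹` and `f_i ↦ - c_i⁻¹ k_i f_i`. The anti-homomorphism above is
multiplied with `(-√-1)^{[x]}`, which turns it into a graded anti-homomorphism. -/
def Uq.gradedAnti (q : ℂ) [Generic q] (c : Fin n → ℂ) (hc : ∀ i, c i ≠ 0) :
    Uq n q →ₗ[ℂ] Uq n q :=
  (MulOpposite.opLinearEquiv ℂ).symm.toLinearMap ∘ₗ (Uq.antiHom q c hc).toLinearMap ∘ₗ Uq.rot n q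

theorem Uq.rot_even {x : Uq n q} (hx : x ∈ Uq.grading n q 0) : Uq.rot n q x = x := by
  simp [Uq.rot, oddProj_even _ hx]

theorem Uq.rot_odd {x : Uq n q} (hx : x ∈ Uq.grading n q 1) : Uq.rot n q x = -Complex.I • x := by
  simp only [Uq.rot, LinearMap.sub_apply, LinearMap.smul_apply, oddProj_odd _ hx, LinearMap.id_apply]
  module

/-- Induction along products with generators. -/
theorem Uq.gen_induction {P : Uq n q → Prop} (one : P 1) (add : ∀ x y, P x → P y → P (x + y))
    (smul : ∀ (a : ℂ) x, P x → P (a • x)) (k : ∀ i x, P x → P (Uq.k q i * x))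
    (kinv : ∀ i x, P x → P (Uq.kinv q i * x)) (e : ∀ i x, P x → P (Uq.e q i * x))
    (f : ∀ i x, P x → P (Uq.f q i * x)) (x : Uq n q) : P x := by
  obtain ⟨x, rfl⟩ := RingQuot.mkAlgHom_surjective ℂ (Rel n q) x
  suffices h : ∀ y, P y → P (RingQuot.mkAlgHom ℂ (Rel n q) x * y) by
    have := h 1 one
    rwa [mul_one] at this
  induction x using FreeAlgebra.induction with
  | grade0 r =>
    intro y hy
    rw [AlgHom.commutes, ← Algebra.smul_def]
    exact smul r y hy
  | grade1 g =>
    intro y hy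
    cases g with
    | k i => exact k i y hy
    | kinv i => exact kinv i y hy
    | e i => exact e i y hy
    | f i => exact f i y hy
  | mul a b ha hb =>
    intro y hy
    rw [map_mul, mul_assoc]
    exact ha _ (hb _ hy)
  | add a b ha hb =>
    intro y hy
    rw [map_add, add_mul]
    exact add _ _ (ha y hy) (hb y hy)

variable [hq : Generic q] (c : Fin n → ℂ) (hc : ∀ i, c i ≠ 0)

theorem Uq.gradedAnti_even {x : Uq n q} (hx : x ∈ Uq.grading n q 0) :
    Uq.gradedAnti q c hc x = (Uq.antiHom q c hc x).unop := by
  simp [Uq.gradedAnti, Uq.rot_even hx]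

theorem Uq.gradedAnti_odd {x : Uq n q} (hx : x ∈ Uq.grading n q 1) :
    Uq.gradedAnti q c hc x = -Complex.I • (Uq.antiHom q c hc x).unop := by
  simp [Uq.gradedAnti, Uq.rot_odd hx]

theorem Uq.gradedAnti_one : Uq.gradedAnti q c hc 1 = 1 := by
  rw [Uq.gradedAnti_even c hc SetLike.GradedOne.one_mem, map_one, MulOpposite.unop_one]

theorem Uq.gradedAnti_mul {i j : ZMod 2} {x y : Uq n q} (hx : x ∈ Uq.grading n q i)
    (hy : y ∈ Uq.grading n q j) :
    Uq.gradedAnti q c hc (x * y) =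
      (if i = 1 ∧ j = 1 then (-1 : ℂ) else 1) •
        (Uq.gradedAnti q c hc y * Uq.gradedAnti q c hc x) := by
  have hxy : x * y ∈ Uq.grading n q (i + j) := SetLike.GradedMul.mul_mem hx hy
  rcases zmod_two i with rfl | rfl <;> rcases zmod_two j with rfl | rfl
  · rw [Uq.gradedAnti_even c hc hxy, Uq.gradedAnti_even c hc hx, Uq.gradedAnti_even c hc hy]
    simp
  · rw [Uq.gradedAnti_odd c hc hxy, Uq.gradedAnti_even c hc hx, Uq.gradedAnti_odd c hc hy]
    simp
  · rw [Uq.gradedAnti_odd c hc hxy, Uq.gradedAnti_odd c hc hx, Uq.gradedAnti_even c hc hy]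
    simp
  · rw [Uq.gradedAnti_even c hc hxy, Uq.gradedAnti_odd c hc hx, Uq.gradedAnti_odd c hc hy]
    simp [smul_smul]

theorem Uq.gradedAnti_k (i : Fin n) : Uq.gradedAnti q c hc (Uq.k q i) = Uq.kinv q i := by
  rw [Uq.gradedAnti_even c hc (Uq.k_mem i), Uq.antiHom, Uq.lift_k, MulOpposite.unop_op]

theorem Uq.gradedAnti_kinv (i : Fin n) : Uq.gradedAnti q c hc (Uq.kinv q i) = Uq.k q i := by
  rw [Uq.gradedAnti_even c hc (Uq.kinv_mem i), Uq.antiHom, Uq.lift_kinv, MulOpposite.unop_op]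

theorem Uq.gradedAnti_e (i : Fin n) :
    Uq.gradedAnti q c hc (Uq.e q i) = -c i • (Uq.e q i * Uq.kinv q i) := by
  have hm := Uq.e_mem (q := q) i
  unfold nodeDeg at hm
  split_ifs at hm with h
  · rw [Uq.gradedAnti_odd c hc hm, Uq.antiHom, Uq.lift_e, MulOpposite.unop_op, smul_smul, nodeRoot,
      if_pos h]
    congr 1
    linear_combination (c i) * Complex.I_mul_I
  · rw [Uq.gradedAnti_even c hc hm, Uq.antiHom, Uq.lift_e, MulOpposite.unop_op, nodeRoot,
      if_neg h, mul_one]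

theorem Uq.gradedAnti_f (i : Fin n) :
    Uq.gradedAnti q c hc (Uq.f q i) = -(c i)⁻¹ • (Uq.k q i * Uq.f q i) := by
  have hm := Uq.f_mem (q := q) i
  unfold nodeDeg at hm
  split_ifs at hm with h
  · rw [Uq.gradedAnti_odd c hc hm, Uq.antiHom, Uq.lift_f, MulOpposite.unop_op, smul_smul, nodeRoot,
      if_pos h]
    congr 1
    linear_combination (c i)⁻¹ * Complex.I_mul_I
  · rw [Uq.gradedAnti_even c hc hm, Uq.antiHom, Uq.lift_f, MulOpposite.unop_op, nodeRoot,
      if_neg h, mul_one]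

theorem Uq.parity_antiHom (x : Uq n q) :
    Uq.parity n q (Uq.antiHom q c hc x).unop = (Uq.antiHom q c hc (Uq.parity n q x)).unop := by
  induction x using Uq.gen_induction with
  | one => simp
  | add x y hx hy => simp [hx, hy]
  | smul a x hx => simp [hx]
  | k i x hx =>
    simp only [map_mul, MulOpposite.unop_mul, hx]
    congr 1
    simp [Uq.antiHom, Uq.lift_k, Uq.parity, Uq.lift_kinv]
  | kinv i x hx =>
    simp only [map_mul, MulOpposite.unop_mul, hx]
    congr 1
    simp [Uq.antiHom, Uq.lift_k, Uq.parity, Uq.lift_kinv]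
  | e i x hx =>
    simp only [map_mul, MulOpposite.unop_mul, hx]
    congr 1
    simp only [Uq.antiHom, Uq.lift_e, Uq.parity, Uq.lift_kinv, MulOpposite.unop_op, map_smul,
      map_mul, MulOpposite.unop_smul, smul_mul_assoc]
    rw [smul_comm]
  | f i x hx =>
    simp only [map_mul, MulOpposite.unop_mul, hx]
    congr 1
    simp only [Uq.antiHom, Uq.lift_f, Uq.parity, Uq.lift_k, MulOpposite.unop_op, map_smul,
      map_mul, MulOpposite.unop_smul, mul_smul_comm]
    rw [smul_comm]

theorem Uq.parity_gradedAnti (x : Uq n q) :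
    Uq.parity n q (Uq.gradedAnti q c hc x) = Uq.gradedAnti q c hc (Uq.parity n q x) := by
  have h : ∀ x, Uq.gradedAnti q c hc x = (Uq.antiHom q c hc x).unop -
      ((1 + Complex.I) / 2) • ((Uq.antiHom q c hc x).unop -
        (Uq.antiHom q c hc (Uq.parity n q x)).unop) := by
    intro x
    simp only [Uq.gradedAnti, Uq.rot, LinearMap.comp_apply, LinearMap.sub_apply, LinearMap.id_apply,
      LinearMap.smul_apply, Uq.oddProj_eq, AlgHom.toLinearMap_apply, map_sub, map_smul, smul_smul]
    simp only [LinearEquiv.coe_coe, MulOpposite.opLinearEquiv, smul_sub]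
    simp [mul_div_assoc, div_eq_mul_inv]
  rw [h, h]
  simp only [map_sub, map_smul, Uq.parity_antiHom]

theorem Uq.gradedAnti_mem {i : ZMod 2} {x : Uq n q} (hx : x ∈ Uq.grading n q i) :
    Uq.gradedAnti q c hc x ∈ Uq.grading n q i := by
  rw [Uq.grading, mem_parityGrading] at hx ⊢
  have hx' : Uq.parity n q x = _ := hx
  refine (Uq.parity_gradedAnti c hc x).trans ?_
  rw [hx', map_smul]

end Antipode

section AntipodeEquiv

variable {n : ℕ} {q : ℂ} [hq : Generic q]

theorem Uq.rot_antiHom (c : Fin n → ℂ) (hc : ∀ i, c i ≠ 0) (x : Uq n q) :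
    Uq.rot n q (Uq.antiHom q c hc x).unop = (Uq.antiHom q c hc (Uq.rot n q x)).unop := by
  simp only [Uq.rot, LinearMap.sub_apply, LinearMap.smul_apply, LinearMap.id_apply, Uq.oddProj_eq,
    Uq.parity_antiHom, map_sub, map_smul, MulOpposite.unop_sub, MulOpposite.unop_smul]

theorem Uq.rot_rot (x : Uq n q) : Uq.rot n q (Uq.rot n q x) = Uq.parity n q x := by
  simp only [Uq.rot, LinearMap.sub_apply, LinearMap.smul_apply, LinearMap.id_apply, Uq.oddProj_eq,
    map_sub, map_smul, Uq.parity_parity]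
  match_scalars
  · linear_combination (1 / 2 : ℂ) * Complex.I_mul_I
  · linear_combination (-1 / 2 : ℂ) * Complex.I_mul_I

theorem Uq.antiHom_antiHom (c c' : Fin n → ℂ) (hc : ∀ i, c i ≠ 0) (hc' : ∀ i, c' i ≠ 0)
    (hcc : ∀ i, c i * c' i = q ^ (-ip i i)) (x : Uq n q) :
    (Uq.antiHom q c hc (Uq.antiHom q c' hc' (Uq.parity n q x)).unop).unop = x := by
  have h := Uq.relHolds n q
  have h0 := hq.ne_zero
  induction x using Uq.gen_induction with
  | one => simp
  | add x y hx hy => simp only [map_add, MulOpposite.unop_add, hx, hy]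
  | smul a x hx => simp only [map_smul, MulOpposite.unop_smul, hx]
  | k i x hx =>
    simp only [map_mul, MulOpposite.unop_mul, hx]
    congr 1
    simp [Uq.antiHom, Uq.lift_k, Uq.parity, Uq.lift_kinv]
  | kinv i x hx =>
    simp only [map_mul, MulOpposite.unop_mul, hx]
    congr 1
    simp [Uq.antiHom, Uq.lift_k, Uq.parity, Uq.lift_kinv]
  | e i x hx =>
    simp only [map_mul, MulOpposite.unop_mul, hx]
    congr 1
    rw [Uq.parity_e]
    simp only [Uq.antiHom, Uq.lift_e, Uq.lift_kinv, MulOpposite.unop_op, map_smul,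
      map_mul, MulOpposite.unop_smul, MulOpposite.unop_mul, mul_smul_comm, smul_smul]
    rw [← mul_assoc (Uq.k q i), h.k_e, smul_mul_assoc, mul_assoc (Uq.e q i), h.k_kinv, mul_one, smul_smul]
    have : nodeSign i * -(c' i * nodeRoot i) * -(c i * nodeRoot i) * q ^ ip i i = 1 := by
      have h1 : q ^ (-ip i i) * q ^ ip i i = 1 := by
        rw [← zpow_add₀ h0, neg_add_cancel, zpow_zero]
      rw [← hcc] at h1
      have h2 := nodeRoot_mul_self i
      have h3 := nodeSign_mul_self i
      rw [← h2] at h3 ⊢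
      linear_combination (nodeRoot i * nodeRoot i * (nodeRoot i * nodeRoot i)) * h1 + h3
    rw [this, one_smul]
  | f i x hx =>
    simp only [map_mul, MulOpposite.unop_mul, hx]
    congr 1
    rw [Uq.parity_f]
    simp only [Uq.antiHom, Uq.lift_f, Uq.lift_k, MulOpposite.unop_op, map_smul,
      map_mul, MulOpposite.unop_smul, MulOpposite.unop_mul, smul_mul_assoc, smul_smul]
    rw [h.k_f, smul_mul_assoc, mul_assoc (Uq.f q i), h.k_kinv, mul_one, smul_smul]
    have : nodeSign i * -((c' i)⁻¹ * nodeRoot i) * -((c i)⁻¹ * nodeRoot i) * q ^ (-ip i i) = 1 := by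
      have h2 := nodeRoot_mul_self i
      have h3 := nodeSign_mul_self i
      rw [← h2] at h3 ⊢
      rw [← hcc]
      have := hc i
      have := hc' i
      field_simp
      linear_combination h3
    rw [this, one_smul]

theorem Uq.gradedAnti_gradedAnti (c c' : Fin n → ℂ) (hc : ∀ i, c i ≠ 0) (hc' : ∀ i, c' i ≠ 0)
    (hcc : ∀ i, c i * c' i = q ^ (-ip i i)) (x : Uq n q) :
    Uq.gradedAnti q c hc (Uq.gradedAnti q c' hc' x) = x := by
  have e : ∀ (c : Fin n → ℂ) (hc : ∀ i, c i ≠ 0) (x : Uq n q), Uq.gradedAnti q c hc x =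
    (Uq.antiHom q c hc (Uq.rot n q x)).unop := fun c hc x => rfl
  rw [e, e, Uq.rot_antiHom, Uq.rot_rot, Uq.antiHom_antiHom c c' hc hc' hcc]

theorem antipodeInv_aux (q : ℂ) [hq : Generic q] (i : Fin n) : q ^ (-ip i i) ≠ 0 :=
  zpow_ne_zero _ hq.ne_zero

/-- The antipode `S` of `U_q(osp(1|2n))`: the bijective linear map with
`S(x y) = (-1)^{[x][y]} S(y) S(x)`, `S(k_i) = k_i⁻¹`, `S(e_i) = - e_i k_i⁻¹`,
`S(f_i) = - k_i f_i`. -/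
def Uq.antipode (n : ℕ) (q : ℂ) [Generic q] : Uq n q ≃ₗ[ℂ] Uq n q :=
  LinearEquiv.ofLinearMap (Uq.gradedAnti q (fun _ => 1) (fun _ => one_ne_zero))
    (Uq.gradedAnti q (fun i => q ^ (-ip i i)) (antipodeInv_aux q))
    (LinearMap.ext fun x => Uq.gradedAnti_gradedAnti _ _ _ _ (fun _ => one_mul _) x)
    (LinearMap.ext fun x => Uq.gradedAnti_gradedAnti _ _ _ _ (fun _ => mul_one _) x)

theorem Uq.antipode_mul {i j : ZMod 2} {x y : Uq n q} (hx : x ∈ Uq.grading n q i)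
    (hy : y ∈ Uq.grading n q j) :
    Uq.antipode n q (x * y) = (if i = 1 ∧ j = 1 then (-1 : ℂ) else 1) •
      (Uq.antipode n q y * Uq.antipode n q x) :=
  Uq.gradedAnti_mul _ _ hx hy

theorem Uq.antipode_one : Uq.antipode n q 1 = 1 := Uq.gradedAnti_one _ _

theorem Uq.antipode_k (i : Fin n) : Uq.antipode n q (Uq.k q i) = Uq.kinv q i :=
  Uq.gradedAnti_k _ _ i

theorem Uq.antipode_e (i : Fin n) :
    Uq.antipode n q (Uq.e q i) = -(Uq.e q i * Uq.kinv q i) := by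
  refine (Uq.gradedAnti_e _ _ i).trans ?_
  exact neg_one_smul ℂ (_ : Uq n q)

theorem Uq.antipode_f (i : Fin n) :
    Uq.antipode n q (Uq.f q i) = -(Uq.k q i * Uq.f q i) := by
  refine (Uq.gradedAnti_f _ _ i).trans ?_
  rw [inv_one]
  exact neg_one_smul ℂ (_ : Uq n q)

/-! ### The reductive subalgebras -/

/-- The subalgebra `U_q(𝔨)` generated by all `k_i^{±1}` and the `e_j`, `f_j` with `j ∈ Θ`. -/
def Uq.levi (q : ℂ) (Θ : Set (Fin n)) : Subalgebra ℂ (Uq n q) :=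
  Algebra.adjoin ℂ (Set.range (Uq.k q) ∪ Set.range (Uq.kinv q) ∪ Uq.e q '' Θ ∪ Uq.f q '' Θ)

variable {Θ : Set (Fin n)}

theorem Uq.k_mem_levi (i : Fin n) : Uq.k q i ∈ Uq.levi q Θ :=
  Algebra.subset_adjoin (Or.inl (Or.inl (Or.inl ⟨i, rfl⟩)))

theorem Uq.kinv_mem_levi (i : Fin n) : Uq.kinv q i ∈ Uq.levi q Θ :=
  Algebra.subset_adjoin (Or.inl (Or.inl (Or.inr ⟨i, rfl⟩)))

theorem Uq.e_mem_levi {i : Fin n} (hi : i ∈ Θ) : Uq.e q i ∈ Uq.levi q Θ :=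
  Algebra.subset_adjoin (Or.inl (Or.inr ⟨i, hi, rfl⟩))

theorem Uq.f_mem_levi {i : Fin n} (hi : i ∈ Θ) : Uq.f q i ∈ Uq.levi q Θ :=
  Algebra.subset_adjoin (Or.inr ⟨i, hi, rfl⟩)

theorem Uq.parity_mem_levi {x : Uq n q} (hx : x ∈ Uq.levi q Θ) :
    Uq.parity n q x ∈ Uq.levi q Θ := by
  induction hx using Algebra.adjoin_induction with
  | mem x hx =>
    rcases hx with ((⟨i, rfl⟩ | ⟨i, rfl⟩) | ⟨i, hi, rfl⟩) | ⟨i, hi, rfl⟩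
    · rw [Uq.mem_even.1 (Uq.k_mem i)]; exact Uq.k_mem_levi i
    · rw [Uq.mem_even.1 (Uq.kinv_mem i)]; exact Uq.kinv_mem_levi i
    · rw [Uq.parity_e]; exact Subalgebra.smul_mem _ (Uq.e_mem_levi hi) _
    · rw [Uq.parity_f]; exact Subalgebra.smul_mem _ (Uq.f_mem_levi hi) _
  | algebraMap r => rw [AlgHom.commutes]; exact Subalgebra.algebraMap_mem _ r
  | add x y _ _ hx hy => rw [map_add]; exact add_mem hx hy
  | mul x y _ _ hx hy => rw [map_mul]; exact mul_mem hx hy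

theorem Uq.oddProj_mem_levi {x : Uq n q} (hx : x ∈ Uq.levi q Θ) :
    oddProj (Uq.grading n q) x ∈ Uq.levi q Θ := by
  rw [Uq.oddProj_eq]
  exact Subalgebra.smul_mem _ (sub_mem hx (Uq.parity_mem_levi hx)) _

theorem Uq.antiHom_mem_levi (c : Fin n → ℂ) (hc : ∀ i, c i ≠ 0) {x : Uq n q}
    (hx : x ∈ Uq.levi q Θ) : (Uq.antiHom q c hc x).unop ∈ Uq.levi q Θ := by
  induction hx using Algebra.adjoin_induction with
  | mem x hx =>
    rcases hx with ((⟨i, rfl⟩ | ⟨i, rfl⟩) | ⟨i, hi, rfl⟩) | ⟨i, hi, rfl⟩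
    · rw [Uq.antiHom, Uq.lift_k]; exact Uq.kinv_mem_levi i
    · rw [Uq.antiHom, Uq.lift_kinv]; exact Uq.k_mem_levi i
    · rw [Uq.antiHom, Uq.lift_e]
      exact Subalgebra.smul_mem _ (mul_mem (Uq.e_mem_levi hi) (Uq.kinv_mem_levi i)) _
    · rw [Uq.antiHom, Uq.lift_f]
      exact Subalgebra.smul_mem _ (mul_mem (Uq.k_mem_levi i) (Uq.f_mem_levi hi)) _
  | algebraMap r => rw [AlgHom.commutes]; exact Subalgebra.algebraMap_mem _ r
  | add x y _ _ hx hy => rw [map_add]; exact add_mem hx hy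
  | mul x y _ _ hx hy => rw [map_mul]; exact mul_mem hy hx

theorem Uq.antipode_mem_levi {x : Uq n q} (hx : x ∈ Uq.levi q Θ) :
    Uq.antipode n q x ∈ Uq.levi q Θ := by
  refine Uq.antiHom_mem_levi (fun _ => 1) (fun _ => one_ne_zero) ?_
  exact sub_mem hx (Subalgebra.smul_mem _ (Uq.oddProj_mem_levi hx) _)

end AntipodeEquiv

/-! ### The algebra of functions on `OSP_q(1|2n)` -/

section Dual

variable {n : ℕ} {q : ℂ}

/-- The functional `f ⊗ g` on `U_q ⊗ U_q`: `a ⊗ b ↦ (-1)^{[a][b]} f(a) g(b)`; the sign equals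
`(-1)^{[g][a]}` whenever `g(b) ≠ 0` for homogeneous `g` and `b`. -/
def hatTensor (f g : Module.Dual ℂ (Uq n q)) : Uq.Sq n q →ₗ[ℂ] ℂ :=
  TensorProduct.dualDistrib ℂ (Uq n q) (Uq n q) (f ⊗ₜ g) ∘ₗ
    koszul (Uq.grading n q) (Uq.grading n q) ∘ₗ
    (GradedTensorProduct.of ℂ (Uq.grading n q) (Uq.grading n q)).symm.toLinearMap

theorem hatTensor_ten (f g : Module.Dual ℂ (Uq n q)) (a b : Uq n q) :
    hatTensor f g (Uq.ten a b) = f a * g b -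
      2 * (f (oddProj (Uq.grading n q) a) * g (oddProj (Uq.grading n q) b)) := by
  have : hatTensor f g (Uq.ten a b) = TensorProduct.dualDistrib ℂ (Uq n q) (Uq n q) (f ⊗ₜ g)
    (koszul (Uq.grading n q) (Uq.grading n q) (a ⊗ₜ b)) := rfl
  rw [this, koszul_tmul, map_sub, map_smul, TensorProduct.dualDistrib_apply,
    TensorProduct.dualDistrib_apply, smul_eq_mul]

theorem Sq_induction {P : Uq.Sq n q → Prop} (ten : ∀ a b, P (Uq.ten a b))
    (add : ∀ x y, P x → P y → P (x + y)) (x : Uq.Sq n q) : P x := by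
  have : ∀ y : Uq n q ⊗[ℂ] Uq n q,
      P (GradedTensorProduct.of ℂ (Uq.grading n q) (Uq.grading n q) y) := by
    intro y
    induction y using TensorProduct.induction_on with
    | zero => have := ten 0 0; rwa [Uq.ten, TensorProduct.zero_tmul] at this
    | tmul a b => exact ten a b
    | add x y hx hy => rw [map_add]; exact add _ _ hx hy
  exact this ((GradedTensorProduct.of ℂ (Uq.grading n q) (Uq.grading n q)).symm x)

theorem hatTensor_add_left (f f' g : Module.Dual ℂ (Uq n q)) :
    hatTensor (f + f') g = hatTensor f g + hatTensor f' g := by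
  unfold hatTensor
  rw [TensorProduct.add_tmul, map_add, LinearMap.add_comp]

theorem hatTensor_add_right (f g g' : Module.Dual ℂ (Uq n q)) :
    hatTensor f (g + g') = hatTensor f g + hatTensor f g' := by
  unfold hatTensor
  rw [TensorProduct.tmul_add, map_add, LinearMap.add_comp]

theorem hatTensor_smul_left (c : ℂ) (f g : Module.Dual ℂ (Uq n q)) :
    hatTensor (c • f) g = c • hatTensor f g := by
  unfold hatTensor
  rw [← TensorProduct.smul_tmul', map_smul, LinearMap.smul_comp]

theorem hatTensor_smul_right (c : ℂ) (f g : Module.Dual ℂ (Uq n q)) :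
    hatTensor f (c • g) = c • hatTensor f g := by
  unfold hatTensor
  rw [TensorProduct.tmul_smul, map_smul, LinearMap.smul_comp]

/-- The parity of the dual: `f ↦ f ∘ σ`. -/
abbrev dualParity (f : Module.Dual ℂ (Uq n q)) : Module.Dual ℂ (Uq n q) :=
  f ∘ₗ (Uq.parity n q).toLinearMap

/-- The odd part of a functional. -/
abbrev dualOdd (f : Module.Dual ℂ (Uq n q)) : Module.Dual ℂ (Uq n q) :=
  f ∘ₗ oddProj (Uq.grading n q)

theorem dualOdd_eq (f : Module.Dual ℂ (Uq n q)) :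
    dualOdd f = (1 / 2 : ℂ) • (f - dualParity f) := by
  ext x
  simp [Uq.oddProj_eq]

theorem Uq.oddProj_parity_comm (x : Uq n q) :
    oddProj (Uq.grading n q) (Uq.parity n q x) = Uq.parity n q (oddProj (Uq.grading n q) x) := by
  simp [Uq.oddProj_eq]

theorem Uq.oddProj_idem (x : Uq n q) :
    oddProj (Uq.grading n q) (oddProj (Uq.grading n q) x) = oddProj (Uq.grading n q) x := by
  simp only [Uq.oddProj_eq, map_smul, map_sub, Uq.parity_parity]
  module

/-- How the product of functionals is evaluated on a product. -/
theorem hatTensor_mul {f g : Module.Dual ℂ (Uq n q)} {ι κ : Type} [Fintype ι] [Fintype κ]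
    {f₁ f₂ : ι → Module.Dual ℂ (Uq n q)} {g₁ g₂ : κ → Module.Dual ℂ (Uq n q)}
    (hf : ∀ x y, f (x * y) = ∑ i, f₁ i x * f₂ i y)
    (hg : ∀ x y, g (x * y) = ∑ i, g₁ i x * g₂ i y) (s s' : Uq.Sq n q) :
    hatTensor f g (s * s') = ∑ i, ∑ j, (hatTensor (f₁ i) (g₁ j) s * hatTensor (f₂ i) (g₂ j) s' -
      2 * (hatTensor (dualOdd (f₁ i)) (g₁ j) s * hatTensor (f₂ i) (dualOdd (g₂ j)) s')) := by
  induction s using Sq_induction with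
  | add x y hx hy =>
    rw [add_mul, map_add, hx, hy, ← Finset.sum_add_distrib]
    refine Finset.sum_congr rfl fun i _ => ?_
    rw [← Finset.sum_add_distrib]
    refine Finset.sum_congr rfl fun j _ => ?_
    simp only [map_add]
    ring
  | ten a b =>
  induction s' using Sq_induction with
  | add x y hx hy =>
    rw [mul_add, map_add, hx, hy, ← Finset.sum_add_distrib]
    refine Finset.sum_congr rfl fun i _ => ?_
    rw [← Finset.sum_add_distrib]
    refine Finset.sum_congr rfl fun j _ => ?_
    simp only [map_add]
    ring
  | ten a' b' =>
  rw [Uq.ten_mul, map_sub, map_smul, hatTensor_ten, hatTensor_ten]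
  simp only [hatTensor_ten, LinearMap.comp_apply, Uq.oddProj_idem]
  have e : ∀ x y : Uq n q, oddProj (Uq.grading n q) (x * y) =
      oddProj (Uq.grading n q) x * y + x * oddProj (Uq.grading n q) y -
        (2 : ℂ) • (oddProj (Uq.grading n q) x * oddProj (Uq.grading n q) y) := by
    intro x y
    have hσ : ∀ x, Uq.parity n q x = x - (2 : ℂ) • oddProj (Uq.grading n q) x := by
      intro x; rw [Uq.oddProj_eq]; module
    rw [Uq.oddProj_eq (x * y), map_mul, hσ, hσ]
    simp only [sub_mul, mul_sub, smul_mul_assoc, mul_smul_comm]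
    module
  simp only [e, map_sub, map_add, map_smul, hf, hg, Uq.oddProj_idem, smul_eq_mul]
  generalize hu : oddProj (Uq.grading n q) a = u
  generalize hv : oddProj (Uq.grading n q) b = v
  generalize hu' : oddProj (Uq.grading n q) a' = u'
  generalize hv' : oddProj (Uq.grading n q) b' = v'
  set F : Uq n q → Uq n q → ℂ := fun x y => ∑ i, f₁ i x * f₂ i y with hF
  set G : Uq n q → Uq n q → ℂ := fun x y => ∑ i, g₁ i x * g₂ i y with hG
  have hF' : ∀ x y, ∑ i, f₁ i x * f₂ i y = F x y := fun _ _ => rfl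
  have hG' : ∀ x y, ∑ i, g₁ i x * g₂ i y = G x y := fun _ _ => rfl
  have key : ∀ x y z w, ∑ i, ∑ j, f₁ i x * f₂ i y * (g₁ j z * g₂ j w) = F x y * G z w :=
    fun x y z w => by rw [hF, hG, Finset.sum_mul_sum]
  trans (∑ i, ∑ j, (f₁ i a * f₂ i a' * (g₁ j b * g₂ j b') -
      2 * (f₁ i u * f₂ i a' * (g₁ j v * g₂ j b')) -
      2 * (f₁ i a * f₂ i u' * (g₁ j b * g₂ j v')) +
      4 * (f₁ i u * f₂ i u' * (g₁ j v * g₂ j v')) -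
      2 * (f₁ i u * f₂ i a' * (g₁ j b * g₂ j v')) +
      4 * (f₁ i u * f₂ i u' * (g₁ j b * g₂ j v')) +
      4 * (f₁ i u * f₂ i a' * (g₁ j v * g₂ j v')) -
      8 * (f₁ i u * f₂ i u' * (g₁ j v * g₂ j v'))))
  · simp only [Finset.sum_add_distrib, Finset.sum_sub_distrib, hF', hG']
    simp only [← Finset.mul_sum, hG']
    simp only [← Finset.sum_mul, hF']
    ring
  · refine Finset.sum_congr rfl fun i _ => Finset.sum_congr rfl fun j _ => ?_
    ring

variable [hq : Generic q]

/-- The product of the dual: `⟨f g, x⟩ = ⟨f ⊗ g, Δ(x)⟩`. -/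
def conv (f g : Module.Dual ℂ (Uq n q)) : Module.Dual ℂ (Uq n q) :=
  hatTensor f g ∘ₗ (Uq.comul n q).toLinearMap

/-- The matrix elements `t_{μν}` of the vector representation. -/
def tEntry (q : ℂ) [Generic q] (μ ν : Idx n) : Module.Dual ℂ (Uq n q) :=
  LinearMap.proj ν ∘ₗ LinearMap.proj μ ∘ₗ (Matrix.ofLinearEquiv ℂ).symm.toLinearMap ∘ₗ
    (vecRep n q).toLinearMap

theorem tEntry_apply (μ ν : Idx n) (x : Uq n q) : tEntry q μ ν x = vecRep n q x μ ν := rfl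

end Dual

section Functions

variable {n : ℕ} {q : ℂ} [hq : Generic q]

/-- The functionals obtained from the `t_{μν}` and the unit `ε` by linear combinations and
products. -/
inductive IsFunc (n : ℕ) (q : ℂ) [Generic q] : Module.Dual ℂ (Uq n q) → Prop
  | entry (μ ν : Idx n) : IsFunc n q (tEntry q μ ν)
  | one : IsFunc n q (Uq.counit n q).toLinearMap
  | add {f g} : IsFunc n q f → IsFunc n q g → IsFunc n q (f + g)
  | smul (c : ℂ) {f} : IsFunc n q f → IsFunc n q (c • f)
  | mul {f g} : IsFunc n q f → IsFunc n q g → IsFunc n q (conv f g)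

/-- The algebra `T_q` of functions on `OSP_q(1|2n)`: the subalgebra of the dual of
`U_q(osp(1|2n))` that is generated by the matrix elements `t_{μν}`. -/
def Tq (n : ℕ) (q : ℂ) [Generic q] : Submodule ℂ (Module.Dual ℂ (Uq n q)) where
  carrier := {f | IsFunc n q f}
  add_mem' := IsFunc.add
  zero_mem' := by
    have := IsFunc.smul (n := n) (q := q) 0 IsFunc.one
    rwa [zero_smul] at this
  smul_mem' := fun c _ h => IsFunc.smul c h

theorem Tq.entry_mem (μ ν : Idx n) : tEntry q μ ν ∈ Tq n q := IsFunc.entry μ ν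

theorem Tq.one_mem : (Uq.counit n q).toLinearMap ∈ Tq n q := IsFunc.one

theorem Tq.conv_mem {f g : Module.Dual ℂ (Uq n q)} (hf : f ∈ Tq n q) (hg : g ∈ Tq n q) :
    conv f g ∈ Tq n q := IsFunc.mul hf hg

/-! ### Parity of functions -/

/-- The sign of the basis vector `w_μ`. -/
def idxSign (μ : Idx n) : ℂ := if (μ : ℤ) = 0 then -1 else 1

theorem idxSign_mul_self (μ : Idx n) : idxSign μ * idxSign μ = 1 := by
  unfold idxSign; split_ifs <;> norm_num

theorem tEntry_parity (x : Uq n q) (μ ν : Idx n) :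
    vecRep n q (Uq.parity n q x) μ ν = idxSign μ * idxSign ν * vecRep n q x μ ν := by
  have mul : ∀ g x : Uq n q,
      (∀ μ ν, vecRep n q (Uq.parity n q g) μ ν = idxSign μ * idxSign ν * vecRep n q g μ ν) →
      (∀ μ ν, vecRep n q (Uq.parity n q x) μ ν = idxSign μ * idxSign ν * vecRep n q x μ ν) →
      ∀ μ ν, vecRep n q (Uq.parity n q (g * x)) μ ν =
        idxSign μ * idxSign ν * vecRep n q (g * x) μ ν := by
    intro g x hg hx μ ν
    rw [map_mul, map_mul, map_mul, Matrix.mul_apply, Matrix.mul_apply, Finset.mul_sum]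
    refine Finset.sum_congr rfl fun s _ => ?_
    rw [hg, hx]
    linear_combination (idxSign μ * idxSign ν * vecRep n q g μ s * vecRep n q x s ν) *
      idxSign_mul_self s
  revert μ ν
  have hd : ∀ (d : Idx n → ℂ) (μ ν : Idx n),
      Matrix.diagonal d μ ν = idxSign μ * idxSign ν * Matrix.diagonal d μ ν := by
    intro d μ ν
    by_cases h : μ = ν
    · rw [h, idxSign_mul_self, one_mul]
    · rw [Matrix.diagonal_apply_ne _ h, mul_zero]
  induction x using Uq.gen_induction with
  | one =>
    intro μ ν
    rw [map_one, map_one]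
    exact hd (fun _ => 1) μ ν
  | add x y hx hy =>
    intro μ ν
    rw [map_add, map_add, map_add, Matrix.add_apply, Matrix.add_apply, hx, hy, mul_add]
  | smul a x hx =>
    intro μ ν
    rw [map_smul, map_smul, map_smul, Matrix.smul_apply, Matrix.smul_apply, hx, mul_smul_comm]
  | k i x hx =>
    refine mul _ _ (fun μ ν => ?_) hx
    rw [Uq.mem_even.1 (Uq.k_mem i), vecRep, Uq.lift_k]
    exact hd _ μ ν
  | kinv i x hx =>
    refine mul _ _ (fun μ ν => ?_) hx
    rw [Uq.mem_even.1 (Uq.kinv_mem i), vecRep, Uq.lift_kinv]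
    exact hd _ μ ν
  | e i x hx =>
    refine mul _ _ (fun μ ν => ?_) hx
    rw [Uq.parity_e, map_smul, vecRep, Uq.lift_e, Matrix.smul_apply]
    have hi := i.2
    unfold tE idxSign nodeSign kd
    simp only [Matrix.of_apply]
    split_ifs <;> first | omega | norm_num
  | f i x hx =>
    refine mul _ _ (fun μ ν => ?_) hx
    rw [Uq.parity_f, map_smul, vecRep, Uq.lift_f, Matrix.smul_apply]
    have hi := i.2
    unfold tF idxSign nodeSign kd
    simp only [Matrix.of_apply]
    split_ifs <;> first | omega | norm_num

theorem Uq.parity_oddProj_ten (f g : Module.Dual ℂ (Uq n q)) (a b : Uq n q) :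
    hatTensor (dualParity f) (dualParity g) (Uq.ten a b) =
      hatTensor f g (Uq.ten (Uq.parity n q a) (Uq.parity n q b)) := by
  simp [hatTensor_ten, Uq.oddProj_parity_comm]

/-- The parity of `U_q ⊗ U_q`. -/
def Uq.parityTwo (n : ℕ) (q : ℂ) : Uq.Sq n q →ₗ[ℂ] Uq.Sq n q :=
  (GradedTensorProduct.of ℂ (Uq.grading n q) (Uq.grading n q)).toLinearMap ∘ₗ
    TensorProduct.map (Uq.parity n q).toLinearMap (Uq.parity n q).toLinearMap ∘ₗ
    (GradedTensorProduct.of ℂ (Uq.grading n q) (Uq.grading n q)).symm.toLinearMap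

theorem Uq.parityTwo_ten (a b : Uq n q) :
    Uq.parityTwo n q (Uq.ten a b) = Uq.ten (Uq.parity n q a) (Uq.parity n q b) := rfl

theorem Uq.parityTwo_mul (s s' : Uq.Sq n q) :
    Uq.parityTwo n q (s * s') = Uq.parityTwo n q s * Uq.parityTwo n q s' := by
  induction s using Sq_induction with
  | add x y hx hy => rw [add_mul, map_add, hx, hy, map_add, add_mul]
  | ten a b =>
  induction s' using Sq_induction with
  | add x y hx hy => rw [mul_add, map_add, hx, hy, map_add, mul_add]
  | ten a' b' =>
  simp only [Uq.parityTwo_ten, Uq.ten_mul, map_sub, map_smul, map_mul, Uq.oddProj_parity_comm]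

theorem Uq.comul_parity (x : Uq n q) :
    Uq.comul n q (Uq.parity n q x) = Uq.parityTwo n q (Uq.comul n q x) := by
  induction x using Uq.gen_induction with
  | one => rw [map_one, map_one]; exact (congrArg₂ Uq.ten (map_one (Uq.parity n q)) (map_one (Uq.parity n q))).symm
  | add x y hx hy => rw [map_add, map_add, map_add, map_add, hx, hy]
  | smul a x hx => rw [map_smul, map_smul, map_smul, map_smul, hx]
  | k i x hx =>
    rw [map_mul, map_mul, map_mul, Uq.parityTwo_mul, hx]
    congr 1
    rw [Uq.mem_even.1 (Uq.k_mem i), Uq.comul, Uq.lift_k, Uq.parityTwo_ten,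
      Uq.mem_even.1 (Uq.k_mem i)]
  | kinv i x hx =>
    rw [map_mul, map_mul, map_mul, Uq.parityTwo_mul, hx]
    congr 1
    rw [Uq.mem_even.1 (Uq.kinv_mem i), Uq.comul, Uq.lift_kinv, Uq.parityTwo_ten,
      Uq.mem_even.1 (Uq.kinv_mem i)]
  | e i x hx =>
    rw [map_mul, map_mul, map_mul, Uq.parityTwo_mul, hx]
    congr 1
    rw [Uq.parity_e, map_smul, Uq.comul, Uq.lift_e, map_add, Uq.parityTwo_ten, Uq.parityTwo_ten,
      Uq.mem_even.1 (Uq.k_mem i), map_one, Uq.parity_e, Uq.ten_smul_left, Uq.ten_smul_right,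
      smul_add]
  | f i x hx =>
    rw [map_mul, map_mul, map_mul, Uq.parityTwo_mul, hx]
    congr 1
    rw [Uq.parity_f, map_smul, Uq.comul, Uq.lift_f, map_add, Uq.parityTwo_ten, Uq.parityTwo_ten,
      Uq.mem_even.1 (Uq.kinv_mem i), map_one, Uq.parity_f, Uq.ten_smul_left, Uq.ten_smul_right,
      smul_add]

theorem dualParity_conv (f g : Module.Dual ℂ (Uq n q)) :
    dualParity (conv f g) = conv (dualParity f) (dualParity g) := by
  ext x
  change hatTensor f g (Uq.comul n q (Uq.parity n q x)) =
    hatTensor (dualParity f) (dualParity g) (Uq.comul n q x)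
  rw [Uq.comul_parity]
  induction Uq.comul n q x using Sq_induction with
  | ten a b => rw [Uq.parity_oddProj_ten]; rfl
  | add x y hx hy => rw [map_add, map_add, map_add, hx, hy]

theorem Uq.counit_parity (x : Uq n q) : Uq.counit n q (Uq.parity n q x) = Uq.counit n q x := by
  have : (Uq.counit n q).comp (Uq.parity n q) = Uq.counit n q := by
    apply Uq.hom_ext <;> intro i <;>
    simp [Uq.parity, Uq.lift_k, Uq.lift_kinv, Uq.lift_e, Uq.lift_f, Uq.counit]
  exact DFunLike.congr_fun this x

theorem dualParity_add (f g : Module.Dual ℂ (Uq n q)) :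
    dualParity (f + g) = dualParity f + dualParity g := LinearMap.add_comp _ _ _

theorem dualParity_smul (c : ℂ) (f : Module.Dual ℂ (Uq n q)) :
    dualParity (c • f) = c • dualParity f := LinearMap.smul_comp _ _ _

theorem dualParity_dualParity (f : Module.Dual ℂ (Uq n q)) : dualParity (dualParity f) = f := by
  ext x
  simp [Uq.parity_parity]

theorem dualParity_tEntry (μ ν : Idx n) :
    dualParity (tEntry q μ ν) = (idxSign μ * idxSign ν) • tEntry q μ ν := by
  ext x
  exact tEntry_parity x μ ν

theorem Tq.parity_mem {f : Module.Dual ℂ (Uq n q)} (hf : f ∈ Tq n q) : dualParity f ∈ Tq n q := by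
  have hf' : IsFunc n q f := hf
  induction hf' with
  | entry μ ν =>
    rw [dualParity_tEntry]
    exact Submodule.smul_mem _ _ (Tq.entry_mem μ ν)
  | one =>
    have : dualParity (Uq.counit n q).toLinearMap = (Uq.counit n q).toLinearMap := by
      ext x
      exact Uq.counit_parity x
    rw [this]
    exact Tq.one_mem
  | add h1 h2 i1 i2 =>
    rw [dualParity_add]
    exact add_mem (i1 h1) (i2 h2)
  | smul c h i => rw [dualParity_smul]; exact Submodule.smul_mem _ _ (i h)
  | mul h1 h2 i1 i2 => rw [dualParity_conv]; exact Tq.conv_mem (i1 h1) (i2 h2)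

theorem Tq.odd_mem {f : Module.Dual ℂ (Uq n q)} (hf : f ∈ Tq n q) : dualOdd f ∈ Tq n q := by
  rw [dualOdd_eq]
  exact Submodule.smul_mem _ _ (sub_mem hf (Tq.parity_mem hf))

/-- The parity automorphism `f ↦ (-1)^{[f]} f` of `T_q`, `⟨σ f, x⟩ = ⟨f, σ x⟩`. -/
def Tq.parity (n : ℕ) (q : ℂ) [Generic q] : Tq n q →ₗ[ℂ] Tq n q :=
  LinearMap.restrict ((Uq.parity n q).toLinearMap.lcomp ℂ ℂ) (fun _ => Tq.parity_mem)

theorem Tq.parity_coe (f : Tq n q) : (Tq.parity n q f : Module.Dual ℂ (Uq n q)) = dualParity f :=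
  rfl

theorem Tq.parity_parity (f : Tq n q) : Tq.parity n q (Tq.parity n q f) = f :=
  Subtype.ext (dualParity_dualParity (f : Module.Dual ℂ (Uq n q)))

/-- The `ℤ/2`-grading of `T_q`: a functional is even if it vanishes on odd elements, and odd if it
vanishes on even elements. -/
def Tq.grading (n : ℕ) (q : ℂ) [Generic q] : ZMod 2 → Submodule ℂ (Tq n q) :=
  parityGrading (Tq.parity n q)

instance Tq.decomposition (n : ℕ) (q : ℂ) [Generic q] :
    DirectSum.Decomposition (Tq.grading n q) :=
  parityDecomposition _ Tq.parity_parity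

/-! ### Co-multiplication of functions -/

/-- The functional `a ⊗ b ↦ ∑ f₁(a) f₂(b)` on `U_q ⊗ U_q`, for `∑ f₁ ⊗ f₂` in `T_q ⊗ T_q`. -/
def Tq.pairing (n : ℕ) (q : ℂ) [Generic q] :
    Tq n q ⊗[ℂ] Tq n q →ₗ[ℂ] Module.Dual ℂ (Uq n q ⊗[ℂ] Uq n q) :=
  TensorProduct.dualDistrib ℂ (Uq n q) (Uq n q) ∘ₗ
    TensorProduct.map (Tq n q).subtype (Tq n q).subtype

theorem Tq.pairing_tmul (f g : Tq n q) (a b : Uq n q) :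
    Tq.pairing n q (f ⊗ₜ g) (a ⊗ₜ b) = f.1 a * g.1 b := by
  simp [Tq.pairing]

theorem Tq.pairing_injective : Function.Injective (Tq.pairing n q) := by
  refine (injective_iff_map_eq_zero _).2 fun X hX => ?_
  let b := Module.Free.chooseBasis ℂ (Tq n q)
  obtain ⟨c, rfl⟩ := TensorProduct.eq_repr_basis_left b X
  have h : ∀ y : Uq n q, (c.sum fun i g => (g.1 y) • b i : Tq n q) = 0 := by
    intro y
    apply Subtype.ext
    ext x
    have := congrArg (fun F => F (x ⊗ₜ y)) hX
    simp only [Finsupp.sum, map_sum, LinearMap.sum_apply, Tq.pairing_tmul,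
      LinearMap.zero_apply] at this
    simp only [Finsupp.sum, Submodule.coe_sum, LinearMap.sum_apply, Submodule.coe_smul,
      LinearMap.smul_apply, smul_eq_mul, Submodule.coe_zero, LinearMap.zero_apply]
    rw [← this]
    exact Finset.sum_congr rfl fun i _ => mul_comm _ _
  have h0 : ∀ i, c i = 0 := by
    intro i
    apply Subtype.ext
    ext y
    by_cases hi : i ∈ c.support
    · exact linearIndependent_iff'.1 b.linearIndependent c.support (fun i => (c i).1 y) (h y) i hi
    · rw [Finsupp.notMem_support_iff.1 hi]
  have : c = 0 := Finsupp.ext h0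
  rw [this, Finsupp.sum_zero_index]

theorem Tq.mem_range_of_expansion {f : Module.Dual ℂ (Uq n q)} {ι : Type} [Fintype ι]
    {f₁ f₂ : ι → Tq n q} (h : ∀ x y, f (x * y) = ∑ i, (f₁ i).1 x * (f₂ i).1 y) :
    f ∘ₗ LinearMap.mul' ℂ (Uq n q) ∈ LinearMap.range (Tq.pairing n q) := by
  refine ⟨∑ i, f₁ i ⊗ₜ f₂ i, ?_⟩
  ext x y
  simp only [map_sum, TensorProduct.AlgebraTensorModule.curry_apply, TensorProduct.curry_apply,
    LinearMap.restrictScalars_self, LinearMap.sum_apply, Tq.pairing_tmul, LinearMap.comp_apply,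
    LinearMap.mul'_apply, h]

theorem Tq.expansion_of_mem_range {f : Module.Dual ℂ (Uq n q)}
    (h : f ∘ₗ LinearMap.mul' ℂ (Uq n q) ∈ LinearMap.range (Tq.pairing n q)) :
    ∃ (m : ℕ) (f₁ f₂ : Fin m → Tq n q), ∀ x y, f (x * y) = ∑ i, (f₁ i).1 x * (f₂ i).1 y := by
  obtain ⟨X, hX⟩ := h
  have key : ∀ X : Tq n q ⊗[ℂ] Tq n q, ∃ (m : ℕ) (f₁ f₂ : Fin m → Tq n q), ∀ x y,
      Tq.pairing n q X (x ⊗ₜ y) = ∑ i, (f₁ i).1 x * (f₂ i).1 y := by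
    intro X
    obtain ⟨m, f₁, f₂, rfl⟩ := TensorProduct.exists_sum_tmul_eq X
    refine ⟨m, f₁, f₂, fun x y => ?_⟩
    simp only [map_sum, LinearMap.sum_apply, Tq.pairing_tmul]
  obtain ⟨m, f₁, f₂, h⟩ := key X
  refine ⟨m, f₁, f₂, fun x y => ?_⟩
  rw [← h, hX]
  rfl

theorem Tq.comul_exists {f : Module.Dual ℂ (Uq n q)} (hf : f ∈ Tq n q) :
    f ∘ₗ LinearMap.mul' ℂ (Uq n q) ∈ LinearMap.range (Tq.pairing n q) := by
  have hf' : IsFunc n q f := hf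
  induction hf' with
  | entry μ ν =>
    refine Tq.mem_range_of_expansion (ι := Idx n) (f₁ := fun s => ⟨_, Tq.entry_mem μ s⟩)
      (f₂ := fun s => ⟨_, Tq.entry_mem s ν⟩) fun x y => ?_
    simp only [tEntry_apply, map_mul, Matrix.mul_apply]
  | one =>
    refine Tq.mem_range_of_expansion (ι := Unit) (f₁ := fun _ => ⟨_, Tq.one_mem⟩)
      (f₂ := fun _ => ⟨_, Tq.one_mem⟩) fun x y => ?_
    simp
  | add h1 h2 i1 i2 =>
    rw [LinearMap.add_comp]
    exact add_mem (i1 h1) (i2 h2)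
  | smul c h i =>
    rw [LinearMap.smul_comp]
    exact Submodule.smul_mem _ _ (i h)
  | @mul f g h1 h2 i1 i2 =>
    obtain ⟨m, f₁, f₂, hf⟩ := Tq.expansion_of_mem_range (i1 h1)
    obtain ⟨m', g₁, g₂, hg⟩ := Tq.expansion_of_mem_range (i2 h2)
    refine Tq.mem_range_of_expansion (ι := (Fin m × Fin m') × Bool)
      (f₁ := fun i => if i.2 then ⟨_, Tq.conv_mem (f₁ i.1.1).2 (g₁ i.1.2).2⟩
        else (-2 : ℂ) • ⟨_, Tq.conv_mem (Tq.odd_mem (f₁ i.1.1).2) (g₁ i.1.2).2⟩)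
      (f₂ := fun i => if i.2 then ⟨_, Tq.conv_mem (f₂ i.1.1).2 (g₂ i.1.2).2⟩
        else ⟨_, Tq.conv_mem (f₂ i.1.1).2 (Tq.odd_mem (g₂ i.1.2).2)⟩) fun x y => ?_
    change hatTensor f g (Uq.comul n q (x * y)) = _
    rw [map_mul, hatTensor_mul hf hg, Fintype.sum_prod_type, Fintype.sum_prod_type]
    refine Finset.sum_congr rfl fun i _ => Finset.sum_congr rfl fun j _ => ?_
    rw [Fintype.sum_bool]
    simp only [if_true, Bool.false_eq_true, if_false, Submodule.coe_smul, LinearMap.smul_apply,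
      smul_eq_mul, conv, LinearMap.comp_apply, AlgHom.toLinearMap_apply]
    ring

/-- The dual of the multiplication: the unique `∑ f₁ ⊗ f₂` with `⟨f, a b⟩ = ∑ f₁(a) f₂(b)`. -/
def Tq.split (n : ℕ) (q : ℂ) [Generic q] : Tq n q →ₗ[ℂ] Tq n q ⊗[ℂ] Tq n q :=
  (LinearEquiv.ofInjective (Tq.pairing n q) Tq.pairing_injective).symm.toLinearMap ∘ₗ
    LinearMap.codRestrict (LinearMap.range (Tq.pairing n q))
      ((LinearMap.mul' ℂ (Uq n q)).lcomp ℂ ℂ ∘ₗ (Tq n q).subtype)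
      (fun f => Tq.comul_exists f.2)

theorem Tq.pairing_split (f : Tq n q) (a b : Uq n q) :
    Tq.pairing n q (Tq.split n q f) (a ⊗ₜ b) = f.1 (a * b) := by
  have := LinearEquiv.ofInjective_symm_apply (f := Tq.pairing n q) (h := Tq.pairing_injective)
    (LinearMap.codRestrict (LinearMap.range (Tq.pairing n q))
      ((LinearMap.mul' ℂ (Uq n q)).lcomp ℂ ℂ ∘ₗ (Tq n q).subtype)
      (fun f => Tq.comul_exists f.2) f)
  have := congrArg (fun F => F (a ⊗ₜ b)) this
  exact this

/-- The co-multiplication of `T_q`: the unique element `∑ f₁ ⊗ f₂` with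
`⟨f, a b⟩ = ∑ (-1)^{[f₁][f₂]} f₁(a) f₂(b)`. -/
def Tq.comul (n : ℕ) (q : ℂ) [Generic q] : Tq n q →ₗ[ℂ] Tq n q ⊗[ℂ] Tq n q :=
  koszul (Tq.grading n q) (Tq.grading n q) ∘ₗ Tq.split n q

/-- The co-unit of `T_q`: `f ↦ ⟨f, 1⟩`. -/
def Tq.counit (n : ℕ) (q : ℂ) [Generic q] : Tq n q →ₗ[ℂ] ℂ :=
  LinearMap.applyₗ (1 : Uq n q) ∘ₗ (Tq n q).subtype

end Functions

/-! ### The antipode of functions -/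

section FunctionAntipode

variable {n : ℕ} {q : ℂ} [hq : Generic q]

/-- The index `-μ`. -/
def Idx.neg (μ : Idx n) : Idx n := ⟨-μ, by have := Finset.mem_Icc.1 μ.2; rw [Finset.mem_Icc]; omega⟩

theorem Idx.coe_neg (μ : Idx n) : ((Idx.neg μ : Idx n) : ℤ) = -μ := rfl

theorem Idx.neg_neg (μ : Idx n) : μ.neg.neg = μ := Subtype.ext (_root_.neg_neg _)

/-- The weights of the invariant form. -/
def formWeight (q : ℂ) (μ : Idx n) : ℂ :=
  if (μ : ℤ) = 0 then Complex.I * (-q) ^ (-(n : ℤ))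
  else if 0 < (μ : ℤ) then (-q) ^ ((μ : ℤ) - 2 * n) else (-q) ^ ((μ : ℤ) + 1)

theorem formWeight_ne_zero (μ : Idx n) : formWeight q μ ≠ 0 := by
  have h0 : -q ≠ 0 := neg_ne_zero.2 hq.ne_zero
  unfold formWeight
  split_ifs
  · exact mul_ne_zero Complex.I_ne_zero (zpow_ne_zero _ h0)
  · exact zpow_ne_zero _ h0
  · exact zpow_ne_zero _ h0

theorem tEntry_antiHom (x : Uq n q) (μ ν : Idx n) :
    vecRep n q (Uq.antiHom q (fun _ => 1) (fun _ => one_ne_zero) x).unop μ ν =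
      (formWeight q ν / formWeight q μ) * vecRep n q x ν.neg μ.neg := by
  have h0 := hq.ne_zero
  have h0' : -q ≠ 0 := neg_ne_zero.2 h0
  have mul : ∀ g x : Uq n q,
      (∀ μ ν, vecRep n q (Uq.antiHom q (fun _ => 1) (fun _ => one_ne_zero) g).unop μ ν =
        (formWeight q ν / formWeight q μ) * vecRep n q g ν.neg μ.neg) →
      (∀ μ ν, vecRep n q (Uq.antiHom q (fun _ => 1) (fun _ => one_ne_zero) x).unop μ ν =
        (formWeight q ν / formWeight q μ) * vecRep n q x ν.neg μ.neg) →
      ∀ μ ν, vecRep n q (Uq.antiHom q (fun _ => 1) (fun _ => one_ne_zero) (g * x)).unop μ ν =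
        (formWeight q ν / formWeight q μ) * vecRep n q (g * x) ν.neg μ.neg := by
    intro g x hg hx μ ν
    rw [map_mul, map_mul, MulOpposite.unop_mul, map_mul, Matrix.mul_apply, Matrix.mul_apply,
      Finset.mul_sum]
    refine Finset.sum_bij' (fun s _ => Idx.neg s) (fun s _ => Idx.neg s) (by simp) (by simp)
      (fun s _ => Idx.neg_neg s) (fun s _ => Idx.neg_neg s) fun s _ => ?_
    rw [hg, hx]
    have := formWeight_ne_zero (q := q) s
    field_simp
  have hd : ∀ (d d' : Idx n → ℂ) (μ ν : Idx n), (∀ μ, d μ = d' μ.neg) →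
      Matrix.diagonal d μ ν = (formWeight q ν / formWeight q μ) *
        Matrix.diagonal d' ν.neg μ.neg := by
    intro d d' μ ν hdd
    by_cases h : μ = ν
    · rw [h, div_self (formWeight_ne_zero ν), one_mul, Matrix.diagonal_apply_eq,
        Matrix.diagonal_apply_eq, hdd]
    · have h' : ν.neg ≠ μ.neg := fun h' => h (by rw [← Idx.neg_neg μ, ← h', Idx.neg_neg])
      rw [Matrix.diagonal_apply_ne _ h, Matrix.diagonal_apply_ne _ h', mul_zero]
  have hw : ∀ (μ : Idx n), wt μ.neg = -wt μ := by
    intro μ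
    funext a
    have := a.2
    simp only [wt, Idx.neg, Pi.neg_apply]
    split_ifs <;> omega
  have hq1 : ∀ m : ℤ, (-q) ^ (m + 1) = (-q) ^ m * (-q) := fun m => zpow_add_one₀ h0' m
  have hqm : ∀ m : ℤ, (-q) ^ m ≠ 0 := fun m => zpow_ne_zero m h0'
  revert μ ν
  induction x using Uq.gen_induction with
  | one =>
    intro μ ν
    rw [map_one, MulOpposite.unop_one, map_one]
    exact hd (fun _ => 1) (fun _ => 1) μ ν (fun _ => rfl)
  | add x y hx hy =>
    intro μ ν
    rw [map_add, MulOpposite.unop_add, map_add, map_add, Matrix.add_apply, Matrix.add_apply, hx,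
      hy, mul_add]
  | smul a x hx =>
    intro μ ν
    rw [map_smul, MulOpposite.unop_smul, map_smul, map_smul, Matrix.smul_apply, Matrix.smul_apply,
      hx, mul_smul_comm]
  | k i x hx =>
    refine mul _ _ (fun μ ν => ?_) hx
    rw [Uq.antiHom, Uq.lift_k, MulOpposite.unop_op, vecRep, Uq.lift_k, Uq.lift_kinv]
    refine hd _ _ μ ν fun μ => ?_
    rw [hw, dotProduct_neg]
  | kinv i x hx =>
    refine mul _ _ (fun μ ν => ?_) hx
    rw [Uq.antiHom, Uq.lift_kinv, MulOpposite.unop_op, vecRep, Uq.lift_k, Uq.lift_kinv]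
    refine hd _ _ μ ν fun μ => ?_
    rw [hw, dotProduct_neg, _root_.neg_neg]
  | e i x hx =>
    refine mul _ _ (fun μ ν => ?_) hx
    rw [Uq.antiHom, Uq.lift_e, MulOpposite.unop_op, map_smul, map_mul, vecRep, Uq.lift_e,
      Uq.lift_kinv, Matrix.smul_apply, tKinv, Matrix.mul_diagonal, root_dot]
    have hi := i.2
    have hμ := Finset.mem_Icc.1 μ.2
    have hν := Finset.mem_Icc.1 ν.2
    have c1 := Idx.coe_neg μ
    have c2 := Idx.coe_neg ν
    by_cases hn : (i : ℕ) + 1 = n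
    · have hr : nodeRoot i = Complex.I := if_pos hn
      rw [hr]
      by_cases h1 : (μ : ℤ) = n ∧ (ν : ℤ) = 0
      · obtain ⟨h1, h2⟩ := h1
        have v1 : tE i μ ν = 1 := by
          unfold tE kd
          simp only [Matrix.of_apply, if_pos hn]
          split_ifs <;> first | omega | norm_num
        have v2 : tE i ν.neg μ.neg = -1 := by
          unfold tE kd
          simp only [Matrix.of_apply, if_pos hn]
          split_ifs <;> first | omega | norm_num
        have ex : wt ν i - (if h : (i : ℕ) + 1 < n then wt ν ⟨i + 1, h⟩ else 0) = 0 := by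
          simp only [wt]
          split_ifs <;> omega
        have fm : formWeight q μ = (-q) ^ (-(n : ℤ)) := by
          unfold formWeight
          split_ifs <;> first | omega | rfl | (congr 1; omega) | (congr 2; omega)
        have fn : formWeight q ν = Complex.I * (-q) ^ (-(n : ℤ)) := by
          unfold formWeight
          split_ifs <;> first | omega | rfl | (congr 1; omega) | (congr 2; omega)
        rw [v1, v2, ex, fm, fn]
        simp only [hq1, neg_zero, neg_neg, zpow_zero, zpow_one, zpow_neg_one, inv_one, smul_eq_mul]
        have hz := hqm (-(n : ℤ))
        have hI := Complex.I_mul_I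
        have hI0 := Complex.I_ne_zero
        field_simp
        all_goals try rw [Complex.I_sq]
        all_goals try norm_num
      by_cases h2 : (μ : ℤ) = 0 ∧ (ν : ℤ) = -n
      · obtain ⟨h2, h3⟩ := h2
        have v1 : tE i μ ν = -1 := by
          unfold tE kd
          simp only [Matrix.of_apply, if_pos hn]
          split_ifs <;> first | omega | norm_num
        have v2 : tE i ν.neg μ.neg = 1 := by
          unfold tE kd
          simp only [Matrix.of_apply, if_pos hn]
          split_ifs <;> first | omega | norm_num
        have ex : wt ν i - (if h : (i : ℕ) + 1 < n then wt ν ⟨i + 1, h⟩ else 0) = -1 := by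
          simp only [wt]
          split_ifs <;> omega
        have fm : formWeight q μ = Complex.I * (-q) ^ (-(n : ℤ)) := by
          unfold formWeight
          split_ifs <;> first | omega | rfl | (congr 1; omega) | (congr 2; omega)
        have fn : formWeight q ν = (-q) ^ (-(n : ℤ) + 1) := by
          unfold formWeight
          split_ifs <;> first | omega | rfl | (congr 1; omega) | (congr 2; omega)
        rw [v1, v2, ex, fm, fn]
        simp only [hq1, neg_zero, neg_neg, zpow_zero, zpow_one, zpow_neg_one, inv_one, smul_eq_mul]
        have hz := hqm (-(n : ℤ))
        have hI := Complex.I_mul_I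
        have hI0 := Complex.I_ne_zero
        field_simp
        all_goals try rw [Complex.I_sq]
        all_goals try norm_num
      have z1 : tE i μ ν = 0 := by
        unfold tE kd
        simp only [Matrix.of_apply, if_pos hn]
        split_ifs <;> first | omega | norm_num
      have z2 : tE i ν.neg μ.neg = 0 := by
        unfold tE kd
        simp only [Matrix.of_apply, if_pos hn]
        split_ifs <;> first | omega | norm_num
      simp [z1, z2]
    · have hr : nodeRoot i = 1 := if_neg hn
      rw [hr]
      by_cases h1 : (μ : ℤ) = i + 1 ∧ (ν : ℤ) = i + 1 + 1
      · obtain ⟨h1, h2⟩ := h1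
        have v1 : tE i μ ν = 1 := by
          unfold tE kd
          simp only [Matrix.of_apply, if_neg hn]
          split_ifs <;> first | omega | norm_num
        have v2 : tE i ν.neg μ.neg = 1 := by
          unfold tE kd
          simp only [Matrix.of_apply, if_neg hn]
          split_ifs <;> first | omega | norm_num
        have ex : wt ν i - (if h : (i : ℕ) + 1 < n then wt ν ⟨i + 1, h⟩ else 0) = -1 := by
          simp only [wt]
          split_ifs <;> omega
        have fm : formWeight q μ = (-q) ^ ((i : ℤ) + 1 - 2 * n) := by
          unfold formWeight
          split_ifs <;> first | omega | rfl | (congr 1; omega) | (congr 2; omega)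
        have fn : formWeight q ν = (-q) ^ ((i : ℤ) + 1 - 2 * n + 1) := by
          unfold formWeight
          split_ifs <;> first | omega | rfl | (congr 1; omega) | (congr 2; omega)
        rw [v1, v2, ex, fm, fn]
        simp only [hq1, neg_zero, neg_neg, zpow_zero, zpow_one, zpow_neg_one, inv_one, smul_eq_mul]
        have hz := hqm ((i : ℤ) + 1 - 2 * n)
        have hI := Complex.I_mul_I
        have hI0 := Complex.I_ne_zero
        field_simp
        all_goals try rw [Complex.I_sq]
        all_goals try norm_num
      by_cases h2 : (μ : ℤ) = -(i + 1) - 1 ∧ (ν : ℤ) = -(i + 1)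
      · obtain ⟨h2, h3⟩ := h2
        have v1 : tE i μ ν = 1 := by
          unfold tE kd
          simp only [Matrix.of_apply, if_neg hn]
          split_ifs <;> first | omega | norm_num
        have v2 : tE i ν.neg μ.neg = 1 := by
          unfold tE kd
          simp only [Matrix.of_apply, if_neg hn]
          split_ifs <;> first | omega | norm_num
        have ex : wt ν i - (if h : (i : ℕ) + 1 < n then wt ν ⟨i + 1, h⟩ else 0) = -1 := by
          simp only [wt]
          split_ifs <;> omega
        have fm : formWeight q μ = (-q) ^ (-(i : ℤ) - 1) := by
          unfold formWeight
          split_ifs <;> first | omega | rfl | (congr 1; omega) | (congr 2; omega)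
        have fn : formWeight q ν = (-q) ^ (-(i : ℤ) - 1 + 1) := by
          unfold formWeight
          split_ifs <;> first | omega | rfl | (congr 1; omega) | (congr 2; omega)
        rw [v1, v2, ex, fm, fn]
        simp only [hq1, neg_zero, neg_neg, zpow_zero, zpow_one, zpow_neg_one, inv_one, smul_eq_mul]
        have hz := hqm (-(i : ℤ) - 1)
        have hI := Complex.I_mul_I
        have hI0 := Complex.I_ne_zero
        field_simp
        all_goals try rw [Complex.I_sq]
        all_goals try norm_num
      have z1 : tE i μ ν = 0 := by
        unfold tE kd
        simp only [Matrix.of_apply, if_neg hn]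
        split_ifs <;> first | omega | norm_num
      have z2 : tE i ν.neg μ.neg = 0 := by
        unfold tE kd
        simp only [Matrix.of_apply, if_neg hn]
        split_ifs <;> first | omega | norm_num
      simp [z1, z2]
  | f i x hx =>
    refine mul _ _ (fun μ ν => ?_) hx
    rw [Uq.antiHom, Uq.lift_f, MulOpposite.unop_op, map_smul, map_mul, vecRep, Uq.lift_f,
      Uq.lift_k, Matrix.smul_apply, tK, Matrix.diagonal_mul, root_dot]
    have hi := i.2
    have hμ := Finset.mem_Icc.1 μ.2
    have hν := Finset.mem_Icc.1 ν.2
    have c1 := Idx.coe_neg μ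
    have c2 := Idx.coe_neg ν
    by_cases hn : (i : ℕ) + 1 = n
    · have hr : nodeRoot i = Complex.I := if_pos hn
      rw [hr]
      by_cases h1 : (μ : ℤ) = 0 ∧ (ν : ℤ) = n
      · obtain ⟨h1, h2⟩ := h1
        have v1 : tF i μ ν = 1 := by
          unfold tF kd
          simp only [Matrix.of_apply, if_pos hn]
          split_ifs <;> first | omega | norm_num
        have v2 : tF i ν.neg μ.neg = 1 := by
          unfold tF kd
          simp only [Matrix.of_apply, if_pos hn]
          split_ifs <;> first | omega | norm_num
        have ex : wt μ i - (if h : (i : ℕ) + 1 < n then wt μ ⟨i + 1, h⟩ else 0) = 0 := by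
          simp only [wt]
          split_ifs <;> omega
        have fm : formWeight q μ = Complex.I * (-q) ^ (-(n : ℤ)) := by
          unfold formWeight
          split_ifs <;> first | omega | rfl | (congr 1; omega) | (congr 2; omega)
        have fn : formWeight q ν = (-q) ^ (-(n : ℤ)) := by
          unfold formWeight
          split_ifs <;> first | omega | rfl | (congr 1; omega) | (congr 2; omega)
        rw [v1, v2, ex, fm, fn]
        simp only [hq1, neg_zero, neg_neg, zpow_zero, zpow_one, zpow_neg_one, inv_one, smul_eq_mul]
        have hz := hqm (-(n : ℤ))
        have hI := Complex.I_mul_I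
        have hI0 := Complex.I_ne_zero
        field_simp
        all_goals try rw [Complex.I_sq]
        all_goals try norm_num
      by_cases h2 : (μ : ℤ) = -n ∧ (ν : ℤ) = 0
      · obtain ⟨h2, h3⟩ := h2
        have v1 : tF i μ ν = 1 := by
          unfold tF kd
          simp only [Matrix.of_apply, if_pos hn]
          split_ifs <;> first | omega | norm_num
        have v2 : tF i ν.neg μ.neg = 1 := by
          unfold tF kd
          simp only [Matrix.of_apply, if_pos hn]
          split_ifs <;> first | omega | norm_num
        have ex : wt μ i - (if h : (i : ℕ) + 1 < n then wt μ ⟨i + 1, h⟩ else 0) = -1 := by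
          simp only [wt]
          split_ifs <;> omega
        have fm : formWeight q μ = (-q) ^ (-(n : ℤ) + 1) := by
          unfold formWeight
          split_ifs <;> first | omega | rfl | (congr 1; omega) | (congr 2; omega)
        have fn : formWeight q ν = Complex.I * (-q) ^ (-(n : ℤ)) := by
          unfold formWeight
          split_ifs <;> first | omega | rfl | (congr 1; omega) | (congr 2; omega)
        rw [v1, v2, ex, fm, fn]
        simp only [hq1, neg_zero, neg_neg, zpow_zero, zpow_one, zpow_neg_one, inv_one, smul_eq_mul]
        have hz := hqm (-(n : ℤ))
        have hI := Complex.I_mul_I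
        have hI0 := Complex.I_ne_zero
        field_simp
        all_goals try rw [Complex.I_sq]
        all_goals try norm_num
      have z1 : tF i μ ν = 0 := by
        unfold tF kd
        simp only [Matrix.of_apply, if_pos hn]
        split_ifs <;> first | omega | norm_num
      have z2 : tF i ν.neg μ.neg = 0 := by
        unfold tF kd
        simp only [Matrix.of_apply, if_pos hn]
        split_ifs <;> first | omega | norm_num
      simp [z1, z2]
    · have hr : nodeRoot i = 1 := if_neg hn
      rw [hr]
      by_cases h1 : (μ : ℤ) = i + 1 + 1 ∧ (ν : ℤ) = i + 1
      · obtain ⟨h1, h2⟩ := h1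
        have v1 : tF i μ ν = 1 := by
          unfold tF kd
          simp only [Matrix.of_apply, if_neg hn]
          split_ifs <;> first | omega | norm_num
        have v2 : tF i ν.neg μ.neg = 1 := by
          unfold tF kd
          simp only [Matrix.of_apply, if_neg hn]
          split_ifs <;> first | omega | norm_num
        have ex : wt μ i - (if h : (i : ℕ) + 1 < n then wt μ ⟨i + 1, h⟩ else 0) = -1 := by
          simp only [wt]
          split_ifs <;> omega
        have fm : formWeight q μ = (-q) ^ ((i : ℤ) + 1 - 2 * n + 1) := by
          unfold formWeight
          split_ifs <;> first | omega | rfl | (congr 1; omega) | (congr 2; omega)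
        have fn : formWeight q ν = (-q) ^ ((i : ℤ) + 1 - 2 * n) := by
          unfold formWeight
          split_ifs <;> first | omega | rfl | (congr 1; omega) | (congr 2; omega)
        rw [v1, v2, ex, fm, fn]
        simp only [hq1, neg_zero, neg_neg, zpow_zero, zpow_one, zpow_neg_one, inv_one, smul_eq_mul]
        have hz := hqm ((i : ℤ) + 1 - 2 * n)
        have hI := Complex.I_mul_I
        have hI0 := Complex.I_ne_zero
        field_simp
        all_goals try rw [Complex.I_sq]
        all_goals try norm_num
      by_cases h2 : (μ : ℤ) = -(i + 1) ∧ (ν : ℤ) = -(i + 1) - 1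
      · obtain ⟨h2, h3⟩ := h2
        have v1 : tF i μ ν = 1 := by
          unfold tF kd
          simp only [Matrix.of_apply, if_neg hn]
          split_ifs <;> first | omega | norm_num
        have v2 : tF i ν.neg μ.neg = 1 := by
          unfold tF kd
          simp only [Matrix.of_apply, if_neg hn]
          split_ifs <;> first | omega | norm_num
        have ex : wt μ i - (if h : (i : ℕ) + 1 < n then wt μ ⟨i + 1, h⟩ else 0) = -1 := by
          simp only [wt]
          split_ifs <;> omega
        have fm : formWeight q μ = (-q) ^ (-(i : ℤ) - 1 + 1) := by
          unfold formWeight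
          split_ifs <;> first | omega | rfl | (congr 1; omega) | (congr 2; omega)
        have fn : formWeight q ν = (-q) ^ (-(i : ℤ) - 1) := by
          unfold formWeight
          split_ifs <;> first | omega | rfl | (congr 1; omega) | (congr 2; omega)
        rw [v1, v2, ex, fm, fn]
        simp only [hq1, neg_zero, neg_neg, zpow_zero, zpow_one, zpow_neg_one, inv_one, smul_eq_mul]
        have hz := hqm (-(i : ℤ) - 1)
        have hI := Complex.I_mul_I
        have hI0 := Complex.I_ne_zero
        field_simp
        all_goals try rw [Complex.I_sq]
        all_goals try norm_num
      have z1 : tF i μ ν = 0 := by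
        unfold tF kd
        simp only [Matrix.of_apply, if_neg hn]
        split_ifs <;> first | omega | norm_num
      have z2 : tF i ν.neg μ.neg = 0 := by
        unfold tF kd
        simp only [Matrix.of_apply, if_neg hn]
        split_ifs <;> first | omega | norm_num
      simp [z1, z2]

end FunctionAntipode

section FunctionAntipode

variable {n : ℕ} {q : ℂ} [hq : Generic q]

/-- The map `a ⊗ b ↦ A(b) ⊗ A(a)` for the (ungraded) anti-homomorphism `A`. -/
def Uq.antiTwo (q : ℂ) [Generic q] (c : Fin n → ℂ) (hc : ∀ i, c i ≠ 0) :
    Uq.Sq n q →ₗ[ℂ] Uq.Sq n q :=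
  (GradedTensorProduct.of ℂ (Uq.grading n q) (Uq.grading n q)).toLinearMap ∘ₗ
    TensorProduct.map
      ((MulOpposite.opLinearEquiv ℂ).symm.toLinearMap ∘ₗ (Uq.antiHom q c hc).toLinearMap)
      ((MulOpposite.opLinearEquiv ℂ).symm.toLinearMap ∘ₗ (Uq.antiHom q c hc).toLinearMap) ∘ₗ
    (TensorProduct.comm ℂ (Uq n q) (Uq n q)).toLinearMap ∘ₗ
    (GradedTensorProduct.of ℂ (Uq.grading n q) (Uq.grading n q)).symm.toLinearMap

variable (c : Fin n → ℂ) (hc : ∀ i, c i ≠ 0)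

theorem Uq.antiTwo_ten (a b : Uq n q) :
    Uq.antiTwo q c hc (Uq.ten a b) =
      Uq.ten (Uq.antiHom q c hc b).unop (Uq.antiHom q c hc a).unop := rfl

theorem Uq.oddProj_antiHom (x : Uq n q) :
    oddProj (Uq.grading n q) (Uq.antiHom q c hc x).unop =
      (Uq.antiHom q c hc (oddProj (Uq.grading n q) x)).unop := by
  simp only [Uq.oddProj_eq, Uq.parity_antiHom, map_sub, map_smul, MulOpposite.unop_sub,
    MulOpposite.unop_smul]

theorem Uq.antiTwo_mul (s s' : Uq.Sq n q) :
    Uq.antiTwo q c hc (s * s') = Uq.antiTwo q c hc s' * Uq.antiTwo q c hc s := by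
  induction s using Sq_induction with
  | add x y hx hy => rw [add_mul, map_add, hx, hy, map_add, mul_add]
  | ten a b =>
  induction s' using Sq_induction with
  | add x y hx hy => rw [mul_add, map_add, hx, hy, map_add, add_mul]
  | ten a' b' =>
  simp only [Uq.antiTwo_ten, Uq.ten_mul, map_sub, map_smul, map_mul, MulOpposite.unop_mul,
    Uq.oddProj_antiHom]

theorem Uq.comul_antiHom (x : Uq n q) :
    Uq.comul n q (Uq.antiHom q c hc x).unop = Uq.antiTwo q c hc (Uq.comul n q x) := by
  have h := Uq.relHolds n q
  have hk : ∀ i, Uq.k q i ∈ Uq.grading n q 0 := Uq.k_mem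
  have hk' : ∀ i, Uq.kinv q i ∈ Uq.grading n q 0 := Uq.kinv_mem
  have h1 : (1 : Uq n q) ∈ Uq.grading n q 0 := SetLike.GradedOne.one_mem
  induction x using Uq.gen_induction with
  | one =>
    have : Uq.antiTwo q c hc (Uq.ten 1 1) = Uq.ten 1 1 := by
      rw [Uq.antiTwo_ten, map_one, MulOpposite.unop_one]
    rw [map_one, map_one, MulOpposite.unop_one, map_one]
    exact this.symm
  | add x y hx hy => rw [map_add, MulOpposite.unop_add, map_add, map_add, map_add, hx, hy]
  | smul a x hx => rw [map_smul, MulOpposite.unop_smul, map_smul, map_smul, map_smul, hx]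
  | k i x hx =>
    rw [map_mul, MulOpposite.unop_mul, map_mul, map_mul, Uq.antiTwo_mul, hx]
    congr 1
    simp only [Uq.comul, Uq.lift_k, Uq.antiTwo_ten, Uq.antiHom, MulOpposite.unop_op, Uq.lift_kinv]
  | kinv i x hx =>
    rw [map_mul, MulOpposite.unop_mul, map_mul, map_mul, Uq.antiTwo_mul, hx]
    congr 1
    simp only [Uq.comul, Uq.lift_k, Uq.antiTwo_ten, Uq.antiHom, MulOpposite.unop_op, Uq.lift_kinv]
  | e i x hx =>
    rw [map_mul, MulOpposite.unop_mul, map_mul, map_mul, Uq.antiTwo_mul, hx]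
    congr 1
    simp only [Uq.comul, Uq.lift_k, Uq.lift_e, map_add, Uq.antiTwo_ten, Uq.antiHom, map_one,
      MulOpposite.unop_op, MulOpposite.unop_one, Uq.lift_kinv, map_smul, map_mul]
    rw [add_mul, Uq.ten_mul_even_right _ _ _ _ (hk' i), Uq.ten_mul_even_right _ _ _ _ (hk' i),
      h.k_kinv, Uq.ten_smul_left, Uq.ten_smul_right, one_mul, smul_add, add_comm]
  | f i x hx =>
    rw [map_mul, MulOpposite.unop_mul, map_mul, map_mul, Uq.antiTwo_mul, hx]
    congr 1
    simp only [Uq.comul, Uq.lift_k, Uq.lift_f, map_add, Uq.antiTwo_ten, Uq.antiHom, map_one,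
      MulOpposite.unop_op, MulOpposite.unop_one, Uq.lift_kinv, map_smul, map_mul]
    rw [mul_add, Uq.ten_mul_even_left _ _ _ _ (hk i), Uq.ten_mul_even_left _ _ _ _ (hk i),
      h.k_kinv, Uq.ten_smul_left, Uq.ten_smul_right, mul_one, smul_add, add_comm]

/-- The transpose of the (ungraded) anti-homomorphism `A`. -/
def dualAnti (q : ℂ) [Generic q] (c : Fin n → ℂ) (hc : ∀ i, c i ≠ 0)
    (f : Module.Dual ℂ (Uq n q)) : Module.Dual ℂ (Uq n q) :=
  f ∘ₗ (MulOpposite.opLinearEquiv ℂ).symm.toLinearMap ∘ₗ (Uq.antiHom q c hc).toLinearMap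

theorem dualAnti_apply (f : Module.Dual ℂ (Uq n q)) (x : Uq n q) :
    dualAnti q c hc f x = f (Uq.antiHom q c hc x).unop := rfl

theorem dualAnti_conv (f g : Module.Dual ℂ (Uq n q)) :
    dualAnti q c hc (conv f g) = conv (dualAnti q c hc g) (dualAnti q c hc f) := by
  ext x
  change hatTensor f g (Uq.comul n q (Uq.antiHom q c hc x).unop) =
    hatTensor (dualAnti q c hc g) (dualAnti q c hc f) (Uq.comul n q x)
  rw [Uq.comul_antiHom]
  induction Uq.comul n q x using Sq_induction with
  | ten a b =>
    simp only [Uq.antiTwo_ten, hatTensor_ten, dualAnti_apply, Uq.oddProj_antiHom]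
    ring
  | add x y hx hy => rw [map_add, map_add, map_add, hx, hy]

theorem dualAnti_counit :
    dualAnti q c hc (Uq.counit n q).toLinearMap = (Uq.counit n q).toLinearMap := by
  ext x
  rw [dualAnti_apply]
  change Uq.counit n q _ = Uq.counit n q x
  induction x using Uq.gen_induction with
  | one => simp
  | add x y hx hy => rw [map_add, MulOpposite.unop_add, map_add, map_add, hx, hy]
  | smul a x hx => rw [map_smul, MulOpposite.unop_smul, map_smul, map_smul, hx]
  | k i x hx =>
    rw [map_mul, MulOpposite.unop_mul, map_mul, map_mul, hx, mul_comm]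
    congr 1
    simp [Uq.counit, Uq.antiHom, Uq.lift_k, Uq.lift_kinv]
  | kinv i x hx =>
    rw [map_mul, MulOpposite.unop_mul, map_mul, map_mul, hx, mul_comm]
    congr 1
    simp [Uq.counit, Uq.antiHom, Uq.lift_k, Uq.lift_kinv]
  | e i x hx =>
    rw [map_mul, MulOpposite.unop_mul, map_mul, map_mul, hx, mul_comm]
    congr 1
    simp [Uq.counit, Uq.antiHom, Uq.lift_e, Uq.lift_kinv]
  | f i x hx =>
    rw [map_mul, MulOpposite.unop_mul, map_mul, map_mul, hx, mul_comm]
    congr 1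
    simp [Uq.counit, Uq.antiHom, Uq.lift_f, Uq.lift_k]

theorem Tq.anti_mem_of_entry
    (h : ∀ μ ν, dualAnti q c hc (tEntry q μ ν) ∈ Tq n q) {f : Module.Dual ℂ (Uq n q)}
    (hf : f ∈ Tq n q) : dualAnti q c hc f ∈ Tq n q := by
  have hf' : IsFunc n q f := hf
  induction hf' with
  | entry μ ν => exact h μ ν
  | one => rw [dualAnti_counit]; exact Tq.one_mem
  | add h1 h2 i1 i2 => exact add_mem (i1 h1) (i2 h2)
  | smul c h i => exact Submodule.smul_mem _ _ (i h)
  | mul h1 h2 i1 i2 => rw [dualAnti_conv]; exact Tq.conv_mem (i2 h2) (i1 h1)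

theorem Tq.graded_anti_mem (h : ∀ f ∈ Tq n q, dualAnti q c hc f ∈ Tq n q)
    {f : Module.Dual ℂ (Uq n q)} (hf : f ∈ Tq n q) : f ∘ₗ Uq.gradedAnti q c hc ∈ Tq n q := by
  have e : f ∘ₗ Uq.gradedAnti q c hc =
      dualAnti q c hc f - (1 + Complex.I) • dualOdd (dualAnti q c hc f) := by
    ext x
    change f (Uq.antiHom q c hc (Uq.rot n q x)).unop = _
    simp [Uq.rot, dualAnti_apply]
  rw [e]
  exact sub_mem (h f hf) (Submodule.smul_mem _ _ (Tq.odd_mem (h f hf)))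

theorem dualAnti_tEntry (μ ν : Idx n) :
    dualAnti q (fun _ => 1) (fun _ => one_ne_zero) (tEntry q μ ν) =
      (formWeight q ν / formWeight q μ) • tEntry q ν.neg μ.neg := by
  ext x
  exact tEntry_antiHom x μ ν

theorem Tq.antipode_mem {f : Module.Dual ℂ (Uq n q)} (hf : f ∈ Tq n q) :
    f ∘ₗ (Uq.antipode n q).toLinearMap ∈ Tq n q := by
  refine Tq.graded_anti_mem (fun _ => 1) (fun _ => one_ne_zero) (fun f hf => ?_) hf
  refine Tq.anti_mem_of_entry _ _ (fun μ ν => ?_) hf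
  rw [dualAnti_tEntry]
  exact Submodule.smul_mem _ _ (Tq.entry_mem _ _)

theorem Tq.antipode_symm_mem {f : Module.Dual ℂ (Uq n q)} (hf : f ∈ Tq n q) :
    f ∘ₗ (Uq.antipode n q).symm.toLinearMap ∈ Tq n q := by
  refine Tq.graded_anti_mem (fun i => q ^ (-ip i i)) (antipodeInv_aux q) (fun f hf => ?_) hf
  refine Tq.anti_mem_of_entry _ _ (fun μ ν => ?_) hf
  have e : tEntry q μ ν = (formWeight q μ.neg / formWeight q ν.neg)⁻¹ •
      dualAnti q (fun _ => 1) (fun _ => one_ne_zero) (tEntry q ν.neg μ.neg) := by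
    rw [dualAnti_tEntry, smul_smul, inv_mul_cancel₀, one_smul, Idx.neg_neg, Idx.neg_neg]
    exact div_ne_zero (formWeight_ne_zero _) (formWeight_ne_zero _)
  have e2 : dualAnti q (fun i => q ^ (-ip i i)) (antipodeInv_aux q) (tEntry q μ ν) =
      (formWeight q μ.neg / formWeight q ν.neg)⁻¹ • dualParity (tEntry q ν.neg μ.neg) := by
    rw [e]
    ext x
    have := Uq.antiHom_antiHom (fun _ => (1 : ℂ)) (fun i : Fin n => q ^ (-ip i i))
      (fun _ => one_ne_zero) (antipodeInv_aux q) (fun _ => one_mul _) (Uq.parity n q x)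
    rw [Uq.parity_parity] at this
    simp only [dualAnti_apply, LinearMap.smul_apply, this, LinearMap.comp_apply,
      AlgHom.toLinearMap_apply]
  rw [e2]
  exact Submodule.smul_mem _ _ (Tq.parity_mem (Tq.entry_mem _ _))

/-- The antipode of `T_q`: `⟨S f, x⟩ = ⟨f, S x⟩`; it is bijective. -/
def Tq.antipode (n : ℕ) (q : ℂ) [Generic q] : Tq n q ≃ₗ[ℂ] Tq n q :=
  LinearEquiv.ofLinearMap
    (LinearMap.restrict ((Uq.antipode n q).toLinearMap.lcomp ℂ ℂ) (fun _ => Tq.antipode_mem))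
    (LinearMap.restrict ((Uq.antipode n q).symm.toLinearMap.lcomp ℂ ℂ)
      (fun _ => Tq.antipode_symm_mem))
    (LinearMap.ext fun f => Subtype.ext (LinearMap.ext fun x =>
      congrArg f.1 ((Uq.antipode n q).symm_apply_apply x)))
    (LinearMap.ext fun f => Subtype.ext (LinearMap.ext fun x =>
      congrArg f.1 ((Uq.antipode n q).apply_symm_apply x)))

end FunctionAntipode

/-! ### Translations, sections and the co-action -/

section Sections

variable {n : ℕ} {q : ℂ} [hq : Generic q]

/-- The evaluation `f ↦ ⟨f, x⟩`. -/
def Tq.eval (x : Uq n q) : Tq n q →ₗ[ℂ] ℂ := LinearMap.applyₗ x ∘ₗ (Tq n q).subtype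

/-- Right translation: `x ∘ f = ∑ (-1)^{[f₁][f₂]} f₁ ⟨f₂, x⟩`, where `Δ(f) = ∑ f₁ ⊗ f₂`. -/
def Tq.circ (x : Uq n q) : Tq n q →ₗ[ℂ] Tq n q :=
  (TensorProduct.rid ℂ (Tq n q)).toLinearMap ∘ₗ LinearMap.lTensor (Tq n q) (Tq.eval x) ∘ₗ
    koszul (Tq.grading n q) (Tq.grading n q) ∘ₗ Tq.comul n q

/-- Left translation: `x · f = ∑ ⟨f₁, S⁻¹(x)⟩ f₂`, where `Δ(f) = ∑ f₁ ⊗ f₂`. -/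
def Tq.dot (x : Uq n q) : Tq n q →ₗ[ℂ] Tq n q :=
  (TensorProduct.lid ℂ (Tq n q)).toLinearMap ∘ₗ
    LinearMap.rTensor (Tq n q) (Tq.eval ((Uq.antipode n q).symm x)) ∘ₗ Tq.comul n q

/-- The graded flip `a ⊗ b ↦ (-1)^{[a][b]} b ⊗ a`. -/
def Tq.flip (n : ℕ) (q : ℂ) [Generic q] : Tq n q ⊗[ℂ] Tq n q →ₗ[ℂ] Tq n q ⊗[ℂ] Tq n q :=
  (TensorProduct.comm ℂ (Tq n q) (Tq n q)).toLinearMap ∘ₗ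
    koszul (Tq.grading n q) (Tq.grading n q)

variable {V : Type*} [AddCommGroup V] [Module ℂ V] (𝒱 : ZMod 2 → Submodule ℂ V)
  [DirectSum.Decomposition 𝒱]

/-- The operator `v ⊗ f ↦ (-1)^{[x][v]} v ⊗ A(x) f` on `V ⊗ T_q`. -/
def signedExtend (A : Uq n q → (Tq n q →ₗ[ℂ] Tq n q)) (x : Uq n q) :
    V ⊗[ℂ] Tq n q →ₗ[ℂ] V ⊗[ℂ] Tq n q :=
  TensorProduct.map LinearMap.id (A x) -
    (2 : ℂ) • TensorProduct.map (oddProj 𝒱) (A (oddProj (Uq.grading n q) x))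

/-- Right translation on `V ⊗ T_q`: `x ∘ (v ⊗ f) = (-1)^{[x][v]} v ⊗ x ∘ f`. -/
def circV (x : Uq n q) : V ⊗[ℂ] Tq n q →ₗ[ℂ] V ⊗[ℂ] Tq n q := signedExtend 𝒱 Tq.circ x

/-- Left translation on `V ⊗ T_q`: `x · (v ⊗ f) = (-1)^{[x][v]} v ⊗ x · f`. -/
def dotV (x : Uq n q) : V ⊗[ℂ] Tq n q →ₗ[ℂ] V ⊗[ℂ] Tq n q := signedExtend 𝒱 Tq.dot x

/-- The map `ω = id_V ⊗ (id ⊗ S⁻¹) P Δ` on `V ⊗ T_q`, where `P` is the graded flip: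
`v ⊗ f ↦ ∑ (-1)^{[f₁][f₂]} (v ⊗ f₂) ⊗ S⁻¹(f₁)`. -/
def coactV (V : Type*) [AddCommGroup V] [Module ℂ V] (n : ℕ) (q : ℂ) [Generic q] :
    V ⊗[ℂ] Tq n q →ₗ[ℂ] (V ⊗[ℂ] Tq n q) ⊗[ℂ] Tq n q :=
  (TensorProduct.assoc ℂ V (Tq n q) (Tq n q)).symm.toLinearMap ∘ₗ
    LinearMap.lTensor V
      (LinearMap.lTensor (Tq n q) (Tq.antipode n q).symm.toLinearMap ∘ₗ Tq.flip n q ∘ₗ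
        Tq.comul n q)

/-- The parity `v ⊗ f ↦ (-1)^{[v] + [f]} v ⊗ f` of `V ⊗ T_q`. -/
def tensorParity : V ⊗[ℂ] Tq n q →ₗ[ℂ] V ⊗[ℂ] Tq n q :=
  TensorProduct.map (LinearMap.id - (2 : ℂ) • oddProj 𝒱) (Tq.parity n q)

/-- The `ℤ/2`-grading of `V ⊗ T_q`: `[v ⊗ f] = [v] + [f]`. -/
def tensorGrading (i : ZMod 2) : Submodule ℂ (V ⊗[ℂ] Tq n q) := parityGrading (tensorParity 𝒱) i

/-- The sections
`H_q(V) = {ζ ∈ V ⊗ T_q | x ∘ ζ = (S(x) ⊗ id) ζ for all x in U_q(𝔨)}`. -/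
def qSections (q : ℂ) [Generic q] {V : Type*} [AddCommGroup V] [Module ℂ V]
    (𝒱 : ZMod 2 → Submodule ℂ V) [DirectSum.Decomposition 𝒱] (Θ : Set (Fin n))
    [Module (Uq.levi q Θ) V]
    [IsScalarTower ℂ (Uq.levi q Θ) V] : Submodule ℂ (V ⊗[ℂ] Tq n q) :=
  ⨅ x : Uq.levi q Θ, LinearMap.eqLocus (circV 𝒱 (x : Uq n q))
    (LinearMap.rTensor (Tq n q)
      (Algebra.lsmul ℂ ℂ V (⟨Uq.antipode n q x, Uq.antipode_mem_levi x.2⟩ : Uq.levi q Θ)))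

theorem mem_qSections (Θ : Set (Fin n)) [Module (Uq.levi q Θ) V]
    [IsScalarTower ℂ (Uq.levi q Θ) V] (ζ : V ⊗[ℂ] Tq n q) :
    ζ ∈ qSections q 𝒱 Θ ↔ ∀ x : Uq.levi q Θ, circV 𝒱 (x : Uq n q) ζ =
      LinearMap.rTensor (Tq n q) (Algebra.lsmul ℂ ℂ V
        (⟨Uq.antipode n q x, Uq.antipode_mem_levi x.2⟩ : Uq.levi q Θ)) ζ := by
  simp [qSections, LinearMap.mem_eqLocus]

/-- A right `T_q`-comodule structure: `(ω ⊗ id) ω = (id ⊗ Δ) ω` and `(id ⊗ ε) ω = id`. -/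
structure IsRightComodule {M : Type*} [AddCommGroup M] [Module ℂ M]
    (ω : M →ₗ[ℂ] M ⊗[ℂ] Tq n q) : Prop where
  coassoc : (TensorProduct.assoc ℂ M (Tq n q) (Tq n q)).toLinearMap ∘ₗ
    LinearMap.rTensor (Tq n q) ω ∘ₗ ω = LinearMap.lTensor M (Tq.comul n q) ∘ₗ ω
  counit : (TensorProduct.rid ℂ M).toLinearMap ∘ₗ LinearMap.lTensor M (Tq.counit n q) ∘ₗ ω =
    LinearMap.id

end Sections

end QOsp

end

/-!
All signs become transparent once functions are evaluated on elements of `U_q`. The sign in the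
definition of `x ∘ f` cancels the one in the co-multiplication of `T_q`, so that
`⟨x ∘ f, a⟩ = ⟨f, a x⟩` (`Tq.circ_apply`), while
`⟨x · f, a⟩ = (-1)^{[x][a]} ⟨f, S⁻¹(x) a⟩` for homogeneous `x` and `a` (`Tq.dot_apply`). As `S⁻¹` is
a graded anti-homomorphism, the second formula gives a left action, and associativity in `U_q`
shows that the two translations commute in the graded sense (`Tq.circ_dot`).

On `V ⊗ T_q` a homogeneous `x` acts as `σ^{[x]} ⊗ x ∘` and `σ^{[x]} ⊗ x ·`, where `σ` is the parity
of `V` (`circV_of_mem`, `dotV_of_mem`). The parity and the left translations therefore commute with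
the right translations up to a sign, and with `S(y) ⊗ id` up to the same sign, because `S(y)` is
homogeneous on `V`. Since the equations that define the sections need only be checked for
homogeneous elements of `U_q(𝔨)`, sections are mapped to sections (`mem_qSections_of_comm`).

The contraction of `(id ⊗ S⁻¹) P Δ(f)` with `a` in the first factor is the functional
`c ↦ ⟨f, S⁻¹(c) a⟩` (`Tq.contract_coact_apply`). Contractions separate points (`Tq.contract_ext`),
so co-associativity, co-unit, compatibility with the parity and the equation
`ω (y ∘ ζ) = (y ∘ ⊗ id) ω(ζ)` are identities in `U_q`. By the last one, `ω(ζ)` is annihilated by all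
`(y ∘ - S(y) ⊗ id) ⊗ id` when `ζ` is a section. The common kernel of these operators is
`H_q(V) ⊗ T_q`, because tensoring over a field commutes with arbitrary intersections of equalizers
(`mem_range_rTensor_iInf_eqLocus`).
-/

noncomputable section

namespace QOsp

/-! ### Homogeneous elements of `U_q(osp(1|2n))` -/

section Homogeneous

variable {n : ℕ} {q : ℂ}

theorem Uq.oddProj_mem (x : Uq n q) : oddProj (Uq.grading n q) x ∈ Uq.grading n q 1 := by
  rw [Uq.mem_odd, Uq.oddProj_eq, map_smul, map_sub, Uq.parity_parity]
  module

theorem Uq.sub_oddProj_mem (x : Uq n q) : x - oddProj (Uq.grading n q) x ∈ Uq.grading n q 0 := by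
  rw [Uq.mem_even, Uq.oddProj_eq, map_sub, map_smul, map_sub, Uq.parity_parity]
  module

theorem Uq.parity_of_mem {i : ZMod 2} {x : Uq n q} (hx : x ∈ Uq.grading n q i) :
    Uq.parity n q x = (if i = 0 then (1 : ℂ) else -1) • x := by
  rw [Uq.grading, mem_parityGrading] at hx
  exact hx

variable [hq : Generic q]

theorem Uq.antipode_symm_mem {i : ZMod 2} {x : Uq n q} (hx : x ∈ Uq.grading n q i) :
    (Uq.antipode n q).symm x ∈ Uq.grading n q i :=
  Uq.gradedAnti_mem _ _ hx

theorem Uq.parity_antipode_symm (x : Uq n q) :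
    Uq.parity n q ((Uq.antipode n q).symm x) = (Uq.antipode n q).symm (Uq.parity n q x) :=
  Uq.parity_gradedAnti _ _ x

theorem Uq.antipode_symm_mul {i j : ZMod 2} {x y : Uq n q} (hx : x ∈ Uq.grading n q i)
    (hy : y ∈ Uq.grading n q j) :
    (Uq.antipode n q).symm (x * y) = (if i = 1 ∧ j = 1 then (-1 : ℂ) else 1) •
      ((Uq.antipode n q).symm y * (Uq.antipode n q).symm x) :=
  Uq.gradedAnti_mul _ _ hx hy

theorem Uq.antipode_symm_one : (Uq.antipode n q).symm 1 = 1 := Uq.gradedAnti_one _ _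

theorem Uq.antipode_mem {i : ZMod 2} {x : Uq n q} (hx : x ∈ Uq.grading n q i) :
    Uq.antipode n q x ∈ Uq.grading n q i :=
  Uq.gradedAnti_mem _ _ hx

end Homogeneous

/-! ### Contraction of functions with elements of `U_q(osp(1|2n))` -/

section Contraction

variable {n : ℕ} {q : ℂ} [hq : Generic q]

theorem Tq.ext_eval {f g : Tq n q} (h : ∀ a, f.1 a = g.1 a) : f = g :=
  Subtype.ext (LinearMap.ext h)

/-- The contraction `f ⊗ m ↦ ⟨f, a⟩ m`. -/
def Tq.contract (N : Type*) [AddCommGroup N] [Module ℂ N] (a : Uq n q) :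
    Tq n q ⊗[ℂ] N →ₗ[ℂ] N :=
  (TensorProduct.lid ℂ N).toLinearMap ∘ₗ LinearMap.rTensor N (Tq.eval a)

variable {N N' : Type*} [AddCommGroup N] [Module ℂ N] [AddCommGroup N'] [Module ℂ N']

theorem Tq.contract_tmul (a : Uq n q) (f : Tq n q) (m : N) :
    Tq.contract N a (f ⊗ₜ m) = f.1 a • m := rfl

/-- The contractions separate the points of `T_q ⊗ N`, because the evaluations separate the
points of `T_q`. -/
theorem Tq.contract_ext {z w : Tq n q ⊗[ℂ] N} (h : ∀ a, Tq.contract N a z = Tq.contract N a w) :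
    z = w := by
  rw [← sub_eq_zero]
  have h0 : ∀ a, Tq.contract N a (z - w) = 0 := fun a => by rw [map_sub, h, sub_self]
  generalize z - w = u at h0
  set b := Module.Basis.ofVectorSpace ℂ N
  obtain ⟨c, rfl⟩ := TensorProduct.eq_repr_basis_right b u
  suffices hc : c = 0 by rw [hc, Finsupp.sum_zero_index]
  ext1 k
  refine Tq.ext_eval fun a => ?_
  have h1 := h0 a
  simp only [Finsupp.sum, map_sum, Tq.contract_tmul] at h1
  have h2 := linearIndependent_iff'.1 b.linearIndependent c.support (fun k => (c k).1 a) h1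
  by_cases hk : k ∈ c.support
  · exact h2 k hk
  · rw [Finsupp.notMem_support_iff.1 hk]; rfl

theorem Tq.contract_lTensor (a : Uq n q) (φ : N →ₗ[ℂ] N') (z : Tq n q ⊗[ℂ] N) :
    Tq.contract N' a (LinearMap.lTensor (Tq n q) φ z) = φ (Tq.contract N a z) := by
  induction z with
  | zero => simp only [map_zero]
  | add x y hx hy => simp only [map_add, hx, hy]
  | tmul f m => rw [LinearMap.lTensor_tmul, Tq.contract_tmul, Tq.contract_tmul, map_smul]

theorem Tq.contract_rTensor {a b : Uq n q} {ψ : Tq n q →ₗ[ℂ] Tq n q}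
    (h : ∀ f, (ψ f).1 a = f.1 b) (z : Tq n q ⊗[ℂ] N) :
    Tq.contract N a (LinearMap.rTensor N ψ z) = Tq.contract N b z := by
  induction z with
  | zero => simp only [map_zero]
  | add x y hx hy => simp only [map_add, hx, hy]
  | tmul f m => rw [LinearMap.rTensor_tmul, Tq.contract_tmul, Tq.contract_tmul, h]

theorem Tq.contract_assoc (a : Uq n q) (z : (Tq n q ⊗[ℂ] N) ⊗[ℂ] N') :
    Tq.contract (N ⊗[ℂ] N') a (TensorProduct.assoc ℂ (Tq n q) N N' z) =
      LinearMap.rTensor N' (Tq.contract N a) z := by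
  induction z with
  | zero => simp only [map_zero]
  | add x y hx hy => simp only [map_add, hx, hy]
  | tmul u m =>
    induction u with
    | zero => simp only [TensorProduct.zero_tmul, map_zero]
    | add x y hx hy => simp only [TensorProduct.add_tmul, map_add, hx, hy]
    | tmul f m' =>
      rw [TensorProduct.assoc_tmul, LinearMap.rTensor_tmul, Tq.contract_tmul, Tq.contract_tmul,
        TensorProduct.smul_tmul']

theorem Tq.contract_comm (a : Uq n q) (z : N ⊗[ℂ] Tq n q) :
    Tq.contract N a (TensorProduct.comm ℂ N (Tq n q) z) =
      TensorProduct.rid ℂ N (LinearMap.lTensor N (Tq.eval a) z) := by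
  induction z with
  | zero => simp only [map_zero]
  | add x y hx hy => simp only [map_add, hx, hy]
  | tmul m f => rfl

theorem Tq.contract_apply (a b : Uq n q) (z : Tq n q ⊗[ℂ] Tq n q) :
    (Tq.contract (Tq n q) a z).1 b = Tq.pairing n q z (a ⊗ₜ b) := by
  induction z with
  | zero => simp only [map_zero]; rfl
  | add x y hx hy =>
    rw [map_add, map_add, LinearMap.add_apply, ← hx, ← hy]; rfl
  | tmul f g => rfl

theorem Tq.rid_lTensor_eval_apply (a b : Uq n q) (z : Tq n q ⊗[ℂ] Tq n q) :
    (TensorProduct.rid ℂ (Tq n q) (LinearMap.lTensor (Tq n q) (Tq.eval b) z)).1 a =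
      Tq.pairing n q z (a ⊗ₜ b) := by
  induction z with
  | zero => simp only [map_zero]; rfl
  | add x y hx hy =>
    rw [map_add, map_add, map_add, LinearMap.add_apply, ← hx, ← hy]; rfl
  | tmul f g =>
    rw [Tq.pairing_tmul, mul_comm]; rfl

theorem Tq.rid_lTensor_apply (a : Uq n q) (φ : Tq n q →ₗ[ℂ] ℂ) (z : Tq n q ⊗[ℂ] Tq n q) :
    (TensorProduct.rid ℂ (Tq n q) (LinearMap.lTensor (Tq n q) φ z)).1 a =
      φ (Tq.contract (Tq n q) a z) := by
  induction z with
  | zero => simp only [map_zero]; rfl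
  | add x y hx hy =>
    rw [map_add, map_add, map_add, map_add, ← hx, ← hy]; rfl
  | tmul f g =>
    rw [Tq.contract_tmul, map_smul, smul_eq_mul, mul_comm]; rfl

end Contraction

/-! ### Translations of functions -/

section Translations

variable {n : ℕ} {q : ℂ} [hq : Generic q]

theorem Tq.oddProj_coe (f : Tq n q) (x : Uq n q) :
    (oddProj (Tq.grading n q) f).1 x = f.1 (oddProj (Uq.grading n q) x) := by
  have h : oddProj (Tq.grading n q) f = (1 / 2 : ℂ) • (f - Tq.parity n q f) :=
    @oddProj_parity _ _ _ (Tq.parity n q) Tq.parity_parity (Tq.decomposition n q) f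
  rw [h, Uq.oddProj_eq, map_smul, map_sub]
  rfl

theorem Tq.pairing_koszul (z : Tq n q ⊗[ℂ] Tq n q) (a b : Uq n q) :
    Tq.pairing n q (koszul (Tq.grading n q) (Tq.grading n q) z) (a ⊗ₜ b) =
      Tq.pairing n q z (a ⊗ₜ b) - 2 * Tq.pairing n q z
        (oddProj (Uq.grading n q) a ⊗ₜ oddProj (Uq.grading n q) b) := by
  induction z with
  | zero => simp only [map_zero, LinearMap.zero_apply, mul_zero, sub_zero]
  | add x y hx hy => simp only [map_add, LinearMap.add_apply, hx, hy]; ring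
  | tmul f g =>
    rw [koszul_tmul, map_sub, map_smul, LinearMap.sub_apply, LinearMap.smul_apply]
    simp only [Tq.pairing_tmul, Tq.oddProj_coe, smul_eq_mul]

theorem Tq.pairing_comul (f : Tq n q) (a b : Uq n q) :
    Tq.pairing n q (Tq.comul n q f) (a ⊗ₜ b) =
      f.1 (a * b) - 2 * f.1 (oddProj (Uq.grading n q) a * oddProj (Uq.grading n q) b) := by
  rw [Tq.comul, LinearMap.comp_apply, Tq.pairing_koszul, Tq.pairing_split, Tq.pairing_split]

/-- Right translation is `⟨x ∘ f, a⟩ = ⟨f, a x⟩`: its sign cancels the one in the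
co-multiplication. -/
theorem Tq.circ_apply (x : Uq n q) (f : Tq n q) (a : Uq n q) : (Tq.circ x f).1 a = f.1 (a * x) := by
  refine (Tq.rid_lTensor_eval_apply a x _).trans ?_
  rw [LinearMap.comp_apply, Tq.pairing_koszul, Tq.pairing_comul, Tq.pairing_comul,
    Uq.oddProj_idem, Uq.oddProj_idem]
  ring

theorem Tq.contract_comul_apply (x : Uq n q) (f : Tq n q) (a : Uq n q) :
    (Tq.contract (Tq n q) x (Tq.comul n q f)).1 a =
      f.1 (x * a) - 2 * f.1 (oddProj (Uq.grading n q) x * oddProj (Uq.grading n q) a) := by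
  rw [Tq.contract_apply, Tq.pairing_comul]

theorem Tq.dot_eq (x : Uq n q) (f : Tq n q) :
    Tq.dot x f = Tq.contract (Tq n q) ((Uq.antipode n q).symm x) (Tq.comul n q f) := rfl

/-- Left translation by a homogeneous element is `⟨x · f, a⟩ = (-1)^{[x][a]} ⟨f, S⁻¹(x) a⟩`. -/
theorem Tq.dot_apply {i j : ZMod 2} {x a : Uq n q} (hx : x ∈ Uq.grading n q i)
    (ha : a ∈ Uq.grading n q j) (f : Tq n q) :
    (Tq.dot x f).1 a =
      (if i = 1 ∧ j = 1 then (-1 : ℂ) else 1) * f.1 ((Uq.antipode n q).symm x * a) := by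
  rw [Tq.dot_eq, Tq.contract_comul_apply]
  have hx' := Uq.antipode_symm_mem hx
  rcases zmod_two i with rfl | rfl
  · rw [oddProj_even _ hx']; simp
  · rcases zmod_two j with rfl | rfl
    · rw [oddProj_even _ ha]; simp
    · rw [oddProj_odd _ ha, oddProj_odd _ hx', if_pos ⟨rfl, rfl⟩]; ring

/-- Functions that agree on homogeneous elements are equal. -/
theorem Tq.ext_homogeneous {f g : Tq n q}
    (h : ∀ (j : ZMod 2), ∀ a ∈ Uq.grading n q j, f.1 a = g.1 a) : f = g := by
  refine Tq.ext_eval fun a => ?_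
  rw [← sub_add_cancel a (oddProj (Uq.grading n q) a), map_add, map_add,
    h 0 _ (Uq.sub_oddProj_mem a), h 1 _ (Uq.oddProj_mem a)]

theorem Tq.circ_add (x y : Uq n q) : Tq.circ (x + y) = Tq.circ x + Tq.circ y :=
  LinearMap.ext fun f => Tq.ext_eval fun a => by
    rw [LinearMap.add_apply, Tq.circ_apply, mul_add, map_add, ← Tq.circ_apply, ← Tq.circ_apply]
    rfl

theorem Tq.dot_add (x y : Uq n q) : Tq.dot (x + y) = Tq.dot x + Tq.dot y :=
  LinearMap.ext fun f => Tq.ext_eval fun a => by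
    have e (u v : Tq n q) : (u + v).1 a = u.1 a + v.1 a := rfl
    rw [LinearMap.add_apply, e]
    simp only [Tq.dot_eq, Tq.contract_comul_apply, map_add, add_mul]
    ring

theorem Tq.dot_smul (c : ℂ) (x : Uq n q) : Tq.dot (c • x) = c • Tq.dot x :=
  LinearMap.ext fun f => Tq.ext_eval fun a => by
    have e (u : Tq n q) : (c • u).1 a = c * u.1 a := rfl
    rw [LinearMap.smul_apply, e]
    simp only [Tq.dot_eq, Tq.contract_comul_apply, map_smul, smul_mul_assoc, smul_eq_mul]
    ring

theorem Tq.dot_one : Tq.dot (1 : Uq n q) = LinearMap.id :=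
  LinearMap.ext fun f => Tq.ext_homogeneous fun j a ha => by
    rw [Tq.dot_apply (SetLike.GradedOne.one_mem (A := Uq.grading n q)) ha, Uq.antipode_symm_one,
      one_mul]
    simp

theorem Tq.dot_dot {i j : ZMod 2} {x y : Uq n q} (hx : x ∈ Uq.grading n q i)
    (hy : y ∈ Uq.grading n q j) : Tq.dot x ∘ₗ Tq.dot y = Tq.dot (x * y) :=
  LinearMap.ext fun f => Tq.ext_homogeneous fun l a ha => by
    rw [LinearMap.comp_apply, Tq.dot_apply hx ha,
      Tq.dot_apply hy (SetLike.mul_mem_graded (Uq.antipode_symm_mem hx) ha),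
      Tq.dot_apply (SetLike.mul_mem_graded hx hy) ha, Uq.antipode_symm_mul hx hy, smul_mul_assoc,
      map_smul, smul_eq_mul]
    rcases zmod_two i with rfl | rfl <;> rcases zmod_two j with rfl | rfl <;>
      rcases zmod_two l with rfl | rfl <;> simp [show (1 : ZMod 2) + 1 = 0 from rfl, mul_assoc]

/-- The two translations commute in the graded sense. -/
theorem Tq.circ_dot {i j : ZMod 2} {x y : Uq n q} (hx : x ∈ Uq.grading n q i)
    (hy : y ∈ Uq.grading n q j) :
    Tq.circ y ∘ₗ Tq.dot x =
      (if i = 1 ∧ j = 1 then (-1 : ℂ) else 1) • (Tq.dot x ∘ₗ Tq.circ y) :=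
  LinearMap.ext fun f => Tq.ext_homogeneous fun l a ha => by
    have e (c : ℂ) (u : Tq n q) : (c • u).1 a = c * u.1 a := rfl
    rw [LinearMap.smul_apply, e, LinearMap.comp_apply, LinearMap.comp_apply, Tq.circ_apply,
      Tq.dot_apply hx (SetLike.mul_mem_graded ha hy), Tq.dot_apply hx ha, Tq.circ_apply]
    rcases zmod_two i with rfl | rfl <;> rcases zmod_two j with rfl | rfl <;>
      rcases zmod_two l with rfl | rfl <;> simp [show (1 : ZMod 2) + 1 = 0 from rfl, mul_assoc]

theorem Tq.parity_circ {j : ZMod 2} {y : Uq n q} (hy : y ∈ Uq.grading n q j) :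
    Tq.parity n q ∘ₗ Tq.circ y =
      (if j = 0 then (1 : ℂ) else -1) • (Tq.circ y ∘ₗ Tq.parity n q) :=
  LinearMap.ext fun f => Tq.ext_eval fun a => by
    have e (c : ℂ) (u : Tq n q) : (c • u).1 a = c * u.1 a := rfl
    have e' (u : Tq n q) (b : Uq n q) : (Tq.parity n q u).1 b = u.1 (Uq.parity n q b) := rfl
    rw [LinearMap.smul_apply, e, LinearMap.comp_apply, LinearMap.comp_apply, Tq.circ_apply, e',
      e', Tq.circ_apply, map_mul (Uq.parity n q), Uq.parity_of_mem hy, mul_smul_comm, map_smul,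
      smul_eq_mul]
    rcases zmod_two j with rfl | rfl <;> simp

theorem Tq.parity_dot {i : ZMod 2} {x : Uq n q} (hx : x ∈ Uq.grading n q i) :
    Tq.parity n q ∘ₗ Tq.dot x =
      (if i = 0 then (1 : ℂ) else -1) • (Tq.dot x ∘ₗ Tq.parity n q) :=
  LinearMap.ext fun f => Tq.ext_homogeneous fun l a ha => by
    have e (c : ℂ) (u : Tq n q) : (c • u).1 a = c * u.1 a := rfl
    have e' (u : Tq n q) (b : Uq n q) : (Tq.parity n q u).1 b = u.1 (Uq.parity n q b) := rfl
    rw [LinearMap.smul_apply, e, LinearMap.comp_apply, LinearMap.comp_apply, Tq.dot_apply hx ha,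
      e', e', Uq.parity_of_mem ha, map_smul, Tq.dot_apply hx ha, map_mul (Uq.parity n q), Uq.parity_of_mem ha,
      Uq.parity_of_mem (Uq.antipode_symm_mem hx), smul_mul_smul_comm, map_smul]
    simp only [smul_eq_mul]
    rcases zmod_two i with rfl | rfl <;> rcases zmod_two l with rfl | rfl <;> simp

end Translations

/-! ### The co-action of `T_q` on itself -/

section Coaction

variable {n : ℕ} {q : ℂ} [hq : Generic q]

/-- The map `(id ⊗ S⁻¹) P Δ : f ↦ ∑ (-1)^{[f₁][f₂]} f₂ ⊗ S⁻¹(f₁)`. -/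
def Tq.coact (n : ℕ) (q : ℂ) [Generic q] : Tq n q →ₗ[ℂ] Tq n q ⊗[ℂ] Tq n q :=
  LinearMap.lTensor (Tq n q) (Tq.antipode n q).symm.toLinearMap ∘ₗ Tq.flip n q ∘ₗ Tq.comul n q

theorem Tq.antipode_symm_coe (f : Tq n q) (a : Uq n q) :
    ((Tq.antipode n q).symm f).1 a = f.1 ((Uq.antipode n q).symm a) := rfl

theorem Tq.contract_coact (a : Uq n q) (f : Tq n q) :
    Tq.contract (Tq n q) a (Tq.coact n q f) = (Tq.antipode n q).symm (Tq.circ a f) := by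
  refine (Tq.contract_lTensor a (Tq.antipode n q).symm.toLinearMap _).trans ?_
  exact congrArg (Tq.antipode n q).symm (Tq.contract_comm a _)

theorem Tq.contract_coact_apply (a b : Uq n q) (f : Tq n q) :
    (Tq.contract (Tq n q) a (Tq.coact n q f)).1 b = f.1 ((Uq.antipode n q).symm b * a) := by
  rw [Tq.contract_coact, Tq.antipode_symm_coe, Tq.circ_apply]

theorem Tq.coact_circ (y : Uq n q) (f : Tq n q) :
    Tq.coact n q (Tq.circ y f) = LinearMap.rTensor (Tq n q) (Tq.circ y) (Tq.coact n q f) := by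
  refine Tq.contract_ext fun a => ?_
  rw [Tq.contract_rTensor (fun g => Tq.circ_apply y g a)]
  refine Tq.ext_eval fun b => ?_
  rw [Tq.contract_coact_apply, Tq.contract_coact_apply, Tq.circ_apply, mul_assoc]

theorem Tq.coact_parity (f : Tq n q) :
    Tq.coact n q (Tq.parity n q f) =
      TensorProduct.map (Tq.parity n q) (Tq.parity n q) (Tq.coact n q f) := by
  have e (u : Tq n q) (b : Uq n q) : (Tq.parity n q u).1 b = u.1 (Uq.parity n q b) := rfl
  have h (z : Tq n q ⊗[ℂ] Tq n q) : TensorProduct.map (Tq.parity n q) (Tq.parity n q) z =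
      LinearMap.lTensor (Tq n q) (Tq.parity n q) (LinearMap.rTensor (Tq n q) (Tq.parity n q) z) :=
    LinearMap.congr_fun (f := TensorProduct.map (Tq.parity n q) (Tq.parity n q))
      (g := LinearMap.lTensor (Tq n q) (Tq.parity n q) ∘ₗ
        LinearMap.rTensor (Tq n q) (Tq.parity n q)) (TensorProduct.ext' fun _ _ => rfl) z
  refine Tq.contract_ext fun a => ?_
  rw [h, Tq.contract_lTensor,
    Tq.contract_rTensor (fun g => e g a)]
  refine Tq.ext_eval fun b => ?_
  rw [Tq.contract_coact_apply, e, e, Tq.contract_coact_apply, map_mul, Uq.parity_antipode_symm]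

theorem Tq.coact_counit (f : Tq n q) :
    TensorProduct.rid ℂ (Tq n q) (LinearMap.lTensor (Tq n q) (Tq.counit n q) (Tq.coact n q f)) =
      f := by
  refine Tq.ext_eval fun a => ?_
  rw [Tq.rid_lTensor_apply]
  change (Tq.contract (Tq n q) a (Tq.coact n q f)).1 1 = _
  rw [Tq.contract_coact_apply, Uq.antipode_symm_one, one_mul]

/-- Co-associativity: evaluated on `a ⊗ b ⊗ c`, both sides are `⟨f, S⁻¹(c) S⁻¹(b) a⟩`, because
`S⁻¹(b c) = (-1)^{[b][c]} S⁻¹(c) S⁻¹(b)`. -/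
theorem Tq.coact_coassoc (f : Tq n q) :
    TensorProduct.assoc ℂ (Tq n q) (Tq n q) (Tq n q)
        (LinearMap.rTensor (Tq n q) (Tq.coact n q) (Tq.coact n q f)) =
      LinearMap.lTensor (Tq n q) (Tq.comul n q) (Tq.coact n q f) := by
  refine Tq.contract_ext (N := Tq n q ⊗[ℂ] Tq n q) fun a => ?_
  have h : Tq.contract (Tq n q) a ∘ₗ Tq.coact n q =
      (Tq.antipode n q).symm.toLinearMap ∘ₗ Tq.circ a := LinearMap.ext (Tq.contract_coact a)
  rw [Tq.contract_assoc, Tq.contract_lTensor, ← LinearMap.rTensor_comp_apply, h]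
  refine Tq.contract_ext fun b => ?_
  rw [Tq.contract_rTensor (ψ := (Tq.antipode n q).symm.toLinearMap ∘ₗ Tq.circ a)
    (fun g => Tq.circ_apply a g ((Uq.antipode n q).symm b))]
  refine Tq.ext_eval fun c => ?_
  rw [Tq.contract_coact_apply, Tq.contract_comul_apply, Tq.contract_coact_apply,
    Tq.contract_coact_apply]
  -- The graded product rule for `S⁻¹`, written with odd parts for arbitrary `b` and `c`.
  have key : (Uq.antipode n q).symm c * (Uq.antipode n q).symm b =
      (Uq.antipode n q).symm (b * c) - (2 : ℂ) • (Uq.antipode n q).symm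
        (oddProj (Uq.grading n q) b * oddProj (Uq.grading n q) c) := by
    have hb0 := Uq.sub_oddProj_mem b
    have hb1 := Uq.oddProj_mem b
    have hc0 := Uq.sub_oddProj_mem c
    have hc1 := Uq.oddProj_mem c
    have h00 := Uq.antipode_symm_mul hb0 hc0
    have h01 := Uq.antipode_symm_mul hb0 hc1
    have h10 := Uq.antipode_symm_mul hb1 hc0
    have h11 := Uq.antipode_symm_mul hb1 hc1
    generalize oddProj (Uq.grading n q) b = b1 at *
    generalize oddProj (Uq.grading n q) c = c1 at *
    obtain ⟨b0, rfl⟩ : ∃ b0, b = b0 + b1 := ⟨b - b1, (sub_add_cancel b b1).symm⟩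
    obtain ⟨c0, rfl⟩ : ∃ c0, c = c0 + c1 := ⟨c - c1, (sub_add_cancel c c1).symm⟩
    simp only [add_sub_cancel_right] at h00 h01 h10
    simp only [mul_add, add_mul, map_add, h00, h01, h10, h11]
    simp only [zero_ne_one, false_and, and_false, and_self, if_true, if_false]
    module
  rw [← mul_assoc, key, sub_mul, smul_mul_assoc, map_sub, map_smul, smul_eq_mul]

end Coaction

/-! ### Translations of `V ⊗ T_q` -/

section TensorTranslations

variable {n : ℕ} {q : ℂ} [hq : Generic q]
  {V : Type*} [AddCommGroup V] [Module ℂ V] (𝒱 : ZMod 2 → Submodule ℂ V)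
  [DirectSum.Decomposition 𝒱]

/-- The parity `v ↦ (-1)^{[v]} v` of a super vector space. -/
def superParity : V →ₗ[ℂ] V := LinearMap.id - (2 : ℂ) • oddProj 𝒱

theorem superParity_mem {j : ZMod 2} {v : V} (hv : v ∈ 𝒱 j) :
    superParity 𝒱 v = (if j = 0 then (1 : ℂ) else -1) • v := by
  rw [superParity, LinearMap.sub_apply, LinearMap.smul_apply, LinearMap.id_apply]
  rcases zmod_two j with rfl | rfl
  · rw [oddProj_even _ hv, if_pos rfl]; module
  · rw [oddProj_odd _ hv, if_neg one_ne_zero]; module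

theorem superParity_superParity : superParity 𝒱 ∘ₗ superParity 𝒱 = LinearMap.id := by
  refine LinearMap.ext fun v => ?_
  induction v using DirectSum.Decomposition.inductionOn 𝒱 with
  | zero => simp only [map_zero]
  | add x y hx hy => rw [map_add, hx, hy, map_add]
  | @homogeneous i v =>
    rw [LinearMap.comp_apply, superParity_mem 𝒱 v.2, map_smul, superParity_mem 𝒱 v.2, smul_smul]
    rcases zmod_two i with rfl | rfl <;> simp

theorem signedExtend_even {A : Uq n q → (Tq n q →ₗ[ℂ] Tq n q)} (hA : A 0 = 0) {x : Uq n q}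
    (hx : x ∈ Uq.grading n q 0) :
    signedExtend 𝒱 A x = TensorProduct.map LinearMap.id (A x) := by
  rw [signedExtend, oddProj_even _ hx, hA, TensorProduct.map_zero_right, smul_zero, sub_zero]

theorem signedExtend_odd {A : Uq n q → (Tq n q →ₗ[ℂ] Tq n q)} {x : Uq n q}
    (hx : x ∈ Uq.grading n q 1) :
    signedExtend 𝒱 A x = TensorProduct.map (superParity 𝒱) (A x) := by
  rw [signedExtend, oddProj_odd _ hx]
  apply TensorProduct.ext'
  intro v f
  change v ⊗ₜ[ℂ] A x f - (2 : ℂ) • (oddProj 𝒱 v ⊗ₜ[ℂ] A x f) =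
    (v - (2 : ℂ) • oddProj 𝒱 v) ⊗ₜ[ℂ] A x f
  rw [TensorProduct.sub_tmul, TensorProduct.smul_tmul']

theorem signedExtend_add {A : Uq n q → (Tq n q →ₗ[ℂ] Tq n q)} (hA : ∀ x y, A (x + y) = A x + A y)
    (x y : Uq n q) : signedExtend 𝒱 A (x + y) = signedExtend 𝒱 A x + signedExtend 𝒱 A y := by
  simp only [signedExtend, map_add, hA, TensorProduct.map_add_right, smul_add]
  abel

/-- The parity of a super vector space in degree `1`, the identity in degree `0`: the operator
`v ↦ (-1)^{i [v]} v`. -/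
def degreeSign (i : ZMod 2) : V →ₗ[ℂ] V := if i = 0 then LinearMap.id else superParity 𝒱

theorem Tq.circ_zero : Tq.circ (0 : Uq n q) = 0 :=
  (AddMonoidHom.mk' (Tq.circ (n := n) (q := q)) Tq.circ_add).map_zero

theorem Tq.dot_zero : Tq.dot (0 : Uq n q) = 0 :=
  (AddMonoidHom.mk' (Tq.dot (n := n) (q := q)) Tq.dot_add).map_zero

theorem circV_of_mem {j : ZMod 2} {y : Uq n q} (hy : y ∈ Uq.grading n q j) :
    circV 𝒱 y = TensorProduct.map (degreeSign 𝒱 j) (Tq.circ y) := by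
  rcases zmod_two j with rfl | rfl
  · exact signedExtend_even 𝒱 Tq.circ_zero hy
  · exact signedExtend_odd 𝒱 hy

theorem dotV_of_mem {i : ZMod 2} {x : Uq n q} (hx : x ∈ Uq.grading n q i) :
    dotV 𝒱 x = TensorProduct.map (degreeSign 𝒱 i) (Tq.dot x) := by
  rcases zmod_two i with rfl | rfl
  · exact signedExtend_even 𝒱 Tq.dot_zero hx
  · exact signedExtend_odd 𝒱 hx

theorem circV_add (x y : Uq n q) : circV 𝒱 (x + y) = circV 𝒱 x + circV 𝒱 y :=
  signedExtend_add 𝒱 Tq.circ_add x y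

theorem dotV_add (x y : Uq n q) : dotV 𝒱 (x + y) = dotV 𝒱 x + dotV 𝒱 y :=
  signedExtend_add 𝒱 Tq.dot_add x y

theorem dotV_smul (c : ℂ) (x : Uq n q) : dotV 𝒱 (c • x) = c • dotV 𝒱 x := by
  simp only [dotV, signedExtend, map_smul, Tq.dot_smul, TensorProduct.map_smul_right, smul_sub]
  rw [smul_comm]

theorem dotV_one : dotV 𝒱 (1 : Uq n q) = LinearMap.id := by
  rw [dotV_of_mem 𝒱 (SetLike.GradedOne.one_mem (A := Uq.grading n q)), Tq.dot_one]
  exact TensorProduct.map_id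

theorem degreeSign_comp (i j : ZMod 2) :
    degreeSign 𝒱 i ∘ₗ degreeSign 𝒱 j = degreeSign 𝒱 (i + j) := by
  rcases zmod_two i with rfl | rfl <;> rcases zmod_two j with rfl | rfl <;>
    simp [degreeSign, superParity_superParity, show (1 : ZMod 2) + 1 = 0 from rfl]

theorem dotV_mul (x y : Uq n q) : dotV 𝒱 (x * y) = dotV 𝒱 x ∘ₗ dotV 𝒱 y := by
  have hom {i j : ZMod 2} {x y : Uq n q} (hx : x ∈ Uq.grading n q i)
      (hy : y ∈ Uq.grading n q j) : dotV 𝒱 (x * y) = dotV 𝒱 x ∘ₗ dotV 𝒱 y := by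
    rw [dotV_of_mem 𝒱 hx, dotV_of_mem 𝒱 hy, dotV_of_mem 𝒱 (SetLike.mul_mem_graded hx hy),
      ← TensorProduct.map_comp, Tq.dot_dot hx hy, degreeSign_comp]
  have hx0 := Uq.sub_oddProj_mem x
  have hx1 := Uq.oddProj_mem x
  have hy0 := Uq.sub_oddProj_mem y
  have hy1 := Uq.oddProj_mem y
  rw [← sub_add_cancel x (oddProj (Uq.grading n q) x),
    ← sub_add_cancel y (oddProj (Uq.grading n q) y), add_mul, mul_add, mul_add]
  simp only [dotV_add 𝒱, hom hx0 hy0, hom hx0 hy1, hom hx1 hy0, hom hx1 hy1, LinearMap.comp_add,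
    LinearMap.add_comp]
  exact add_add_add_comm _ _ _ _

theorem circV_dotV {i j : ZMod 2} {x y : Uq n q} (hx : x ∈ Uq.grading n q i)
    (hy : y ∈ Uq.grading n q j) :
    circV 𝒱 y ∘ₗ dotV 𝒱 x =
      (if i = 1 ∧ j = 1 then (-1 : ℂ) else 1) • (dotV 𝒱 x ∘ₗ circV 𝒱 y) := by
  rw [circV_of_mem 𝒱 hy, dotV_of_mem 𝒱 hx, ← TensorProduct.map_comp, ← TensorProduct.map_comp,
    Tq.circ_dot hx hy, degreeSign_comp, degreeSign_comp, add_comm, TensorProduct.map_smul_right]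

theorem tensorParity_eq :
    tensorParity (n := n) (q := q) 𝒱 = TensorProduct.map (degreeSign 𝒱 1) (Tq.parity n q) := rfl

theorem tensorParity_circV {j : ZMod 2} {y : Uq n q} (hy : y ∈ Uq.grading n q j) :
    tensorParity 𝒱 ∘ₗ circV 𝒱 y =
      (if j = 0 then (1 : ℂ) else -1) • (circV 𝒱 y ∘ₗ tensorParity 𝒱) := by
  rw [tensorParity_eq, circV_of_mem 𝒱 hy, ← TensorProduct.map_comp, ← TensorProduct.map_comp,
    Tq.parity_circ hy, degreeSign_comp, degreeSign_comp, add_comm, TensorProduct.map_smul_right]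

theorem tensorParity_dotV {i : ZMod 2} {x : Uq n q} (hx : x ∈ Uq.grading n q i) :
    tensorParity 𝒱 ∘ₗ dotV 𝒱 x =
      (if i = 0 then (1 : ℂ) else -1) • (dotV 𝒱 x ∘ₗ tensorParity 𝒱) := by
  rw [tensorParity_eq, dotV_of_mem 𝒱 hx, ← TensorProduct.map_comp, ← TensorProduct.map_comp,
    Tq.parity_dot hx, degreeSign_comp, degreeSign_comp, add_comm, TensorProduct.map_smul_right]

theorem dotV_mem_tensorGrading {i j : ZMod 2} {x : Uq n q} {ζ : V ⊗[ℂ] Tq n q}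
    (hx : x ∈ Uq.grading n q i) (hζ : ζ ∈ tensorGrading 𝒱 j) :
    dotV 𝒱 x ζ ∈ tensorGrading 𝒱 (i + j) := by
  rw [tensorGrading, mem_parityGrading] at hζ ⊢
  have h := LinearMap.congr_fun (tensorParity_dotV 𝒱 hx) ζ
  rw [LinearMap.comp_apply, LinearMap.smul_apply, LinearMap.comp_apply, hζ, map_smul,
    smul_smul] at h
  rw [h]
  congr 1
  rcases zmod_two i with rfl | rfl <;> rcases zmod_two j with rfl | rfl <;>
    simp [show (1 : ZMod 2) + 1 = 0 from rfl]

end TensorTranslations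

/-! ### The co-action on `V ⊗ T_q` -/

section TensorCoaction

variable {n : ℕ} {q : ℂ} [hq : Generic q] {V : Type*} [AddCommGroup V] [Module ℂ V]

theorem lTensor_assoc_symm {A B C : Type*} [AddCommGroup A] [Module ℂ A] [AddCommGroup B]
    [Module ℂ B] [AddCommGroup C] [Module ℂ C] (φ : B →ₗ[ℂ] C) (v : V) (z : A ⊗[ℂ] B) :
    LinearMap.lTensor (V ⊗[ℂ] A) φ ((TensorProduct.assoc ℂ V A B).symm (v ⊗ₜ z)) =
      (TensorProduct.assoc ℂ V A C).symm (v ⊗ₜ LinearMap.lTensor A φ z) := by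
  induction z with
  | zero => simp only [map_zero, TensorProduct.tmul_zero]
  | add x y hx hy => simp only [map_add, TensorProduct.tmul_add, hx, hy]
  | tmul a b => rfl

theorem assoc_rTensor_assoc_symm {A : Type*} [AddCommGroup A] [Module ℂ A]
    (δ : A →ₗ[ℂ] A ⊗[ℂ] A) (v : V) (z : A ⊗[ℂ] A) :
    TensorProduct.assoc ℂ (V ⊗[ℂ] A) A A
        (LinearMap.rTensor A ((TensorProduct.assoc ℂ V A A).symm.toLinearMap ∘ₗ
          LinearMap.lTensor V δ) ((TensorProduct.assoc ℂ V A A).symm (v ⊗ₜ z))) =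
      (TensorProduct.assoc ℂ V A (A ⊗[ℂ] A)).symm
        (v ⊗ₜ TensorProduct.assoc ℂ A A A (LinearMap.rTensor A δ z)) := by
  induction z with
  | zero => simp only [map_zero, TensorProduct.tmul_zero]
  | add x y hx hy => simp only [map_add, TensorProduct.tmul_add, hx, hy]
  | tmul a b =>
    rw [TensorProduct.assoc_symm_tmul, LinearMap.rTensor_tmul, LinearMap.rTensor_tmul,
      LinearMap.comp_apply, LinearMap.lTensor_tmul, LinearEquiv.coe_coe]
    induction δ a with
    | zero => simp only [map_zero, TensorProduct.tmul_zero, TensorProduct.zero_tmul]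
    | add x y hx hy =>
      simp only [map_add, TensorProduct.tmul_add, TensorProduct.add_tmul, hx, hy]
    | tmul a b => rfl

/-- If `δ` is co-associative with respect to `Δ`, then so is `id_V ⊗ δ`. -/
theorem coassoc_lTensor {A : Type*} [AddCommGroup A] [Module ℂ A] {δ Δ : A →ₗ[ℂ] A ⊗[ℂ] A}
    (h : ∀ f, TensorProduct.assoc ℂ A A A (LinearMap.rTensor A δ (δ f)) =
      LinearMap.lTensor A Δ (δ f)) {Ω : V ⊗[ℂ] A →ₗ[ℂ] (V ⊗[ℂ] A) ⊗[ℂ] A}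
    (hΩ : Ω = (TensorProduct.assoc ℂ V A A).symm.toLinearMap ∘ₗ LinearMap.lTensor V δ)
    (ζ : V ⊗[ℂ] A) :
    TensorProduct.assoc ℂ (V ⊗[ℂ] A) A A (LinearMap.rTensor A Ω (Ω ζ)) =
      LinearMap.lTensor (V ⊗[ℂ] A) Δ (Ω ζ) := by
  induction ζ with
  | zero => simp only [map_zero]
  | add x y hx hy => simp only [map_add, hx, hy]
  | tmul v f =>
    have e : Ω (v ⊗ₜ f) = (TensorProduct.assoc ℂ V A A).symm (v ⊗ₜ δ f) := by rw [hΩ]; rfl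
    rw [e, lTensor_assoc_symm, ← h, hΩ, assoc_rTensor_assoc_symm]

theorem coactV_tmul (v : V) (f : Tq n q) :
    coactV V n q (v ⊗ₜ f) =
      (TensorProduct.assoc ℂ V (Tq n q) (Tq n q)).symm (v ⊗ₜ Tq.coact n q f) := rfl

/-- An operator `φ ⊗ A` of `V ⊗ T_q` is compatible with `ω` if `A` is compatible with the co-action
of `T_q` on itself. -/
theorem coactV_map (φ : V →ₗ[ℂ] V) (A B : Tq n q →ₗ[ℂ] Tq n q)
    (hA : ∀ f, Tq.coact n q (A f) = TensorProduct.map A B (Tq.coact n q f))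
    (ζ : V ⊗[ℂ] Tq n q) :
    coactV V n q (TensorProduct.map φ A ζ) =
      TensorProduct.map (TensorProduct.map φ A) B (coactV V n q ζ) := by
  induction ζ with
  | zero => simp only [map_zero]
  | add x y hx hy => simp only [map_add, hx, hy]
  | tmul v f =>
    rw [TensorProduct.map_tmul, coactV_tmul, coactV_tmul, hA]
    induction Tq.coact n q f with
    | zero => simp only [map_zero, TensorProduct.tmul_zero]
    | add x y hx hy => simp only [map_add, TensorProduct.tmul_add, hx, hy]
    | tmul a b => rfl

theorem coactV_counit (ζ : V ⊗[ℂ] Tq n q) :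
    TensorProduct.rid ℂ (V ⊗[ℂ] Tq n q)
      (LinearMap.lTensor (V ⊗[ℂ] Tq n q) (Tq.counit n q) (coactV V n q ζ)) = ζ := by
  induction ζ with
  | zero => simp only [map_zero]
  | add x y hx hy => simp only [map_add, hx, hy]
  | tmul v f =>
    rw [coactV_tmul]
    conv_rhs => rw [← Tq.coact_counit f]
    induction Tq.coact n q f with
    | zero => simp only [map_zero, TensorProduct.tmul_zero]
    | add x y hx hy => simp only [map_add, TensorProduct.tmul_add, hx, hy]
    | tmul a b =>
      rw [TensorProduct.assoc_symm_tmul, LinearMap.lTensor_tmul, LinearMap.lTensor_tmul,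
        TensorProduct.rid_tmul, TensorProduct.rid_tmul, TensorProduct.tmul_smul]

theorem coactV_coassoc (ζ : V ⊗[ℂ] Tq n q) :
    TensorProduct.assoc ℂ (V ⊗[ℂ] Tq n q) (Tq n q) (Tq n q)
        (LinearMap.rTensor (Tq n q) (coactV V n q) (coactV V n q ζ)) =
      LinearMap.lTensor (V ⊗[ℂ] Tq n q) (Tq.comul n q) (coactV V n q ζ) :=
  coassoc_lTensor Tq.coact_coassoc rfl ζ

end TensorCoaction

/-! ### Tensor products of equalizers and comodules on subspaces -/

section Subspaces

/-- Over a field, tensoring commutes with intersections of equalizers. -/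
theorem mem_range_rTensor_iInf_eqLocus {ι : Sort*} {M M' N : Type*} [AddCommGroup M] [Module ℂ M]
    [AddCommGroup M'] [Module ℂ M'] [AddCommGroup N] [Module ℂ N] (A B : ι → M →ₗ[ℂ] M')
    {z : M ⊗[ℂ] N} (h : ∀ i, LinearMap.rTensor N (A i) z = LinearMap.rTensor N (B i) z) :
    z ∈ LinearMap.range
      (LinearMap.rTensor N (⨅ i, LinearMap.eqLocus (A i) (B i) : Submodule ℂ M).subtype) := by
  classical
  -- In a basis of `N` the hypothesis holds for each coefficient of `z`.
  set b := Module.Basis.ofVectorSpace ℂ N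
  obtain ⟨c, rfl⟩ := TensorProduct.eq_repr_basis_right b z
  refine Submodule.sum_mem _ fun k _ => ?_
  have hk : c k ∈ (⨅ i, LinearMap.eqLocus (A i) (B i) : Submodule ℂ M) := by
    rw [Submodule.mem_iInf]
    intro i
    rw [LinearMap.mem_eqLocus, ← sub_eq_zero, ← LinearMap.sub_apply]
    have h0 : (c.mapRange (A i - B i) (map_zero _)).sum (fun k m => m ⊗ₜ[ℂ] b k) = 0 := by
      refine (Finsupp.sum_mapRange_index (h := fun k (m : M') => m ⊗ₜ[ℂ] b k)
        fun _ => TensorProduct.zero_tmul _ _).trans ?_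
      have h1 := h i
      rw [← sub_eq_zero, ← LinearMap.sub_apply, ← LinearMap.rTensor_sub, Finsupp.sum,
        map_sum] at h1
      exact h1
    have h2 := TensorProduct.sum_tmul_basis_right_eq_zero b _ h0
    simpa using DFunLike.congr_fun h2 k
  exact ⟨⟨c k, hk⟩ ⊗ₜ b k, rfl⟩

theorem rTensor_subtype_injective {M N : Type*} [AddCommGroup M] [Module ℂ M] [AddCommGroup N]
    [Module ℂ N] (H : Submodule ℂ M) : Function.Injective (LinearMap.rTensor N H.subtype) :=
  Module.Flat.rTensor_preserves_injective_linearMap _ H.injective_subtype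

variable {n : ℕ} {q : ℂ} [hq : Generic q]

/-- A subspace `H` that a co-action maps into `H ⊗ T_q` is a comodule. -/
theorem IsRightComodule.restrict {M : Type*} [AddCommGroup M] [Module ℂ M] {H : Submodule ℂ M}
    {Ω : M →ₗ[ℂ] M ⊗[ℂ] Tq n q} (hΩ : IsRightComodule Ω) {ω : H →ₗ[ℂ] H ⊗[ℂ] Tq n q}
    (hω : ∀ ζ, LinearMap.rTensor (Tq n q) H.subtype (ω ζ) = Ω ζ.1) : IsRightComodule ω where
  coassoc := by
    refine LinearMap.ext fun ζ =>
      rTensor_subtype_injective (N := Tq n q ⊗[ℂ] Tq n q) H ?_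
    have h1 := LinearMap.congr_fun hΩ.coassoc ζ.1
    simp only [LinearMap.comp_apply, LinearEquiv.coe_coe, ← hω] at h1 ⊢
    have e1 (z : (H ⊗[ℂ] Tq n q) ⊗[ℂ] Tq n q) :
        LinearMap.rTensor (Tq n q ⊗[ℂ] Tq n q) H.subtype
          (TensorProduct.assoc ℂ H (Tq n q) (Tq n q) z) =
        TensorProduct.assoc ℂ M (Tq n q) (Tq n q)
          (LinearMap.rTensor (Tq n q) (LinearMap.rTensor (Tq n q) H.subtype) z) :=
      LinearMap.congr_fun (f := LinearMap.rTensor (Tq n q ⊗[ℂ] Tq n q) H.subtype ∘ₗ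
          (TensorProduct.assoc ℂ H (Tq n q) (Tq n q)).toLinearMap)
        (g := (TensorProduct.assoc ℂ M (Tq n q) (Tq n q)).toLinearMap ∘ₗ
          LinearMap.rTensor (Tq n q) (LinearMap.rTensor (Tq n q) H.subtype))
        (TensorProduct.ext_threefold fun _ _ _ => rfl) z
    have e2 (z : H ⊗[ℂ] Tq n q) : LinearMap.rTensor (Tq n q ⊗[ℂ] Tq n q) H.subtype
          (LinearMap.lTensor H (Tq.comul n q) z) =
        LinearMap.lTensor M (Tq.comul n q) (LinearMap.rTensor (Tq n q) H.subtype z) :=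
      LinearMap.congr_fun (f := LinearMap.rTensor (Tq n q ⊗[ℂ] Tq n q) H.subtype ∘ₗ
          LinearMap.lTensor H (Tq.comul n q))
        (g := LinearMap.lTensor M (Tq.comul n q) ∘ₗ LinearMap.rTensor (Tq n q) H.subtype)
        (TensorProduct.ext' fun _ _ => rfl) z
    have h2 : LinearMap.rTensor (Tq n q) H.subtype ∘ₗ ω = Ω ∘ₗ H.subtype := LinearMap.ext hω
    rw [e1, e2, ← h1, ← LinearMap.rTensor_comp_apply, ← LinearMap.rTensor_comp_apply, h2]
  counit := by
    refine LinearMap.ext fun ζ => Subtype.ext ?_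
    have h1 := LinearMap.congr_fun hΩ.counit ζ.1
    simp only [LinearMap.comp_apply, LinearEquiv.coe_coe, ← hω] at h1 ⊢
    have e (z : H ⊗[ℂ] Tq n q) :
        H.subtype (TensorProduct.rid ℂ H (LinearMap.lTensor H (Tq.counit n q) z)) =
        TensorProduct.rid ℂ M
          (LinearMap.lTensor M (Tq.counit n q) (LinearMap.rTensor (Tq n q) H.subtype z)) :=
      LinearMap.congr_fun (f := H.subtype ∘ₗ (TensorProduct.rid ℂ H).toLinearMap ∘ₗ
          LinearMap.lTensor H (Tq.counit n q))
        (g := (TensorProduct.rid ℂ M).toLinearMap ∘ₗ LinearMap.lTensor M (Tq.counit n q) ∘ₗ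
          LinearMap.rTensor (Tq n q) H.subtype)
        (TensorProduct.ext' fun _ _ => rfl) z
    exact (e _).trans h1

end Subspaces

/-! ### The sections -/

section SectionModule

variable {n : ℕ} {q : ℂ} [hq : Generic q] {Θ : Set (Fin n)}
  {V : Type*} [AddCommGroup V] [Module ℂ V]
  [Module (Uq.levi q Θ) V] [IsScalarTower ℂ (Uq.levi q Θ) V]
  (𝒱 : ZMod 2 → Submodule ℂ V) [DirectSum.Decomposition 𝒱]

/-- The operator `v ↦ S(x) v` on `V`. -/
def antipodeSmul (V : Type*) [AddCommGroup V] [Module ℂ V] [Module (Uq.levi q Θ) V]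
    [IsScalarTower ℂ (Uq.levi q Θ) V] (x : Uq.levi q Θ) : V →ₗ[ℂ] V :=
  Algebra.lsmul ℂ ℂ V (⟨Uq.antipode n q x, Uq.antipode_mem_levi x.2⟩ : Uq.levi q Θ)

theorem antipodeSmul_add (x y : Uq.levi q Θ) :
    antipodeSmul V (x + y) = antipodeSmul V x + antipodeSmul V y := by
  unfold antipodeSmul
  rw [← map_add]
  congr 1
  exact Subtype.ext (map_add (Uq.antipode n q) x.1 y.1)

theorem mem_qSections_iff (ζ : V ⊗[ℂ] Tq n q) :
    ζ ∈ qSections q 𝒱 Θ ↔ ∀ x : Uq.levi q Θ, circV 𝒱 (x : Uq n q) ζ =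
      LinearMap.rTensor (Tq n q) (antipodeSmul V x) ζ :=
  mem_qSections 𝒱 Θ ζ

/-- The equations that define the sections need only be checked for homogeneous `x`. -/
theorem mem_qSections_of_homogeneous {ζ : V ⊗[ℂ] Tq n q}
    (h : ∀ (j : ZMod 2) (y : Uq.levi q Θ), (y : Uq n q) ∈ Uq.grading n q j →
      circV 𝒱 (y : Uq n q) ζ = LinearMap.rTensor (Tq n q) (antipodeSmul V y) ζ) :
    ζ ∈ qSections q 𝒱 Θ := by
  rw [mem_qSections_iff]
  intro x
  set x1 : Uq.levi q Θ := ⟨_, Uq.oddProj_mem_levi x.2⟩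
  rw [← sub_add_cancel x x1, antipodeSmul_add, LinearMap.rTensor_add, Subalgebra.coe_add,
    circV_add, LinearMap.add_apply, LinearMap.add_apply, h 0 (x - x1) (Uq.sub_oddProj_mem x.1),
    h 1 x1 (Uq.oddProj_mem x.1)]

variable {𝒱}

theorem superParity_antipodeSmul
    (h𝒱 : ∀ (i j : ZMod 2) (x : Uq.levi q Θ) (v : V),
      (x : Uq n q) ∈ Uq.grading n q i → v ∈ 𝒱 j → x • v ∈ 𝒱 (i + j))
    {j : ZMod 2} {y : Uq.levi q Θ} (hy : (y : Uq n q) ∈ Uq.grading n q j) :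
    superParity 𝒱 ∘ₗ antipodeSmul V y =
      (if j = 0 then (1 : ℂ) else -1) • (antipodeSmul V y ∘ₗ superParity 𝒱) := by
  refine LinearMap.ext fun v => ?_
  induction v using DirectSum.Decomposition.inductionOn 𝒱 with
  | zero => simp only [map_zero]
  | add x y hx hy => rw [map_add, hx, hy, map_add]
  | @homogeneous i v =>
    have h1 : antipodeSmul V y v ∈ 𝒱 (j + i) := h𝒱 j i _ _ (Uq.antipode_mem hy) v.2
    rw [LinearMap.smul_apply, LinearMap.comp_apply, LinearMap.comp_apply, superParity_mem 𝒱 h1,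
      superParity_mem 𝒱 v.2, map_smul, smul_smul]
    congr 1
    rcases zmod_two i with rfl | rfl <;> rcases zmod_two j with rfl | rfl <;>
      simp [show (1 : ZMod 2) + 1 = 0 from rfl]

theorem degreeSign_antipodeSmul
    (h𝒱 : ∀ (i j : ZMod 2) (x : Uq.levi q Θ) (v : V),
      (x : Uq n q) ∈ Uq.grading n q i → v ∈ 𝒱 j → x • v ∈ 𝒱 (i + j))
    (i : ZMod 2) {j : ZMod 2} {y : Uq.levi q Θ} (hy : (y : Uq n q) ∈ Uq.grading n q j) :
    antipodeSmul V y ∘ₗ degreeSign 𝒱 i =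
      (if i = 1 ∧ j = 1 then (-1 : ℂ) else 1) • (degreeSign 𝒱 i ∘ₗ antipodeSmul V y) := by
  rcases zmod_two i with rfl | rfl
  · simp [degreeSign]
  · simp only [degreeSign, one_ne_zero, if_false, superParity_antipodeSmul h𝒱 hy, smul_smul]
    rcases zmod_two j with rfl | rfl <;> simp

/-- An operator that commutes, up to the same sign, with the right translations and with the
operators `S(y) ⊗ id` preserves the sections. -/
theorem mem_qSections_of_comm {D : V ⊗[ℂ] Tq n q →ₗ[ℂ] V ⊗[ℂ] Tq n q} (s : ZMod 2 → ℂ)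
    (h1 : ∀ (j : ZMod 2) (y : Uq.levi q Θ), (y : Uq n q) ∈ Uq.grading n q j →
      circV 𝒱 (y : Uq n q) ∘ₗ D = s j • (D ∘ₗ circV 𝒱 (y : Uq n q)))
    (h2 : ∀ (j : ZMod 2) (y : Uq.levi q Θ), (y : Uq n q) ∈ Uq.grading n q j →
      LinearMap.rTensor (Tq n q) (antipodeSmul V y) ∘ₗ D =
        s j • (D ∘ₗ LinearMap.rTensor (Tq n q) (antipodeSmul V y)))
    {ζ : V ⊗[ℂ] Tq n q} (hζ : ζ ∈ qSections q 𝒱 Θ) : D ζ ∈ qSections q 𝒱 Θ := by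
  refine mem_qSections_of_homogeneous 𝒱 fun j y hy => ?_
  have e1 := LinearMap.congr_fun (h1 j y hy) ζ
  have e2 := LinearMap.congr_fun (h2 j y hy) ζ
  simp only [LinearMap.comp_apply, LinearMap.smul_apply] at e1 e2
  rw [e1, e2, (mem_qSections_iff 𝒱 ζ).1 hζ y]

theorem rTensor_antipodeSmul_map
    (h𝒱 : ∀ (i j : ZMod 2) (x : Uq.levi q Θ) (v : V),
      (x : Uq n q) ∈ Uq.grading n q i → v ∈ 𝒱 j → x • v ∈ 𝒱 (i + j))
    (i : ZMod 2) {j : ZMod 2} {y : Uq.levi q Θ} (hy : (y : Uq n q) ∈ Uq.grading n q j)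
    (A : Tq n q →ₗ[ℂ] Tq n q) :
    LinearMap.rTensor (Tq n q) (antipodeSmul V y) ∘ₗ TensorProduct.map (degreeSign 𝒱 i) A =
      (if i = 1 ∧ j = 1 then (-1 : ℂ) else 1) •
        (TensorProduct.map (degreeSign 𝒱 i) A ∘ₗ
          LinearMap.rTensor (Tq n q) (antipodeSmul V y)) := by
  rw [LinearMap.rTensor, ← TensorProduct.map_comp, ← TensorProduct.map_comp,
    degreeSign_antipodeSmul h𝒱 i hy, TensorProduct.map_smul_left, LinearMap.id_comp,
    LinearMap.comp_id]

theorem tensorParity_mem_qSections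
    (h𝒱 : ∀ (i j : ZMod 2) (x : Uq.levi q Θ) (v : V),
      (x : Uq n q) ∈ Uq.grading n q i → v ∈ 𝒱 j → x • v ∈ 𝒱 (i + j))
    {ζ : V ⊗[ℂ] Tq n q} (hζ : ζ ∈ qSections q 𝒱 Θ) :
    tensorParity 𝒱 ζ ∈ qSections q 𝒱 Θ := by
  refine mem_qSections_of_comm (D := tensorParity 𝒱)
    (fun j => if (1 : ZMod 2) = 1 ∧ j = 1 then (-1 : ℂ) else 1)
    (fun j y hy => ?_) (fun j y hy => rTensor_antipodeSmul_map h𝒱 1 hy _) hζ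
  rw [tensorParity_circV 𝒱 hy, smul_smul]
  rcases zmod_two j with rfl | rfl <;> simp

theorem dotV_mem_qSections
    (h𝒱 : ∀ (i j : ZMod 2) (x : Uq.levi q Θ) (v : V),
      (x : Uq n q) ∈ Uq.grading n q i → v ∈ 𝒱 j → x • v ∈ 𝒱 (i + j))
    (x : Uq n q) {ζ : V ⊗[ℂ] Tq n q} (hζ : ζ ∈ qSections q 𝒱 Θ) :
    dotV 𝒱 x ζ ∈ qSections q 𝒱 Θ := by
  have hom {i : ZMod 2} {x : Uq n q} (hx : x ∈ Uq.grading n q i) :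
      dotV 𝒱 x ζ ∈ qSections q 𝒱 Θ := by
    refine mem_qSections_of_comm (fun j => if i = 1 ∧ j = 1 then (-1 : ℂ) else 1)
      (fun j y hy => circV_dotV 𝒱 hx hy) (fun j y hy => ?_) hζ
    rw [dotV_of_mem 𝒱 hx]
    exact rTensor_antipodeSmul_map h𝒱 i hy _
  rw [← sub_add_cancel x (oddProj (Uq.grading n q) x), dotV_add, LinearMap.add_apply]
  exact add_mem (hom (Uq.sub_oddProj_mem x)) (hom (Uq.oddProj_mem x))

/-- The left `U_q`-module structure of the sections. -/
def sectionsRep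
    (h𝒱 : ∀ (i j : ZMod 2) (x : Uq.levi q Θ) (v : V),
      (x : Uq n q) ∈ Uq.grading n q i → v ∈ 𝒱 j → x • v ∈ 𝒱 (i + j)) :
    Uq n q →ₐ[ℂ] Module.End ℂ (qSections q 𝒱 Θ) :=
  AlgHom.ofLinearMap
    { toFun := fun x => (dotV 𝒱 x).restrict fun _ => dotV_mem_qSections h𝒱 x
      map_add' := fun x y => LinearMap.ext fun ζ =>
        Subtype.ext (LinearMap.congr_fun (dotV_add 𝒱 x y) ζ.1)
      map_smul' := fun c x => LinearMap.ext fun ζ =>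
        Subtype.ext (LinearMap.congr_fun (dotV_smul 𝒱 c x) ζ.1) }
    (LinearMap.ext fun ζ => Subtype.ext (LinearMap.congr_fun (dotV_one 𝒱) ζ.1))
    (fun x y => LinearMap.ext fun ζ => Subtype.ext (LinearMap.congr_fun (dotV_mul 𝒱 x y) ζ.1))

theorem coactV_circV (y : Uq n q) (ζ : V ⊗[ℂ] Tq n q) :
    coactV V n q (circV 𝒱 y ζ) = LinearMap.rTensor (Tq n q) (circV 𝒱 y) (coactV V n q ζ) := by
  have hom {j : ZMod 2} {y : Uq n q} (hy : y ∈ Uq.grading n q j) :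
      coactV V n q (circV 𝒱 y ζ) =
        LinearMap.rTensor (Tq n q) (circV 𝒱 y) (coactV V n q ζ) := by
    rw [circV_of_mem 𝒱 hy]
    exact coactV_map _ _ LinearMap.id (Tq.coact_circ y) ζ
  rw [← sub_add_cancel y (oddProj (Uq.grading n q) y), circV_add, LinearMap.rTensor_add,
    LinearMap.add_apply, LinearMap.add_apply, map_add, hom (Uq.sub_oddProj_mem y),
    hom (Uq.oddProj_mem y)]

/-- `ω` commutes with the right translations and with the operators of `V`, hence it maps the
sections into `H_q(V) ⊗ T_q`. -/
theorem coactV_mem_range {ζ : V ⊗[ℂ] Tq n q} (hζ : ζ ∈ qSections q 𝒱 Θ) :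
    coactV V n q ζ ∈
      LinearMap.range (LinearMap.rTensor (Tq n q) (qSections q 𝒱 Θ).subtype) := by
  refine mem_range_rTensor_iInf_eqLocus _ _ fun x : Uq.levi q Θ => ?_
  rw [← coactV_circV]
  refine (congrArg (coactV V n q) ((mem_qSections_iff 𝒱 ζ).1 hζ x)).trans ?_
  refine coactV_map (antipodeSmul V x) LinearMap.id LinearMap.id (fun f => ?_) ζ
  rw [TensorProduct.map_id]
  rfl

/-- The restriction `H_q(V) → H_q(V) ⊗ T_q` of `ω`. -/
def sectionsCoact (𝒱 : ZMod 2 → Submodule ℂ V) [DirectSum.Decomposition 𝒱] :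
    qSections q 𝒱 Θ →ₗ[ℂ] qSections q 𝒱 Θ ⊗[ℂ] Tq n q :=
  (LinearEquiv.ofInjective _
      (rTensor_subtype_injective (N := Tq n q) (qSections q 𝒱 Θ))).symm.toLinearMap ∘ₗ
    LinearMap.codRestrict _ (coactV V n q ∘ₗ (qSections q 𝒱 Θ).subtype)
      (fun ζ => coactV_mem_range ζ.2)

theorem rTensor_sectionsCoact (ζ : qSections q 𝒱 Θ) :
    LinearMap.rTensor (Tq n q) (qSections q 𝒱 Θ).subtype (sectionsCoact 𝒱 ζ) =
      coactV V n q ζ.1 :=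
  LinearEquiv.ofInjective_symm_apply _
    (h := rTensor_subtype_injective (N := Tq n q) (qSections q 𝒱 Θ)) _

theorem coactV_isRightComodule (V : Type*) [AddCommGroup V] [Module ℂ V] :
    IsRightComodule (coactV V n q) where
  coassoc := LinearMap.ext coactV_coassoc
  counit := LinearMap.ext coactV_counit

end SectionModule

end QOsp

end

theorem mainTheorem10 (n : ℕ) (q : ℂ) [QOsp.Generic q] (Θ : Set (Fin n))
    {V : Type*} [AddCommGroup V] [Module ℂ V] [FiniteDimensional ℂ V]
    [Module (QOsp.Uq.levi q Θ) V] [IsScalarTower ℂ (QOsp.Uq.levi q Θ) V]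
    (𝒱 : ZMod 2 → Submodule ℂ V) [DirectSum.Decomposition 𝒱]
    (h𝒱 : ∀ (i j : ZMod 2) (x : QOsp.Uq.levi q Θ) (v : V),
      (x : QOsp.Uq n q) ∈ QOsp.Uq.grading n q i → v ∈ 𝒱 j → x • v ∈ 𝒱 (i + j)) :
    -- `H_q(V)` is a `ℤ/2`-graded subspace of `V ⊗ T_q`
    (∀ ζ ∈ QOsp.qSections q 𝒱 Θ, QOsp.tensorParity 𝒱 ζ ∈ QOsp.qSections q 𝒱 Θ) ∧
    -- it is a (graded) left module under left translations
    (∃ ρ : QOsp.Uq n q →ₐ[ℂ] Module.End ℂ (QOsp.qSections q 𝒱 Θ),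
      (∀ (x : QOsp.Uq n q) (ζ : QOsp.qSections q 𝒱 Θ),
        (ρ x ζ).1 = QOsp.dotV 𝒱 x ζ.1) ∧
      (∀ (i j : ZMod 2) (x : QOsp.Uq n q) (ζ : QOsp.qSections q 𝒱 Θ),
        x ∈ QOsp.Uq.grading n q i → ζ.1 ∈ QOsp.tensorGrading 𝒱 j →
          (ρ x ζ).1 ∈ QOsp.tensorGrading 𝒱 (i + j))) ∧
    -- it is a (graded) right comodule under `ω`
    (∃ ω : QOsp.qSections q 𝒱 Θ →ₗ[ℂ] QOsp.qSections q 𝒱 Θ ⊗[ℂ] QOsp.Tq n q,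
      (∀ ζ : QOsp.qSections q 𝒱 Θ,
        LinearMap.rTensor (QOsp.Tq n q) (QOsp.qSections q 𝒱 Θ).subtype (ω ζ) =
          QOsp.coactV V n q ζ.1) ∧
      (∀ ζ ∈ QOsp.qSections q 𝒱 Θ,
        TensorProduct.map (QOsp.tensorParity 𝒱) (QOsp.Tq.parity n q) (QOsp.coactV V n q ζ) =
          QOsp.coactV V n q (QOsp.tensorParity 𝒱 ζ)) ∧
      QOsp.IsRightComodule ω) := by
  refine ⟨fun ζ hζ => QOsp.tensorParity_mem_qSections h𝒱 hζ,
    ⟨QOsp.sectionsRep h𝒱, fun _ _ => rfl, fun i j x ζ hx hζ =>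
      QOsp.dotV_mem_tensorGrading 𝒱 hx hζ⟩,
    QOsp.sectionsCoact 𝒱, QOsp.rTensor_sectionsCoact, fun ζ _ => ?_,
    (QOsp.coactV_isRightComodule V).restrict QOsp.rTensor_sectionsCoact⟩
  exact (QOsp.coactV_map _ _ _ QOsp.Tq.coact_parity ζ).symm
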